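/- Let $\mathbb T$ be the triangular lattice embedded in $\mathbb R^2$ (neighbouring sites at distance $1$), with site set $V(\mathbb T)$, and let its dual be the hexagonal lattice $\mathbb H$, whose sites are the centres of the faces of $\mathbb T$. A configuration is the set $\omega\subseteq V(\mathbb T)$ of open sites. An enhancement function of range $R_0$ is a map $\phi_o$ from configurations to configurations such that $\phi_o(\omega)$ depends only on $\omega\cap\mathbb B_o$ and $\phi_o(\omega)\subseteq\mathbb B_o$, where $\mathbb B_o=\{x\in V(\mathbb T):|x|\le R_0\}$. Put $\phi_x(\omega)=x+\phi_o(\tau_x\omega)$ with $\tau_x\omega=\{y:y+x\in\omega\}$; for a set $\alpha\subseteq V(\mathbb T)$ of activated sites, the enhanced configuration is $\hat\omega=\omega\cup\bigcup_{x\in\alpha}\phi_x(\omega)$. The enhancement is monotonic if $\omega\subseteq\omega'$ implies $\phi_o(\omega)\subseteq\phi_o(\omega')$. It is essential if there is a configuration $\omega$ that contains no doubly-infinite self-repelling path (a doubly-infinite self-avoiding path of $\mathbb T$ none of whose sites is adjacent to another site of the path except its two neighbours in the path), while $\omega\cup\phi_o(\omega)$ contains one. For $\delta>0$ and a configuration $\omega$,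 the b-loops of $\omega$ of step size $\delta$ are the closed self-avoiding paths $\xi_0,\xi_1,\dots,\xi_k=\xi_0$ in $\mathbb H$ (any starting point, either orientation) each of whose edges separates an open site from a closed site of $\omega$, scaled by $\delta$ and regarded as closed polygonal curves in $\mathbb R^2$. Let $\mathcal F_\delta$ and $\hat{\mathcal F}_\delta$ be the collections of all b-loops of step size $\delta$ of $\omega$ and of $\hat\omega$, respectively. Let $\mathrm d(u,v)=\inf_f\int(1+|f|^2)^{-1}\,dl$, the infimum being over smooth curves $f$ from $u$ to $v$, with $l$ the arclength. For continuous curves $g_1,g_2$ on $[0,1]$ let $\mathrm D(g_1,g_2)=\inf_{f_1,f_2}\sup_{t\in[0,1]}\mathrm d(g_1(f_1(t)),g_2(f_2(t)))$, the infimum being over monotone (increasing or decreasing) continuous functions $f_1,f_2$ from $[0,1]$ onto itself. For collections $\mathcal F,\mathcal F'$ of curves let $\mathrm{dist}(\mathcal F,\mathcal F')$ be the Hausdorff distance induced by $\mathrm D$: the infimum of all $\varepsilon$ such that every $\mathcal C\in\mathcal F$ has some $\mathcal C'\in\mathcal F'$ with $\mathrm D(\mathcal C,\mathcal C')\le\varepsilon$,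 and vice versa. **Lemma.** Let $\phi_o$ be a monotonic, nonessential enhancement function on $\mathbb T$ (of some range $R_0$) and let $s\in[0,1]$. Let $\omega$ be independent site percolation on $\mathbb T$ at its critical probability $p_c$ (each site is open with probability $p_c$), and let $\alpha$, independent of $\omega$, contain each site independently with probability $s$. Then for almost every $(\omega,\alpha)$ (with respect to the product measure $P_{p_c}\times P'_s$), $$\lim_{\delta\to0}\mathrm{dist}(\mathcal F_\delta,\hat{\mathcal F}_\delta)=0 .$$ -/

import Mathlib

open MeasureTheory ProbabilityTheory Filter Topology
open scoped ENNReal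

noncomputable section

namespace EnhPerc

/-! ### The triangular lattice and its dual, the hexagonal lattice -/

/-- Sites of the triangular lattice `𝕋`: the pair `(a, b)` stands for the point
`a + b e^{iπ/3}` of the plane. -/
abbrev Site : Type := ℤ × ℤ

/-- The position in the plane `ℝ² = ℂ` of a site of `𝕋`; neighbouring sites are at distance `1`. -/
def Site.pos (x : Site) : ℂ := ⟨(x.1 : ℝ) + (x.2 : ℝ) / 2, √3 / 2 * (x.2 : ℝ)⟩

/-- The six vectors joining a site of `𝕋` to its neighbours. -/
def nbrVectors : Finset Site := {(1, 0), (-1, 0), (0, 1), (0, -1), (1, -1), (-1, 1)}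

/-- The triangular lattice `𝕋`. -/
def triLattice : SimpleGraph Site where
  Adj x y := y - x ∈ nbrVectors
  symm := ⟨by
    intro x y h
    simp only [nbrVectors, Finset.mem_insert, Finset.mem_singleton, Prod.ext_iff, Prod.fst_sub,
      Prod.snd_sub] at h ⊢
    omega⟩
  loopless := ⟨by
    intro x h
    simp [nbrVectors, Prod.ext_iff] at h⟩

/-- Sites of the hexagonal lattice `ℍ`, i.e. dual sites, i.e. faces (elementary triangles) of `𝕋`:
`((a, b), true)` is the triangle with vertices `(a, b), (a+1, b), (a, b+1)` and
`((a, b), false)` is the triangle with vertices `(a+1, b), (a, b+1), (a+1, b+1)`. -/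
abbrev DualSite : Type := Site × Bool

/-- The three vertices of a face of `𝕋`. -/
def DualSite.vertices : DualSite → Finset Site
  | ((a, b), true) => {(a, b), (a + 1, b), (a, b + 1)}
  | ((a, b), false) => {(a + 1, b), (a, b + 1), (a + 1, b + 1)}

/-- The position of a dual site: the centre of the face. -/
def DualSite.pos (ξ : DualSite) : ℂ := (∑ x ∈ ξ.vertices, x.pos) / 3

/-- A configuration, represented by its set `ω` of open sites. -/
abbrev Config : Type := Set Site

/-- `Γ(ω)`: the graph on the dual sites whose edges are the unsatisfied dual edges, that is the
edges of `ℍ` (joining two distinct faces with a common lattice edge `(x, y)`) such that one of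
`x, y` is open and the other one is closed. -/
def boundaryGraph (ω : Config) : SimpleGraph DualSite where
  Adj ξ ζ := ξ ≠ ζ ∧ ∃ x y : Site, x ∈ ω ∧ y ∉ ω ∧
    x ∈ ξ.vertices ∧ y ∈ ξ.vertices ∧ x ∈ ζ.vertices ∧ y ∈ ζ.vertices
  symm := ⟨by
    rintro ξ ζ ⟨hne, x, y, hx, hy, h1, h2, h3, h4⟩
    exact ⟨hne.symm, x, y, hx, hy, h3, h4, h1, h2⟩⟩
  loopless := ⟨fun _ h => h.1 rfl⟩

/-! ### Independent percolation and its critical probability -/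

/-- The Bernoulli product measure `P_p` on configurations: each site is open with probability `p`,
independently of the others. -/
abbrev siteMeasure (p : unitInterval) : Measure Config := setBernoulli (Set.univ : Set Site) p

/-- The open cluster of the origin. -/
def originCluster (ω : Config) : Set Site :=
  {y | ∃ w : triLattice.Walk (0 : Site) y, ∀ z ∈ w.support, z ∈ ω}

/-- The percolation probability `θ(p)`. -/
def theta (p : unitInterval) : ℝ≥0∞ := siteMeasure p {ω | (originCluster ω).Infinite}

/-- The critical probability `p_c` of site percolation on `𝕋`. -/
def criticalProb : unitInterval := sInf {p | 0 < theta p}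

/-! ### Enhancements -/

/-- `𝔹_o`, the sites within Euclidean distance `R₀` of the origin. -/
def siteBall (R₀ : ℝ) : Set Site := {x | ‖x.pos‖ ≤ R₀}

/-- `φ` is an enhancement function of range `R₀`. -/
def IsEnhancementFunction (φ : Config → Config) (R₀ : ℝ) : Prop :=
  (∀ ω ω' : Config, ω ∩ siteBall R₀ = ω' ∩ siteBall R₀ → φ ω = φ ω') ∧
    ∀ ω : Config, φ ω ⊆ siteBall R₀

/-- The shift `τ_x ω = {y : y + x ∈ ω}`. -/
def shift (x : Site) (ω : Config) : Config := {y | y + x ∈ ω}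

/-- The translated enhancement function `φ_x(ω) = x + φ(τ_x ω)`. -/
def enhanceAt (φ : Config → Config) (x : Site) (ω : Config) : Config :=
  (fun z => x + z) '' φ (shift x ω)

/-- The enhanced configuration; `α` is the set of sites at which the enhancement is activated. -/
def enhanced (φ : Config → Config) (ω α : Config) : Config :=
  ω ∪ ⋃ x ∈ α, enhanceAt φ x ω

/-- `ω` contains a doubly-infinite self-repelling path. -/
def HasDoublyInfinitePath (ω : Config) : Prop :=
  ∃ γ : ℤ → Site, Function.Injective γ ∧ (∀ n, γ n ∈ ω) ∧
    (∀ n, triLattice.Adj (γ n) (γ (n + 1))) ∧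
    ∀ m n, triLattice.Adj (γ m) (γ n) → n = m + 1 ∨ m = n + 1

/-- The enhancement is essential: for some configuration without doubly-infinite self-repelling
path, the enhancement at the origin produces such a path. -/
def IsEssential (φ : Config → Config) : Prop :=
  ∃ ω : Config, ¬ HasDoublyInfinitePath ω ∧ HasDoublyInfinitePath (ω ∪ φ ω)

/-! ### Curves, and distances between curves and between collections of curves -/

/-- The distance `d(u, v)`: the infimum of `∫ (1 + |f|²)⁻¹ dl` over smooth curves `f` from `u` to
`v`, where `dl = |f'(t)| dt` is the element of arclength. -/
def sphereDist (u v : ℂ) : ℝ :=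
  sInf {r | ∃ f : ℝ → ℂ, ContDiff ℝ ((⊤ : ℕ∞) : WithTop ℕ∞) f ∧ f 0 = u ∧ f 1 = v ∧
    r = ∫ t in (0 : ℝ)..1, (1 + ‖f t‖ ^ 2)⁻¹ * ‖deriv f t‖}

/-- The parametrized continuous curves in the plane. -/
abbrev Curve : Type := C(unitInterval, ℂ)

/-- The monotone (increasing or decreasing) continuous functions from `[0,1]` onto itself. -/
def reparams : Set C(unitInterval, unitInterval) :=
  {f | (Monotone f ∨ Antitone f) ∧ Function.Surjective f}

/-- The distance `D` between (the classes modulo monotone reparametrization of) two curves. -/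
def curveDist (g₁ g₂ : Curve) : ℝ≥0∞ :=
  ⨅ f₁ ∈ reparams, ⨅ f₂ ∈ reparams, ⨆ t : unitInterval,
    ENNReal.ofReal (sphereDist (g₁ (f₁ t)) (g₂ (f₂ t)))

/-- The Hausdorff distance between two collections of curves (`∞` if exactly one of them is
empty). -/
def loopDist (F F' : Set Curve) : ℝ≥0∞ :=
  sInf {ε | (∀ C ∈ F, ∃ C' ∈ F', curveDist C C' ≤ ε) ∧ ∀ C' ∈ F', ∃ C ∈ F, curveDist C C' ≤ ε}

/-- The polygonal curve through `q 0, q 1, …, q k`, parametrized so that it is at `q i` at time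
`i / k` and affine in between. -/
def polyline (q : ℕ → ℂ) (k : ℕ) : Curve where
  toFun t := q 0 + ∑ i ∈ Finset.range k,
    (max 0 (min 1 ((k : ℝ) * (t : ℝ) - i)) : ℝ) • (q (i + 1) - q i)
  continuous_toFun := by fun_prop

/-- The collection of all b-loops of the configuration `ω` on the lattice `δ𝕋`: the closed
self-avoiding paths `ξ₀, ξ₁, …, ξ_k = ξ₀` of dual sites all of whose edges are unsatisfied,
with any starting point and either orientation, drawn as polygonal curves in the plane. -/
def bLoops (δ : ℝ) (ω : Config) : Set Curve :=
  {C | ∃ (ξ : DualSite) (w : (boundaryGraph ω).Walk ξ ξ), w.IsCycle ∧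
    C = polyline (fun i => (δ : ℂ) * (w.getVert i).pos) w.length}

end EnhPerc

end

/-!
The convergence holds at every density, and apart from one probabilistic input it is deterministic:
there is a constant `K`, depending only on the range, such that each loop of `ω` whose diameter
exceeds `K` lattice units can be parametrized together with a loop of the enhanced configuration
`ω̂` so that the two stay within distance `K`, and conversely. After scaling by `δ` such pairs
become close. The remaining loops are small on the lattice scale, and it suffices to find some loop
of the other configuration near each of them. At densities other than `0` and `1` there are almost
surely isolated open sites, surrounded by wide closed regions, within distance `o(|x|)` of every
site `x` (`ae_denselyIsolated`), and the loops around them belong to both configurations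
(`Pattern.isolated_enhanced`). The factor `(1 + |f|²)⁻¹` in the metric makes `o(|x|)` good enough
uniformly in the plane (`sphereDist_le_of_far`). At the densities `0` and `1` there are no loops.

Nonessentiality enters through a single statement, `conn_of_conn_enhanced`: if two boundary sites of
a rectangle are connected inside the rectangle after enhancing a configuration supported there, then
they were connected before. Otherwise straight arms leaving the rectangle at these sites would turn
the connection into a doubly-infinite self-repelling path that was created by the activation of
finitely many sites. Applied to the two sides of a self-repelling closed path, this shows that such
a path stays closed away from its ends (`Admissible.notMem_enhanceAt`). Hence a long closed
connection contains long pieces that stay closed, and a closed cluster of `ω` contains at most one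
large closed cluster of `ω̂` (`Admissible.conn_closed`).

Loops are followed as orbits of the map `nxt ω`, which crosses one face after the other with open
sites on the left. For finite `ω`, take a large open cluster `A` of `ω` and a large closed cluster
`B` of `ω̂`. The faces with a side from `B` to `A`, the gates, are passed by an interface of `ω` and
by an interface of `ω̂`, both times in the same cyclic order (`Separated.first_return_eq`), and
between consecutive gates both interfaces stay within bounded distance (`Matched.rad_left_le`,
`Matched.rad_right_le`). This yields the coupling (`Admissible.exists_stair_of_finite`,
`Admissible.exists_stair_enhanced_of_finite`), and finite loops of arbitrary configurations are
covered by restriction to a large box.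

In place of the Jordan curve theorem the proof uses that the triangular lattice is simply connected
modulo two (`exists_potential`): the numbers of crossings of the lattice edges by a closed dual walk
form a cocycle, hence the walk separates the sites into two classes.
-/

open MeasureTheory ProbabilityTheory Filter Topology
open scoped ENNReal

noncomputable section

namespace EnhPerc

/-! ### Adjacency, connectivity and boxes in the triangular lattice -/

theorem adj_iff {x y : Site} : triLattice.Adj x y ↔
    (y.1 = x.1 + 1 ∧ y.2 = x.2) ∨ (y.1 = x.1 - 1 ∧ y.2 = x.2) ∨ (y.1 = x.1 ∧ y.2 = x.2 + 1) ∨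
    (y.1 = x.1 ∧ y.2 = x.2 - 1) ∨ (y.1 = x.1 + 1 ∧ y.2 = x.2 - 1) ∨
    (y.1 = x.1 - 1 ∧ y.2 = x.2 + 1) := by
  change y - x ∈ nbrVectors ↔ _
  simp only [nbrVectors, Finset.mem_insert, Finset.mem_singleton, Prod.ext_iff, Prod.fst_sub,
    Prod.snd_sub]
  omega

/-- Connectivity of two sites by a lattice path inside `S`. A site is connected to itself even when
it does not lie in `S`. -/
def Conn (S : Set Site) : Site → Site → Prop :=
  Relation.ReflTransGen fun x y => x ∈ S ∧ y ∈ S ∧ triLattice.Adj x y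

theorem Conn.refl (S : Set Site) (a : Site) : Conn S a a := Relation.ReflTransGen.refl

theorem Conn.trans {S : Set Site} {a b c : Site} (h : Conn S a b) (h' : Conn S b c) : Conn S a c :=
  Relation.ReflTransGen.trans h h'

theorem Conn.symm {S : Set Site} {a b : Site} (h : Conn S a b) : Conn S b a := by
  induction h with
  | refl => exact Conn.refl S _
  | tail _ h2 ih => exact Relation.ReflTransGen.head ⟨h2.2.1, h2.1, h2.2.2.symm⟩ ih

theorem Conn.mono {S T : Set Site} (hST : S ⊆ T) {a b : Site} (h : Conn S a b) : Conn T a b :=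
  Relation.ReflTransGen.mono (fun _ _ h => ⟨hST h.1, hST h.2.1, h.2.2⟩) _ _ h

theorem Conn.single {S : Set Site} {a b : Site} (ha : a ∈ S) (hb : b ∈ S)
    (h : triLattice.Adj a b) : Conn S a b :=
  Relation.ReflTransGen.single ⟨ha, hb, h⟩

theorem Conn.single_or_eq {S : Set Site} {a b : Site} (ha : a ∈ S) (hb : b ∈ S)
    (h : a = b ∨ triLattice.Adj a b) : Conn S a b := by
  rcases h with rfl | h
  · exact Conn.refl S a
  · exact Conn.single ha hb h

theorem Conn.mem {S : Set Site} {a b : Site} (h : Conn S a b) (ha : a ∈ S) : b ∈ S := by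
  induction h with
  | refl => exact ha
  | tail _ h2 _ => exact h2.2.1

/-- A property that passes from any site of `S` having it to the neighbours in `S` spreads along
connections. -/
theorem Conn.invariant {S : Set Site} {P : Site → Prop}
    (hP : ∀ x y, x ∈ S → y ∈ S → triLattice.Adj x y → P x → P y) {a b : Site} (h : Conn S a b)
    (ha : P a) : P b := by
  induction h with
  | refl => exact ha
  | tail _ h2 ih => exact hP _ _ h2.1 h2.2.1 h2.2.2 ih

theorem Conn.eq_of_forall_adj {β : Type*} {S : Set Site} {f : Site → β}
    (hf : ∀ x y, x ∈ S → y ∈ S → triLattice.Adj x y → f x = f y) {a b : Site} (h : Conn S a b) :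
    f b = f a :=
  h.invariant (P := fun x => f x = f a) (fun x y hx hy hxy h => (hf x y hx hy hxy).symm.trans h) rfl

/-- The part of `S` connected to `a` is itself connected. -/
theorem Conn.cluster {S : Set Site} {a b : Site} (h : Conn S a b) : Conn {x | Conn S a x} a b := by
  induction h with
  | refl => exact Conn.refl _ _
  | tail h1 h2 ih =>
    exact ih.trans (Conn.single h1 (Relation.ReflTransGen.tail h1 h2) h2.2.2)

/-- First passage of a function that changes by at most one along edges. -/
theorem Conn.exists_first {S : Set Site} {h : Site → ℤ}
    (hh : ∀ x y, triLattice.Adj x y → h y ≤ h x + 1) {a b : Site} (hc : Conn S a b) (ha : a ∈ S)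
    {t : ℤ} (hat : h a ≤ t) (htb : t ≤ h b) :
    ∃ e ∈ S, h e = t ∧ Conn (S ∩ {x | h x ≤ t}) a e := by
  have key : (Conn (S ∩ {x | h x ≤ t}) a b ∧ b ∈ S ∧ h b ≤ t) ∨
      ∃ e ∈ S, h e = t ∧ Conn (S ∩ {x | h x ≤ t}) a e := by
    clear htb
    induction hc with
    | refl => exact Or.inl ⟨Conn.refl _ _, ha, hat⟩
    | @tail x y h1 h2 ih =>
      rcases ih with ⟨ih1, ih2, ih3⟩ | ih
      · by_cases hy : h y ≤ t
        · exact Or.inl ⟨ih1.trans (Conn.single ⟨h2.1, ih3⟩ ⟨h2.2.1, hy⟩ h2.2.2), h2.2.1, hy⟩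
        · have := hh x y h2.2.2
          exact Or.inr ⟨x, ih2, by omega, ih1⟩
      · exact Or.inr ih
  rcases key with ⟨k1, k2, k3⟩ | k
  · exact ⟨b, k2, le_antisymm k3 htb, k1⟩
  · exact k

/-- The sup-norm distance in lattice coordinates. -/
def rad (c x : Site) : ℤ := max |x.1 - c.1| |x.2 - c.2|

theorem rad_le_iff {c x : Site} {n : ℤ} : rad c x ≤ n ↔
    c.1 - n ≤ x.1 ∧ x.1 ≤ c.1 + n ∧ c.2 - n ≤ x.2 ∧ x.2 ≤ c.2 + n := by
  simp only [rad, max_le_iff, abs_le]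
  omega

theorem lt_rad_iff {c x : Site} {n : ℤ} : n < rad c x ↔
    x.1 < c.1 - n ∨ c.1 + n < x.1 ∨ x.2 < c.2 - n ∨ c.2 + n < x.2 := by
  rw [← not_le, rad_le_iff]
  omega

theorem rad_comm (c x : Site) : rad c x = rad x c := by
  simp only [rad, abs_sub_comm]

theorem rad_self (c : Site) : rad c c = 0 := by simp [rad]

theorem rad_nonneg (c x : Site) : 0 ≤ rad c x := le_max_of_le_left (abs_nonneg _)

theorem rad_triangle (a b c : Site) : rad a c ≤ rad a b + rad b c := by
  have h1 := (rad_le_iff (c := a) (x := b)).1 le_rfl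
  have h2 := (rad_le_iff (c := b) (x := c)).1 le_rfl
  rw [rad_le_iff]
  omega

theorem rad_adj {x y : Site} (h : triLattice.Adj x y) : rad x y ≤ 1 := by
  rw [adj_iff] at h
  rw [rad_le_iff]
  omega

theorem rad_le_of_adj (c : Site) {x y : Site} (h : triLattice.Adj x y) :
    rad c y ≤ rad c x + 1 :=
  (rad_triangle c x y).trans (by have := rad_adj h; omega)

theorem finite_rad_le (c : Site) (n : ℤ) : {x | rad c x ≤ n}.Finite := by
  refine (Set.finite_Icc (c.1 - n, c.2 - n) (c.1 + n, c.2 + n)).subset fun x hx => ?_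
  have := rad_le_iff.1 hx
  exact ⟨⟨by omega, by omega⟩, ⟨by omega, by omega⟩⟩

/-! ### Cocycles modulo two on the triangular lattice -/

/-- The vertices of a face in counterclockwise order. -/
def vtx : DualSite → Fin 3 → Site
  | ((a, b), true) => ![(a, b), (a + 1, b), (a, b + 1)]
  | ((a, b), false) => ![(a + 1, b), (a + 1, b + 1), (a, b + 1)]

/-- The face on the other side of the side joining the vertices number `i` and `i + 1`. -/
def nbr : DualSite → Fin 3 → DualSite
  | ((a, b), true) => ![((a, b - 1), false), ((a, b), false), ((a - 1, b), false)]
  | ((a, b), false) => ![((a + 1, b), true), ((a, b + 1), true), ((a, b), true)]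

theorem vtx_adj (ξ : DualSite) (i : Fin 3) : triLattice.Adj (vtx ξ i) (vtx ξ (i + 1)) := by
  rcases ξ with ⟨⟨a, b⟩, _ | _⟩ <;> fin_cases i <;> simp [vtx, adj_iff]

theorem vtx_adj_of_ne {ξ : DualSite} {i j : Fin 3} (h : i ≠ j) :
    triLattice.Adj (vtx ξ i) (vtx ξ j) := by
  rcases ξ with ⟨⟨a, b⟩, _ | _⟩ <;> fin_cases i <;> fin_cases j <;>
    first | exact absurd rfl h | simp [vtx, adj_iff]

theorem vtx_eq_or_adj (ξ : DualSite) (i j : Fin 3) :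
    vtx ξ i = vtx ξ j ∨ triLattice.Adj (vtx ξ i) (vtx ξ j) := by
  by_cases h : i = j
  · exact Or.inl (by rw [h])
  · exact Or.inr (vtx_adj_of_ne h)

theorem mem_vertices_iff {ξ : DualSite} {x : Site} : x ∈ ξ.vertices ↔ ∃ i, vtx ξ i = x := by
  rcases ξ with ⟨⟨a, b⟩, _ | _⟩ <;>
    simp [DualSite.vertices, vtx, Fin.exists_fin_succ, eq_comm] <;> tauto

theorem rad_vtx (ξ : DualSite) (i : Fin 3) : rad ξ.1 (vtx ξ i) ≤ 1 := by
  rcases ξ with ⟨⟨a, b⟩, _ | _⟩ <;> fin_cases i <;> simp [vtx, rad_le_iff] <;> omega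

/-- Across a side lies a face having the same side, with the opposite orientation. -/
theorem exists_nbr_nbr (ξ : DualSite) (i : Fin 3) : ∃ j, nbr (nbr ξ i) j = ξ ∧
    vtx (nbr ξ i) j = vtx ξ (i + 1) ∧ vtx (nbr ξ i) (j + 1) = vtx ξ i := by
  rcases ξ with ⟨⟨a, b⟩, _ | _⟩ <;> fin_cases i
  · exact ⟨2, by simp [nbr, vtx]⟩
  · exact ⟨0, by simp [nbr, vtx]⟩
  · exact ⟨1, by simp [nbr, vtx]⟩
  · exact ⟨1, by simp [nbr, vtx]⟩
  · exact ⟨2, by simp [nbr, vtx]⟩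
  · exact ⟨0, by simp [nbr, vtx]⟩

/-- An oriented lattice edge is a counterclockwise side of exactly one face. -/
theorem side_injective {ξ ζ : DualSite} {i j : Fin 3} (h : vtx ξ i = vtx ζ j)
    (h' : vtx ξ (i + 1) = vtx ζ (j + 1)) : ξ = ζ ∧ i = j := by
  rcases ξ with ⟨⟨a, b⟩, _ | _⟩ <;> rcases ζ with ⟨⟨a', b'⟩, _ | _⟩ <;> fin_cases i <;>
    fin_cases j <;> simp [vtx] at h h' ⊢ <;> omega

theorem exists_side {x y : Site} (h : triLattice.Adj x y) :
    ∃ ξ i, vtx ξ i = x ∧ vtx ξ (i + 1) = y := by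
  obtain ⟨a, b⟩ := x
  obtain ⟨a', b'⟩ := y
  rw [adj_iff] at h
  simp only at h
  rcases h with h | h | h | h | h | h <;> obtain ⟨rfl, rfl⟩ := h
  · exact ⟨((a, b'), true), 0, by simp [vtx]⟩
  · exact ⟨((a - 1, b' - 1), false), 1, by simp [vtx]⟩
  · exact ⟨((a' - 1, b), false), 0, by simp [vtx]⟩
  · exact ⟨((a', b - 1), true), 2, by simp [vtx]⟩
  · exact ⟨((a, b - 1), false), 2, by simp [vtx]⟩
  · exact ⟨((a - 1, b), true), 1, by simp [vtx]⟩

theorem exists_forall_int_succ_eq (s : ℤ → ZMod 2) (z : ZMod 2) :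
    ∃ f : ℤ → ZMod 2, f 0 = z ∧ ∀ a, f (a + 1) = f a + s a := by
  refine ⟨fun a => z + (∑ i ∈ Finset.Ico 0 a, s i + ∑ i ∈ Finset.Ico a 0, s i), by simp, ?_⟩
  intro a
  rcases le_or_gt 0 a with ha | ha
  · have h1 : Finset.Ico 0 (a + 1) = insert a (Finset.Ico 0 a) := by
      ext x; simp only [Finset.mem_Ico, Finset.mem_insert]; omega
    have h2 : Finset.Ico (a + 1) 0 = ∅ := Finset.Ico_eq_empty (by omega)
    have h3 : Finset.Ico a 0 = ∅ := Finset.Ico_eq_empty (by omega)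
    simp only [h1, h2, h3]
    rw [Finset.sum_insert (by simp)]
    simp only [Finset.sum_empty]
    ring
  · have h1 : Finset.Ico a 0 = insert a (Finset.Ico (a + 1) 0) := by
      ext x; simp only [Finset.mem_Ico, Finset.mem_insert]; omega
    have h2 : Finset.Ico 0 a = ∅ := Finset.Ico_eq_empty (by omega)
    have h3 : Finset.Ico 0 (a + 1) = ∅ := Finset.Ico_eq_empty (by omega)
    simp only [h1, h2, h3]
    rw [Finset.sum_insert (by simp)]
    simp only [Finset.sum_empty]
    have : s a + s a = 0 := CharTwo.add_self_eq_zero _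
    linear_combination -this

/-- The triangular lattice is simply connected: a function on the edges whose sum over the sides of
each face vanishes modulo two is a coboundary. -/
theorem exists_potential (c : Site → Site → ZMod 2) (hsymm : ∀ x y, c x y = c y x)
    (hc : ∀ κ, ∑ j, c (vtx κ j) (vtx κ (j + 1)) = 0) :
    ∃ f : Site → ZMod 2, ∀ x y, triLattice.Adj x y → c x y = f x + f y := by
  obtain ⟨g, -, hg⟩ := exists_forall_int_succ_eq (fun a => c (a, 0) (a + 1, 0)) 0
  choose h h0 hh using fun a => exists_forall_int_succ_eq (fun b => c (a, b) (a, b + 1)) (g a)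
  have hup : ∀ a b : ℤ, c (a, b) (a + 1, b) + c (a + 1, b) (a, b + 1) +
      c (a, b + 1) (a, b) = 0 := by
    intro a b
    simpa [Fin.sum_univ_three, vtx] using hc ((a, b), true)
  have hdn : ∀ a b : ℤ, c (a + 1, b) (a + 1, b + 1) + c (a + 1, b + 1) (a, b + 1) +
      c (a, b + 1) (a + 1, b) = 0 := by
    intro a b
    simpa [Fin.sum_univ_three, vtx] using hc ((a, b), false)
  have aux1 : ∀ p q r u v h1 h2 : ZMod 2, p + q + r = 0 → u + v + q = 0 → h2 = h1 + p →
      h2 + u = h1 + r + v := by decide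
  have aux2 : ∀ p q r u v h1 h2 : ZMod 2, p + q + r = 0 → u + v + q = 0 → h2 + u = h1 + r + v →
      h2 = h1 + p := by decide
  -- The potential is defined along the line `b = 0` and then along the vertical lines. Summing over
  -- the two faces between consecutive horizontal edges carries the rule from line to line.
  have hstep : ∀ a b : ℤ, h (a + 1) b = h a b + c (a, b) (a + 1, b) ↔
      h (a + 1) (b + 1) = h a (b + 1) + c (a, b + 1) (a + 1, b + 1) := by
    intro a b
    have e1 := hup a b
    have e2 := hdn a b
    rw [hsymm (a, b + 1) (a, b)] at e1
    rw [hsymm (a + 1, b + 1) (a, b + 1), hsymm (a, b + 1) (a + 1, b)] at e2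
    rw [hh (a + 1) b, hh a b]
    exact ⟨aux1 _ _ _ _ _ _ _ e1 e2, aux2 _ _ _ _ _ _ _ e1 e2⟩
  have hhor : ∀ a b : ℤ, h (a + 1) b = h a b + c (a, b) (a + 1, b) := by
    intro a b
    induction b using Int.induction_on with
    | zero => rw [h0, h0, hg]
    | succ n ih => exact (hstep a n).1 ih
    | pred n ih =>
      refine (hstep a (-n - 1)).2 ?_
      simpa using ih
  refine ⟨fun x => h x.1 x.2, ?_⟩
  have aux3 : ∀ s t u : ZMod 2, s = t + u → u = t + s := by decide
  have aux4 : ∀ p q r h1 h2 h3 : ZMod 2, p + q + r = 0 → h2 = h1 + p → h3 = h1 + r →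
      q = h2 + h3 := by decide
  have H : ∀ a b : ℤ, c (a, b) (a + 1, b) = h a b + h (a + 1) b := fun a b => aux3 _ _ _ (hhor a b)
  have V : ∀ a b : ℤ, c (a, b) (a, b + 1) = h a b + h a (b + 1) := fun a b => aux3 _ _ _ (hh a b)
  have D : ∀ a b : ℤ, c (a + 1, b) (a, b + 1) = h (a + 1) b + h a (b + 1) := by
    intro a b
    have e1 := hup a b
    rw [hsymm (a, b + 1) (a, b)] at e1
    exact aux4 _ _ _ _ _ _ e1 (hhor a b) (hh a b)
  rintro ⟨a, b⟩ ⟨a', b'⟩ hxy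
  rw [adj_iff] at hxy
  simp only at hxy ⊢
  rcases hxy with hxy | hxy | hxy | hxy | hxy | hxy <;> obtain ⟨rfl, rfl⟩ := hxy
  · exact H _ _
  · have := H (a - 1) b'
    rw [sub_add_cancel] at this
    rw [hsymm, this, add_comm]
  · exact V _ _
  · have := V a' (b - 1)
    rw [sub_add_cancel] at this
    rw [hsymm, this, add_comm]
  · have := D a (b - 1)
    rw [sub_add_cancel] at this
    rw [hsymm, this, add_comm]
  · have := D (a - 1) b
    rw [sub_add_cancel] at this
    exact this

/-- Indicator, for the unordered pair `x, y`, of the lattice edge crossed when leaving the face `ξ`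
through its side number `i`. -/
def cr (ξ : DualSite) (i : Fin 3) (x y : Site) : ZMod 2 :=
  open Classical in
  if (x = vtx ξ i ∧ y = vtx ξ (i + 1)) ∨ (y = vtx ξ i ∧ x = vtx ξ (i + 1)) then 1 else 0

theorem cr_symm (ξ : DualSite) (i : Fin 3) (x y : Site) : cr ξ i x y = cr ξ i y x := by
  unfold cr
  congr 1
  exact propext or_comm

theorem cr_eq_zero {ξ : DualSite} {i : Fin 3} {x y : Site}
    (h : ¬ ((x = vtx ξ i ∧ y = vtx ξ (i + 1)) ∨ (y = vtx ξ i ∧ x = vtx ξ (i + 1)))) :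
    cr ξ i x y = 0 := if_neg h

theorem nbr_ne (ξ : DualSite) (i : Fin 3) : nbr ξ i ≠ ξ := by
  rcases ξ with ⟨⟨a, b⟩, _ | _⟩ <;> fin_cases i <;> simp [nbr]

open Classical in
/-- A single step of a dual walk crosses the boundary of exactly the two faces that it joins. -/
theorem sum_cr (ξ κ : DualSite) (i : Fin 3) : ∑ j, cr ξ i (vtx κ j) (vtx κ (j + 1)) =
    (if κ = ξ then 1 else 0) + (if κ = nbr ξ i then 1 else 0) := by
  obtain ⟨j₀, h0, h1, h2⟩ := exists_nbr_nbr ξ i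
  have e : ∀ j, cr ξ i (vtx κ j) (vtx κ (j + 1)) =
      (if κ = ξ ∧ j = i then 1 else 0) + (if κ = nbr ξ i ∧ j = j₀ then 1 else 0) := by
    intro j
    have hne := nbr_ne ξ i
    unfold cr
    by_cases hA : κ = ξ ∧ j = i
    · obtain ⟨rfl, rfl⟩ := hA
      simp [hne.symm]
    · by_cases hB : κ = nbr ξ i ∧ j = j₀
      · obtain ⟨rfl, rfl⟩ := hB
        simp [hne, h1, h2]
      · rw [if_neg hA, if_neg hB, if_neg, add_zero]
        rintro (⟨e1, e2⟩ | ⟨e1, e2⟩)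
        · exact hA (side_injective e1 e2)
        · exact hB (side_injective (e2.trans h1.symm) (e1.trans h2.symm))
  simp only [e, Finset.sum_add_distrib]
  congr 1
  · by_cases h : κ = ξ <;> simp [h]
  · by_cases h : κ = nbr ξ i <;> simp [h]

/-- The number modulo two of crossings of the lattice edge `x y` by the dual walk that starts at
`u 0` and, for `t < n`, leaves `u t` through its side number `σ t`. -/
def crossings (u : ℕ → DualSite) (σ : ℕ → Fin 3) (n : ℕ) (x y : Site) : ZMod 2 :=
  ∑ t ∈ Finset.range n, cr (u t) (σ t) x y

open Classical in
theorem sum_crossings {u : ℕ → DualSite} {σ : ℕ → Fin 3} {n : ℕ}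
    (h : ∀ t < n, u (t + 1) = nbr (u t) (σ t)) (κ : DualSite) :
    ∑ j, crossings u σ n (vtx κ j) (vtx κ (j + 1)) =
      (if κ = u 0 then 1 else 0) + (if κ = u n then 1 else 0) := by
  induction n with
  | zero => simp [crossings, CharTwo.add_self_eq_zero]
  | succ n ih =>
    have e : ∀ x y, crossings u σ (n + 1) x y = crossings u σ n x y + cr (u n) (σ n) x y :=
      fun x y => Finset.sum_range_succ _ _
    simp only [e, Finset.sum_add_distrib]
    rw [ih fun t ht => h t (by omega), sum_cr, ← h n (by omega)]
    have aux : ∀ a b c : ZMod 2, a + b + (b + c) = a + c := by decide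
    exact aux _ _ _

/-- Two dual walks with the same end points together form the boundary of a set of sites. -/
theorem exists_potential_of_walks {u u' : ℕ → DualSite} {σ σ' : ℕ → Fin 3} {n n' : ℕ}
    (h : ∀ t < n, u (t + 1) = nbr (u t) (σ t)) (h' : ∀ t < n', u' (t + 1) = nbr (u' t) (σ' t))
    (h0 : u 0 = u' 0) (hn : u n = u' n') :
    ∃ f : Site → ZMod 2, ∀ x y, triLattice.Adj x y →
      crossings u σ n x y + crossings u' σ' n' x y = f x + f y := by
  refine exists_potential _ (fun x y => ?_) fun κ => ?_
  · simp only [crossings, cr_symm _ _ x y]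
  · classical
    rw [Finset.sum_add_distrib, sum_crossings h, sum_crossings h', h0, hn]
    exact CharTwo.add_self_eq_zero _

section

/-! ### Following the interfaces -/

/-- The face `ξ` has both open and closed vertices; equivalently, some counterclockwise side leads
from a closed to an open vertex. -/
def Mixed (ω : Config) (ξ : DualSite) : Prop := ∃ i, vtx ξ i ∉ ω ∧ vtx ξ (i + 1) ∈ ω

open Classical in
/-- The side of a mixed face that leads counterclockwise from a closed to an open vertex. An
interface that keeps open sites on its left leaves the face through this side. -/
def exitSide (ω : Config) (ξ : DualSite) : Fin 3 :=
  if h : Mixed ω ξ then h.choose else 0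

/-- The closed end point of the exit side. -/
def cls (ω : Config) (ξ : DualSite) : Site := vtx ξ (exitSide ω ξ)

/-- The open end point of the exit side. -/
def opn (ω : Config) (ξ : DualSite) : Site := vtx ξ (exitSide ω ξ + 1)

open Classical in
/-- One step along the interface through a face, with open sites on the left; faces whose vertices
are all open or all closed stay fixed. -/
def nxt (ω : Config) (ξ : DualSite) : DualSite :=
  if Mixed ω ξ then nbr ξ (exitSide ω ξ) else ξ

variable {ω ω' : Config} {ξ ζ : DualSite}

theorem Mixed.cls_notMem (h : Mixed ω ξ) : cls ω ξ ∉ ω := by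
  unfold cls exitSide
  rw [dif_pos h]
  exact h.choose_spec.1

theorem Mixed.opn_mem (h : Mixed ω ξ) : opn ω ξ ∈ ω := by
  unfold opn exitSide
  rw [dif_pos h]
  exact h.choose_spec.2

theorem Mixed.nxt_eq (h : Mixed ω ξ) : nxt ω ξ = nbr ξ (exitSide ω ξ) := if_pos h

theorem exitSide_eq {i : Fin 3} (h : vtx ξ i ∉ ω) (h' : vtx ξ (i + 1) ∈ ω) :
    exitSide ω ξ = i := by
  have hm : Mixed ω ξ := ⟨i, h, h'⟩
  have h1 : vtx ξ (exitSide ω ξ) ∉ ω := hm.cls_notMem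
  have h2 : vtx ξ (exitSide ω ξ + 1) ∈ ω := hm.opn_mem
  generalize exitSide ω ξ = j at h1 h2
  fin_cases i <;> fin_cases j <;> first | rfl | (exfalso; simp_all)

theorem mixed_compl : Mixed ωᶜ ξ ↔ Mixed ω ξ := by
  have e : ∀ P : Fin 3 → Prop, (∃ i, P i) ↔ P 0 ∨ P 1 ∨ P 2 := fun P => by
    simp [Fin.exists_fin_succ]
  simp only [Mixed, Set.mem_compl_iff, not_not, e]
  simp only [Fin.isValue, zero_add, Fin.reduceAdd]
  tauto

theorem Mixed.nxt (h : Mixed ω ξ) : Mixed ω (nxt ω ξ) := by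
  rw [h.nxt_eq, ← mixed_compl]
  obtain ⟨j, -, h1, h2⟩ := exists_nbr_nbr ξ (exitSide ω ξ)
  refine ⟨j, ?_, ?_⟩
  · rw [h1]; exact fun hc => hc h.opn_mem
  · rw [h2]; exact h.cls_notMem

/-- Interchanging open and closed sites reverses the interfaces. -/
theorem nxt_compl_nxt (ω : Config) (ξ : DualSite) : nxt ωᶜ (nxt ω ξ) = ξ := by
  by_cases h : Mixed ω ξ
  · have h' : Mixed ωᶜ (nxt ω ξ) := mixed_compl.2 h.nxt
    obtain ⟨j, h0, h1, h2⟩ := exists_nbr_nbr ξ (exitSide ω ξ)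
    have e : exitSide ωᶜ (nbr ξ (exitSide ω ξ)) = j := by
      apply exitSide_eq
      · rw [h1]; exact fun hc => hc h.opn_mem
      · rw [h2]; exact h.cls_notMem
    rw [h'.nxt_eq, h.nxt_eq, e, h0]
  · have e : nxt ω ξ = ξ := if_neg h
    rw [e]
    exact if_neg fun hc => h (mixed_compl.1 hc)

theorem nxt_injective (ω : Config) : Function.Injective (nxt ω) :=
  Function.LeftInverse.injective (nxt_compl_nxt ω)

theorem Mixed.iterate (h : Mixed ω ξ) (t : ℕ) : Mixed ω ((EnhPerc.nxt ω)^[t] ξ) := by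
  induction t with
  | zero => exact h
  | succ t ih => rw [Function.iterate_succ_apply']; exact ih.nxt

theorem Mixed.nxt_ne (h : Mixed ω ξ) : EnhPerc.nxt ω ξ ≠ ξ := by
  rw [h.nxt_eq]; exact nbr_ne _ _

theorem rad_cls (ω : Config) (ξ : DualSite) : rad ξ.1 (cls ω ξ) ≤ 1 := rad_vtx _ _

theorem rad_opn (ω : Config) (ξ : DualSite) : rad ξ.1 (opn ω ξ) ≤ 1 := rad_vtx _ _

theorem cls_adj_opn (ω : Config) (ξ : DualSite) : triLattice.Adj (cls ω ξ) (opn ω ξ) := vtx_adj _ _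

theorem Mixed.opn_step (h : Mixed ω ξ) :
    opn ω ξ = opn ω (EnhPerc.nxt ω ξ) ∨ triLattice.Adj (opn ω ξ) (opn ω (EnhPerc.nxt ω ξ)) := by
  obtain ⟨j, -, h1, h2⟩ := exists_nbr_nbr ξ (exitSide ω ξ)
  rw [← h.nxt_eq] at h1
  have : opn ω ξ = vtx (EnhPerc.nxt ω ξ) j := h1.symm
  rw [this]
  exact vtx_eq_or_adj _ _ _

theorem Mixed.cls_step (h : Mixed ω ξ) :
    cls ω ξ = cls ω (EnhPerc.nxt ω ξ) ∨ triLattice.Adj (cls ω ξ) (cls ω (EnhPerc.nxt ω ξ)) := by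
  obtain ⟨j, -, h1, h2⟩ := exists_nbr_nbr ξ (exitSide ω ξ)
  rw [← h.nxt_eq] at h2
  have : cls ω ξ = vtx (EnhPerc.nxt ω ξ) (j + 1) := h2.symm
  rw [this]
  exact vtx_eq_or_adj _ _ _

theorem rad_nbr (ξ : DualSite) (i : Fin 3) : rad ξ.1 (nbr ξ i).1 ≤ 1 := by
  rcases ξ with ⟨⟨a, b⟩, _ | _⟩ <;> fin_cases i <;> simp [nbr, rad_le_iff] <;> omega

theorem rad_nxt (ω : Config) (ξ : DualSite) : rad ξ.1 (nxt ω ξ).1 ≤ 1 := by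
  unfold nxt
  split_ifs
  · exact rad_nbr _ _
  · rw [rad_self]; exact zero_le_one

/-- A stretch of an interface has connected left side. -/
theorem Mixed.conn_opn (h : Mixed ω ξ) {S : Set Site} {m n : ℕ} (hmn : m ≤ n)
    (hS : ∀ t, m ≤ t → t ≤ n → opn ω ((EnhPerc.nxt ω)^[t] ξ) ∈ S) :
    Conn S (opn ω ((EnhPerc.nxt ω)^[m] ξ)) (opn ω ((EnhPerc.nxt ω)^[n] ξ)) := by
  induction n, hmn using Nat.le_induction with
  | base => exact Conn.refl _ _
  | succ n hmn ih =>
    refine (ih fun t h1 h2 => hS t h1 (by omega)).trans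
      (Conn.single_or_eq (hS n hmn (by omega)) (hS _ (by omega) le_rfl) ?_)
    rw [Function.iterate_succ_apply']
    exact (h.iterate n).opn_step

/-- A stretch of an interface has connected right side. -/
theorem Mixed.conn_cls (h : Mixed ω ξ) {S : Set Site} {m n : ℕ} (hmn : m ≤ n)
    (hS : ∀ t, m ≤ t → t ≤ n → cls ω ((EnhPerc.nxt ω)^[t] ξ) ∈ S) :
    Conn S (cls ω ((EnhPerc.nxt ω)^[m] ξ)) (cls ω ((EnhPerc.nxt ω)^[n] ξ)) := by
  induction n, hmn using Nat.le_induction with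
  | base => exact Conn.refl _ _
  | succ n hmn ih =>
    refine (ih fun t h1 h2 => hS t h1 (by omega)).trans
      (Conn.single_or_eq (hS n hmn (by omega)) (hS _ (by omega) le_rfl) ?_)
    rw [Function.iterate_succ_apply']
    exact (h.iterate n).cls_step

theorem eq_of_cls_eq_of_opn_eq (h1 : cls ω ξ = cls ω ζ) (h2 : opn ω ξ = opn ω ζ) : ξ = ζ :=
  (side_injective h1 h2).1

theorem finite_mixed (hω : ω.Finite) : {ξ | Mixed ω ξ}.Finite := by
  refine ((hω.biUnion fun x _ => finite_rad_le x 1).prod (Set.finite_univ (α := Bool))).subset ?_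
  intro ξ hξ
  refine ⟨?_, trivial⟩
  simp only [Set.mem_iUnion]
  exact ⟨_, Mixed.opn_mem hξ, by rw [Set.mem_ofPred_eq, rad_comm]; exact rad_opn ω ξ⟩

/-- Interfaces of a finite configuration are loops. -/
theorem minimalPeriod_pos (hω : ω.Finite) (ξ : DualSite) :
    0 < Function.minimalPeriod (nxt ω) ξ := by
  by_cases h : Mixed ω ξ
  · obtain ⟨m, n, hne, he⟩ : ∃ m n : ℕ, m ≠ n ∧ (nxt ω)^[m] ξ = (nxt ω)^[n] ξ := by
      by_contra! hc
      exact Set.not_injOn_infinite_finite_image Set.infinite_univ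
        ((finite_mixed hω).subset (Set.image_subset_iff.2 fun t _ => h.iterate t))
        (fun m _ n _ he => by_contra fun hmn => hc m n hmn he)
    wlog hlt : m < n generalizing m n
    · exact this n m hne.symm he.symm (by omega)
    refine Function.IsPeriodicPt.minimalPeriod_pos (n := n - m) (by omega) ?_
    have : (nxt ω)^[m] ξ = (nxt ω)^[m] ((nxt ω)^[n - m] ξ) := by
      rw [← Function.iterate_add_apply, he]; congr 2; omega
    exact ((nxt_injective ω).iterate m this).symm
  · exact Function.IsPeriodicPt.minimalPeriod_pos one_pos (by
      rw [Function.IsPeriodicPt, Function.iterate_one]; exact if_neg h)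

/-- Crossings of the edge `x y` by the first `n` steps along the interface from `ξ`. -/
def orbitCrossings (ω : Config) (ξ : DualSite) (n : ℕ) (x y : Site) : ZMod 2 :=
  crossings (fun t => (nxt ω)^[t] ξ) (fun t => exitSide ω ((nxt ω)^[t] ξ)) n x y

theorem orbitCrossings_eq_zero {n : ℕ} {x y : Site}
    (h : ∀ t < n, ¬ (x = cls ω ((nxt ω)^[t] ξ) ∧ y = opn ω ((nxt ω)^[t] ξ)))
    (h' : ∀ t < n, ¬ (y = cls ω ((nxt ω)^[t] ξ) ∧ x = opn ω ((nxt ω)^[t] ξ))) :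
    orbitCrossings ω ξ n x y = 0 := by
  unfold orbitCrossings crossings
  refine Finset.sum_eq_zero fun t ht => cr_eq_zero ?_
  have ht := Finset.mem_range.1 ht
  exact not_or.2 ⟨h t ht, h' t ht⟩

theorem exists_of_orbitCrossings_ne_zero {n : ℕ} {x y : Site} (h : orbitCrossings ω ξ n x y ≠ 0) :
    ∃ t < n, (x = cls ω ((nxt ω)^[t] ξ) ∧ y = opn ω ((nxt ω)^[t] ξ)) ∨
      (y = cls ω ((nxt ω)^[t] ξ) ∧ x = opn ω ((nxt ω)^[t] ξ)) := by
  by_contra! hc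
  exact h (orbitCrossings_eq_zero (fun t ht hh => (hc t ht).1 hh.1 hh.2)
    fun t ht hh => (hc t ht).2 hh.1 hh.2)

theorem orbitCrossings_eq_one (hξ : Mixed ω ξ) {n t₀ : ℕ}
    (hn : n ≤ Function.minimalPeriod (nxt ω) ξ) (ht : t₀ < n) :
    orbitCrossings ω ξ n (cls ω ((nxt ω)^[t₀] ξ)) (opn ω ((nxt ω)^[t₀] ξ)) = 1 := by
  unfold orbitCrossings crossings
  rw [Finset.sum_eq_single t₀]
  · exact if_pos (Or.inl ⟨rfl, rfl⟩)
  · intro t ht' hne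
    have ht' := Finset.mem_range.1 ht'
    refine cr_eq_zero ?_
    rintro (⟨h1, h2⟩ | ⟨h1, h2⟩)
    · refine hne (Function.iterate_injOn_Iio_minimalPeriod (f := nxt ω) (x := ξ)
        (Set.mem_Iio.2 (by omega)) (Set.mem_Iio.2 (by omega)) ?_)
      exact (side_injective h1.symm h2.symm).1
    · have := (hξ.iterate t₀).opn_mem
      rw [h1] at this
      exact (hξ.iterate t).cls_notMem this
  · intro h
    exact absurd (Finset.mem_range.2 ht) h

theorem orbit_walk (hξ : Mixed ω ξ) (t : ℕ) :
    (nxt ω)^[t + 1] ξ = nbr ((nxt ω)^[t] ξ) (exitSide ω ((nxt ω)^[t] ξ)) := by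
  rw [Function.iterate_succ_apply']
  exact (hξ.iterate t).nxt_eq

/-- A loop has two sides: some two-colouring of the sites changes exactly across the loop. -/
theorem exists_potential_orbit (hξ : Mixed ω ξ) :
    ∃ f : Site → ZMod 2, ∀ x y, triLattice.Adj x y →
      orbitCrossings ω ξ (Function.minimalPeriod (nxt ω) ξ) x y = f x + f y := by
  obtain ⟨f, hf⟩ := exists_potential_of_walks
    (u := fun t => (nxt ω)^[t] ξ) (σ := fun t => exitSide ω ((nxt ω)^[t] ξ))
    (u' := fun _ => ξ) (σ' := fun _ => 0) (n' := 0)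
    (fun t (_ : t < Function.minimalPeriod (nxt ω) ξ) => orbit_walk hξ t) (by simp) rfl
    (Function.iterate_minimalPeriod (f := nxt ω) (x := ξ))
  refine ⟨f, fun x y hxy => ?_⟩
  rw [← hf x y hxy]
  simp [orbitCrossings, crossings]

theorem zmod_eq_of_add_eq_zero {a b : ZMod 2} (h : 0 = a + b) : a = b := by
  revert a b; decide

theorem zmod_ne_of_add_eq_one {a b : ZMod 2} (h : 1 = a + b) : a ≠ b := by
  revert a b; decide

/-- Interfaces with connected left sides and connected right sides coincide. -/
theorem exists_iterate_eq (hω : ω.Finite) (hξ : Mixed ω ξ) (hζ : Mixed ω ζ)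
    (ho : Conn ω (opn ω ξ) (opn ω ζ)) (hc : Conn ωᶜ (cls ω ξ) (cls ω ζ)) :
    ∃ m, (nxt ω)^[m] ξ = ζ := by
  obtain ⟨f, hf⟩ := exists_potential_orbit hξ
  have h1 : f (opn ω ζ) = f (opn ω ξ) := by
    refine ho.eq_of_forall_adj fun x y hx hy hxy => zmod_eq_of_add_eq_zero ?_
    rw [← hf x y hxy, orbitCrossings_eq_zero]
    · rintro t - ⟨rfl, -⟩; exact (hξ.iterate t).cls_notMem hx
    · rintro t - ⟨rfl, -⟩; exact (hξ.iterate t).cls_notMem hy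
  have h2 : f (cls ω ζ) = f (cls ω ξ) := by
    refine hc.eq_of_forall_adj fun x y hx hy hxy => zmod_eq_of_add_eq_zero ?_
    rw [← hf x y hxy, orbitCrossings_eq_zero]
    · rintro t - ⟨-, rfl⟩; exact hy (hξ.iterate t).opn_mem
    · rintro t - ⟨-, rfl⟩; exact hx (hξ.iterate t).opn_mem
  have h3 := hf _ _ (cls_adj_opn ω ξ)
  have h4 := hf _ _ (cls_adj_opn ω ζ)
  rw [h1, h2, ← h3] at h4
  have h5 := orbitCrossings_eq_one hξ le_rfl (minimalPeriod_pos hω ξ)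
  rw [Function.iterate_zero_apply] at h5
  rw [h5] at h4
  obtain ⟨t, -, ht⟩ := exists_of_orbitCrossings_ne_zero (h4.trans_ne one_ne_zero)
  rcases ht with ⟨e1, e2⟩ | ⟨e1, e2⟩
  · exact ⟨t, eq_of_cls_eq_of_opn_eq e1.symm e2.symm⟩
  · exact absurd (e1 ▸ hζ.opn_mem) (hξ.iterate t).cls_notMem

theorem conn_horizontal {S : Set Site} (a b : ℤ) (k : ℕ)
    (h : ∀ t : ℤ, 0 ≤ t → t ≤ k → (a + t, b) ∈ S) :
    Conn S (a, b) (a + k, b) := by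
  induction k with
  | zero => simpa using Conn.refl S (a, b)
  | succ k ih =>
    refine (ih fun t h0 h1 => h t h0 (by push_cast; omega)).trans
      (Conn.single (h k (by omega) (by push_cast; omega)) ?_ ?_)
    · exact h _ (by omega) le_rfl
    · rw [adj_iff]; left; constructor
      · push_cast; ring
      · rfl

theorem conn_vertical {S : Set Site} (a b : ℤ) (k : ℕ)
    (h : ∀ t : ℤ, 0 ≤ t → t ≤ k → (a, b + t) ∈ S) :
    Conn S (a, b) (a, b + k) := by
  induction k with
  | zero => simpa using Conn.refl S (a, b)
  | succ k ih =>
    refine (ih fun t h0 h1 => h t h0 (by push_cast; omega)).trans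
      (Conn.single (h k (by omega) (by push_cast; omega)) ?_ ?_)
    · exact h _ (by omega) le_rfl
    · rw [adj_iff]; right; right; left; constructor
      · rfl
      · push_cast; ring

theorem conn_horizontal' {S : Set Site} {a a' b : ℤ}
    (h : ∀ t : ℤ, min a a' ≤ t → t ≤ max a a' → (t, b) ∈ S) : Conn S (a, b) (a', b) := by
  wlog haa : a ≤ a' generalizing a a'
  · exact (this (by rwa [min_comm, max_comm]) (by omega)).symm
  obtain ⟨k, rfl⟩ : ∃ k : ℕ, a' = a + k := ⟨(a' - a).toNat, by omega⟩
  exact conn_horizontal a b k fun t h0 h1 => h _ (by omega) (by omega)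

theorem conn_vertical' {S : Set Site} {a b b' : ℤ}
    (h : ∀ t : ℤ, min b b' ≤ t → t ≤ max b b' → (a, t) ∈ S) : Conn S (a, b) (a, b') := by
  wlog hbb : b ≤ b' generalizing b b'
  · exact (this (by rwa [min_comm, max_comm]) (by omega)).symm
  obtain ⟨k, rfl⟩ : ∃ k : ℕ, b' = b + k := ⟨(b' - b).toNat, by omega⟩
  exact conn_vertical a b k fun t h0 h1 => h _ (by omega) (by omega)

/-- The complement of a box is connected. -/
theorem conn_outside_box {c : Site} {n : ℤ} {a b : Site} (ha : n < rad c a) (hb : n < rad c b) :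
    Conn {x | n < rad c x} a b := by
  have key : ∀ a : Site, n < rad c a → Conn {x | n < rad c x} a (c.1 + n + 1, c.2 + n + 1) := by
    rintro ⟨a₁, a₂⟩ ha
    have ha' := lt_rad_iff.1 ha
    simp only at ha'
    have H : a₁ < c.1 - n ∨ c.1 + n < a₁ → Conn {x | n < rad c x} (a₁, a₂)
        (c.1 + n + 1, c.2 + n + 1) := fun h =>
      (conn_vertical' (b' := c.2 + n + 1) fun t _ _ => lt_rad_iff.2 (by simp only; omega)).trans
        (conn_horizontal' fun t _ _ => lt_rad_iff.2 (by simp only; omega))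
    have V : a₂ < c.2 - n ∨ c.2 + n < a₂ → Conn {x | n < rad c x} (a₁, a₂)
        (c.1 + n + 1, c.2 + n + 1) := fun h =>
      (conn_horizontal' (a' := c.1 + n + 1) fun t _ _ => lt_rad_iff.2 (by simp only; omega)).trans
        (conn_vertical' fun t _ _ => lt_rad_iff.2 (by simp only; omega))
    rcases ha' with h | h | h | h
    · exact H (Or.inl h)
    · exact H (Or.inr h)
    · exact V (Or.inl h)
    · exact V (Or.inr h)
  exact (key a ha).trans (key b hb).symm

/-- A loop inside a box does not separate two sites outside. -/
theorem not_conn_of_orbit_in_box (hω : ω.Finite) (hξ : Mixed ω ξ) {c : Site} {n : ℤ}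
    (h : ∀ t, rad c ((nxt ω)^[t] ξ).1 ≤ n) {a b : Site} (ha : Conn ω (opn ω ξ) a)
    (hb : Conn ωᶜ (cls ω ξ) b) (hna : n + 1 < rad c a) (hnb : n + 1 < rad c b) : False := by
  obtain ⟨f, hf⟩ := exists_potential_orbit hξ
  have h1 : f a = f (opn ω ξ) := by
    refine ha.eq_of_forall_adj fun x y hx hy hxy => zmod_eq_of_add_eq_zero ?_
    rw [← hf x y hxy, orbitCrossings_eq_zero]
    · rintro t - ⟨rfl, -⟩; exact (hξ.iterate t).cls_notMem hx
    · rintro t - ⟨rfl, -⟩; exact (hξ.iterate t).cls_notMem hy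
  have h2 : f b = f (cls ω ξ) := by
    refine hb.eq_of_forall_adj fun x y hx hy hxy => zmod_eq_of_add_eq_zero ?_
    rw [← hf x y hxy, orbitCrossings_eq_zero]
    · rintro t - ⟨-, rfl⟩; exact hy (hξ.iterate t).opn_mem
    · rintro t - ⟨-, rfl⟩; exact hx (hξ.iterate t).opn_mem
  have hcls : ∀ t, rad c (cls ω ((nxt ω)^[t] ξ)) ≤ n + 1 := fun t =>
    (rad_triangle c _ _).trans (add_le_add (h t) (rad_cls _ _))
  have h3 : f b = f a := by
    refine (conn_outside_box hna hnb).eq_of_forall_adj fun x y hx hy hxy =>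
      zmod_eq_of_add_eq_zero ?_
    rw [← hf x y hxy, orbitCrossings_eq_zero]
    · rintro t - ⟨rfl, -⟩; exact absurd (hcls t) (not_le.2 hx)
    · rintro t - ⟨rfl, -⟩; exact absurd (hcls t) (not_le.2 hy)
  have h4 := hf _ _ (cls_adj_opn ω ξ)
  have h5 := orbitCrossings_eq_one hξ le_rfl (minimalPeriod_pos hω ξ)
  rw [Function.iterate_zero_apply] at h5
  rw [h5] at h4
  exact zmod_ne_of_add_eq_one h4 (by rw [← h1, ← h2, h3])

end

section

/-- Planarity around a site: if the two sites `l`, `r` next to a neighbour `n` of `p` lie in a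
connected set `A` avoiding `p`, then `n` is not connected, off `A` and `p`, to any other neighbour
`q` of `p`. -/
theorem not_interlaced {A B : Set Site} (hA : A.Finite)
    (hcA : ∀ x ∈ A, ∀ y ∈ A, Conn A x y) (hcB : ∀ x ∈ B, ∀ y ∈ B, Conn B x y)
    (hAB : ∀ x ∈ A, x ∉ B) {τ : DualSite} {i j : Fin 3} (hpA : vtx τ i ∉ A) (hpB : vtx τ i ∉ B)
    (hn : vtx τ (i + 1) ∈ B) (hl : vtx τ (i + 2) ∈ A) (hr : vtx (nbr τ i) j ∈ A) {q : Site}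
    (hq : q ∈ B) (hpq : triLattice.Adj (vtx τ i) q) (hqn : q ≠ vtx τ (i + 1)) : False := by
  obtain ⟨k, hk, hk1, hk2⟩ := exists_nbr_nbr τ i
  have hnA : vtx τ (i + 1) ∉ A := fun h => hAB _ h hn
  have hr' : vtx (nbr τ i) (k + 2) ∈ A := by
    have hj : j = k ∨ j = k + 1 ∨ j = k + 2 := by
      clear * -; revert j k; decide
    rcases hj with rfl | rfl | rfl
    · exact absurd (hk1 ▸ hr) hnA
    · exact absurd (hk2 ▸ hr) hpA
    · exact hr
  have e3 : ∀ m : Fin 3, m + 1 + 1 = m + 2 := by decide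
  have ht1 : vtx τ (i + 1 + 1) ∈ A := by rwa [e3]
  have ht2 : vtx (nbr τ i) (k + 1 + 1) ∈ A := by rwa [e3]
  have hk2A : vtx (nbr τ i) (k + 1) ∉ A := by rwa [hk2]
  have hmt : Mixed A τ := ⟨i + 1, hnA, ht1⟩
  have hmt' : Mixed A (nbr τ i) := ⟨k + 1, hk2A, ht2⟩
  have hs := exitSide_eq hnA ht1
  have hs' := exitSide_eq hk2A ht2
  obtain ⟨m, hm⟩ := exists_iterate_eq hA hmt' hmt
    (hcA _ hmt'.opn_mem _ hmt.opn_mem)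
    (Conn.single hmt'.cls_notMem hmt.cls_notMem (by
      unfold cls
      rw [hs, hs', hk2]
      exact vtx_adj _ _))
  -- Close the part of the loop around `A` between the two faces by crossing the edge `p n`.
  obtain ⟨f, hf⟩ := exists_potential_of_walks
    (u := fun t => (nxt A)^[t] (nbr τ i)) (σ := fun t => exitSide A ((nxt A)^[t] (nbr τ i)))
    (u' := fun t => if t = 0 then nbr τ i else τ) (σ' := fun _ => k) (n := m) (n' := 1)
    (fun t _ => orbit_walk hmt' t) (by simp [hk]) (by simp) (by simpa using hm)
  have hf' : ∀ x y, triLattice.Adj x y → x ∉ A → y ∉ A → cr (nbr τ i) k x y = f x + f y := by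
    intro x y hxy hx hy
    rw [← hf x y hxy]
    have h1 : crossings (fun t => (nxt A)^[t] (nbr τ i))
        (fun t => exitSide A ((nxt A)^[t] (nbr τ i))) m x y = 0 := by
      refine orbitCrossings_eq_zero (ω := A) ?_ ?_
      · rintro t - ⟨-, rfl⟩; exact hy (hmt'.iterate t).opn_mem
      · rintro t - ⟨-, rfl⟩; exact hx (hmt'.iterate t).opn_mem
    rw [h1]
    simp [crossings]
  have hBA : ∀ x ∈ B, x ∉ A := fun x hx hx' => hAB x hx' hx
  have h1 : f q = f (vtx τ (i + 1)) := by
    refine (hcB _ hn _ hq).eq_of_forall_adj fun x y hx hy hxy => zmod_eq_of_add_eq_zero ?_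
    rw [← hf' x y hxy (hBA x hx) (hBA y hy), cr_eq_zero]
    rw [hk1, hk2]
    rintro (⟨-, rfl⟩ | ⟨-, rfl⟩)
    · exact hpB hy
    · exact hpB hx
  have h2 : f (vtx τ i) = f q := by
    refine zmod_eq_of_add_eq_zero ?_
    rw [← hf' _ _ hpq hpA (hBA q hq), cr_eq_zero]
    rw [hk1, hk2]
    rintro (⟨h, -⟩ | ⟨h, -⟩)
    · exact hpB (h ▸ hn)
    · exact hqn h
  have h3 : f (vtx τ i) ≠ f (vtx τ (i + 1)) := by
    refine zmod_ne_of_add_eq_one ?_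
    rw [← hf' _ _ (vtx_adj _ _) hpA hnA]
    refine (if_pos (Or.inr ?_)).symm
    rw [hk1, hk2]
    exact ⟨rfl, rfl⟩
  exact h3 (h2.trans h1)

/-! ### Interfaces of two configurations passing through common gates -/

/-- The faces with a counterclockwise side leading from `B` to `A`. -/
def gates (A B : Set Site) : Set DualSite := {ξ | ∃ i, vtx ξ i ∈ B ∧ vtx ξ (i + 1) ∈ A}

/-- `A` and `B` are connected sets of sites, the former open and the latter closed in the finite
configuration `ω`. -/
structure Separated (ω : Config) (A B : Set Site) : Prop where
  finite : ω.Finite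
  subset : A ⊆ ω
  notMem : ∀ x ∈ B, x ∉ ω
  conn_left : ∀ x ∈ A, ∀ y ∈ A, Conn A x y
  conn_right : ∀ x ∈ B, ∀ y ∈ B, Conn B x y

variable {ω ω' : Config} {A B : Set Site} {s ξ : DualSite}

theorem Separated.exitSide_eq (h : Separated ω A B) {i : Fin 3} (hi : vtx ξ i ∈ B)
    (hi' : vtx ξ (i + 1) ∈ A) : exitSide ω ξ = i :=
  EnhPerc.exitSide_eq (h.notMem _ hi) (h.subset hi')

theorem Separated.mixed (h : Separated ω A B) (hs : s ∈ gates A B) : Mixed ω s := by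
  obtain ⟨i, hi, hi'⟩ := hs
  exact ⟨i, h.notMem _ hi, h.subset hi'⟩

theorem Separated.cls_mem (h : Separated ω A B) (hs : s ∈ gates A B) : cls ω s ∈ B := by
  obtain ⟨i, hi, hi'⟩ := hs
  rw [cls, h.exitSide_eq hi hi']
  exact hi

theorem Separated.opn_mem (h : Separated ω A B) (hs : s ∈ gates A B) : opn ω s ∈ A := by
  obtain ⟨i, hi, hi'⟩ := hs
  rw [opn, h.exitSide_eq hi hi']
  exact hi'

theorem mem_gates (h1 : cls ω ξ ∈ B) (h2 : opn ω ξ ∈ A) : ξ ∈ gates A B := ⟨_, h1, h2⟩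

theorem Separated.opn_eq (h : Separated ω A B) (h' : Separated ω' A B) (hs : s ∈ gates A B) :
    opn ω s = opn ω' s := by
  obtain ⟨i, hi, hi'⟩ := hs
  rw [opn, opn, h.exitSide_eq hi hi', h'.exitSide_eq hi hi']

theorem Separated.nxt_eq (h : Separated ω A B) (h' : Separated ω' A B) (hs : s ∈ gates A B) :
    nxt ω s = nxt ω' s := by
  rw [(h.mixed hs).nxt_eq, (h'.mixed hs).nxt_eq]
  obtain ⟨i, hi, hi'⟩ := hs
  rw [h.exitSide_eq hi hi', h'.exitSide_eq hi hi']

/-- All gates lie on one loop. -/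
theorem Separated.exists_iterate_eq (h : Separated ω A B) (hs : s ∈ gates A B)
    (hξ : ξ ∈ gates A B) : ∃ m, (nxt ω)^[m] s = ξ :=
  EnhPerc.exists_iterate_eq h.finite (h.mixed hs) (h.mixed hξ)
    ((h.conn_left _ (h.opn_mem hs) _ (h.opn_mem hξ)).mono h.subset)
    ((h.conn_right _ (h.cls_mem hs) _ (h.cls_mem hξ)).mono h.notMem)

theorem orbitCrossings_eq_zero_of_notMem_gates (h : Separated ω A B) {n : ℕ}
    (hn : ∀ t < n, (nxt ω)^[t] ξ ∉ gates A B) {x y : Site} (hx : x ∈ B) (hy : y ∈ A)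
    (hξ : Mixed ω ξ) : orbitCrossings ω ξ n x y = 0 := by
  refine orbitCrossings_eq_zero ?_ ?_
  · rintro t ht ⟨rfl, rfl⟩
    exact hn t ht (mem_gates hx hy)
  · rintro t - ⟨rfl, -⟩
    exact (hξ.iterate t).cls_notMem (h.subset hy)

theorem orbitCrossings_eq_zero_left (hA : A ⊆ ω) {n : ℕ} (hξ : Mixed ω ξ) {x y : Site}
    (hx : x ∈ A) (hy : y ∈ A) : orbitCrossings ω ξ n x y = 0 := by
  refine orbitCrossings_eq_zero ?_ ?_
  · rintro t - ⟨rfl, -⟩; exact (hξ.iterate t).cls_notMem (hA hx)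
  · rintro t - ⟨rfl, -⟩; exact (hξ.iterate t).cls_notMem (hA hy)

theorem orbitCrossings_eq_zero_right (hB : ∀ x ∈ B, x ∉ ω) {n : ℕ} (hξ : Mixed ω ξ) {x y : Site}
    (hx : x ∈ B) (hy : y ∈ B) : orbitCrossings ω ξ n x y = 0 := by
  refine orbitCrossings_eq_zero ?_ ?_
  · rintro t - ⟨-, rfl⟩; exact hB _ hy (hξ.iterate t).opn_mem
  · rintro t - ⟨-, rfl⟩; exact hB _ hx (hξ.iterate t).opn_mem

/-- Two stretches of interface with common end points that leave a gate `s` bound a set of sites,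
described by a two-colouring which is constant on `A` and on `B`. -/
theorem Separated.exists_potential (h : Separated ω A B) (h' : Separated ω' A B)
    (hs : s ∈ gates A B) {n n' : ℕ}
    (hn : (nxt ω)^[n] (nxt ω s) = (nxt ω')^[n'] (nxt ω' s)) :
    ∃ f : Site → ZMod 2, (∀ x y, triLattice.Adj x y →
      orbitCrossings ω (nxt ω s) n x y + orbitCrossings ω' (nxt ω' s) n' x y = f x + f y) ∧
      (∀ x ∈ A, ∀ y ∈ A, f x = f y) ∧ ∀ x ∈ B, ∀ y ∈ B, f x = f y := by
  have hm := (h.mixed hs).nxt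
  have hm' := (h'.mixed hs).nxt
  obtain ⟨f, hf⟩ := exists_potential_of_walks
    (u := fun t => (nxt ω)^[t] (nxt ω s)) (σ := fun t => exitSide ω ((nxt ω)^[t] (nxt ω s)))
    (u' := fun t => (nxt ω')^[t] (nxt ω' s)) (σ' := fun t => exitSide ω' ((nxt ω')^[t] (nxt ω' s)))
    (n := n) (n' := n') (fun t _ => orbit_walk hm t) (fun t _ => orbit_walk hm' t)
    (h.nxt_eq h' hs) hn
  refine ⟨f, hf, fun x hx y hy => ?_, fun x hx y hy => ?_⟩
  · refine ((h.conn_left x hx y hy).eq_of_forall_adj fun u v hu hv huv =>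
      zmod_eq_of_add_eq_zero ?_).symm
    rw [← hf u v huv]
    have e1 := orbitCrossings_eq_zero_left h.subset (n := n) hm hu hv
    have e2 := orbitCrossings_eq_zero_left h'.subset (n := n') hm' hu hv
    exact (by rw [e1, e2, add_zero] :
      orbitCrossings ω (nxt ω s) n u v + orbitCrossings ω' (nxt ω' s) n' u v = 0).symm
  · refine ((h.conn_right x hx y hy).eq_of_forall_adj fun u v hu hv huv =>
      zmod_eq_of_add_eq_zero ?_).symm
    rw [← hf u v huv]
    have e1 := orbitCrossings_eq_zero_right h.notMem (n := n) hm hu hv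
    have e2 := orbitCrossings_eq_zero_right h'.notMem (n := n') hm' hu hv
    exact (by rw [e1, e2, add_zero] :
      orbitCrossings ω (nxt ω s) n u v + orbitCrossings ω' (nxt ω' s) n' u v = 0).symm

/-- The interfaces of `ω` and of `ω'` visit the common gates in the same order. Otherwise the arc
of the first one up to a later gate and the arc of the second one bound a set of sites whose
boundary contains exactly one of two gates, although `A` and `B` are connected. -/
theorem Separated.first_return_eq (h : Separated ω A B) (h' : Separated ω' A B)
    (hs : s ∈ gates A B) {n n' : ℕ}
    (hn : (nxt ω)^[n] (nxt ω s) ∈ gates A B) (hlt : ∀ t < n, (nxt ω)^[t] (nxt ω s) ∉ gates A B)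
    (hn' : (nxt ω')^[n'] (nxt ω' s) ∈ gates A B)
    (hlt' : ∀ t < n', (nxt ω')^[t] (nxt ω' s) ∉ gates A B) :
    (nxt ω)^[n] (nxt ω s) = (nxt ω')^[n'] (nxt ω' s) := by
  set k := Function.minimalPeriod (nxt ω) s with hk
  have hkpos : 0 < k := minimalPeriod_pos h.finite s
  have hk1 : Function.minimalPeriod (nxt ω) (nxt ω s) = k :=
    Function.minimalPeriod_apply (Function.minimalPeriod_pos_iff_mem_periodicPts.1 hkpos)
  have hlast : (nxt ω)^[k - 1] (nxt ω s) = s := by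
    rw [← Function.iterate_succ_apply, Nat.succ_eq_add_one, Nat.sub_add_cancel hkpos]
    exact Function.iterate_minimalPeriod
  obtain ⟨m, hmk, hm⟩ : ∃ m < k, (nxt ω)^[m] (nxt ω s) = (nxt ω')^[n'] (nxt ω' s) := by
    obtain ⟨m, hm⟩ := h.exists_iterate_eq hs hn'
    have hm2 : (nxt ω)^[m + (k - 1)] (nxt ω s) = (nxt ω')^[n'] (nxt ω' s) := by
      rw [Function.iterate_add_apply, hlast, hm]
    refine ⟨(m + (k - 1)) % k, Nat.mod_lt _ hkpos, ?_⟩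
    rw [← hm2, ← hk1]
    exact Function.iterate_mod_minimalPeriod_eq
  have hnm : n ≤ m := by
    by_contra hc
    exact hlt m (by omega) (hm ▸ hn')
  rcases hnm.eq_or_lt with rfl | hnm
  · exact hm
  exfalso
  -- The gate number `n` of the first arc is crossed once, and the gate `s` not at all.
  have hmx := (h.mixed hs).nxt
  have hmx' := (h'.mixed hs).nxt
  obtain ⟨f, hf, hfA, hfB⟩ := h.exists_potential h' hs hm
  have h1 := hf _ _ (cls_adj_opn ω s)
  rw [orbitCrossings_eq_zero_of_notMem_gates h' hlt' (h.cls_mem hs) (h.opn_mem hs) hmx',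
    add_zero, orbitCrossings_eq_zero] at h1
  · have h2 := hf _ _ (cls_adj_opn ω ((nxt ω)^[n] (nxt ω s)))
    rw [orbitCrossings_eq_zero_of_notMem_gates h' hlt' (h.cls_mem hn) (h.opn_mem hn) hmx',
      add_zero, orbitCrossings_eq_one hmx (by omega) hnm] at h2
    refine zmod_ne_of_add_eq_one h2 ?_
    rw [hfB _ (h.cls_mem hn) _ (h.cls_mem hs), hfA _ (h.opn_mem hn) _ (h.opn_mem hs)]
    exact zmod_eq_of_add_eq_zero h1
  · rintro t ht ⟨e1, e2⟩
    have e3 : (nxt ω)^[t] (nxt ω s) = (nxt ω)^[k - 1] (nxt ω s) := by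
      rw [hlast]
      exact (eq_of_cls_eq_of_opn_eq e1 e2).symm
    have := Function.iterate_injOn_Iio_minimalPeriod (f := nxt ω) (x := nxt ω s)
      (Set.mem_Iio.2 (by omega)) (Set.mem_Iio.2 (by omega)) e3
    omega
  · rintro t - ⟨e1, -⟩
    exact (hmx.iterate t).cls_notMem (e1 ▸ (h.mixed hs).opn_mem)

end

section

/-! ### Induced paths -/

/-- `η 0, …, η m` is a self-repelling path in `S`. -/
structure IsInducedPath (S : Set Site) (m : ℕ) (η : ℕ → Site) : Prop where
  mem : ∀ i ≤ m, η i ∈ S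
  adj : ∀ i < m, triLattice.Adj (η i) (η (i + 1))
  not_adj : ∀ i j, i + 1 < j → j ≤ m → ¬ triLattice.Adj (η i) (η j)
  ne : ∀ i j, i < j → j ≤ m → η i ≠ η j

/-- A shortest path is self-repelling. -/
theorem Conn.exists_inducedPath {S : Set Site} {a b : Site} (h : Conn S a b) (ha : a ∈ S) :
    ∃ m η, IsInducedPath S m η ∧ η 0 = a ∧ η m = b := by
  classical
  have hex : ∃ m : ℕ, ∃ η : ℕ → Site, (∀ i ≤ m, η i ∈ S) ∧
      (∀ i < m, triLattice.Adj (η i) (η (i + 1))) ∧ η 0 = a ∧ η m = b := by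
    induction h with
    | refl => exact ⟨0, fun _ => a, fun _ _ => ha, fun i hi => by omega, rfl, rfl⟩
    | @tail x y h1 h2 ih =>
      obtain ⟨m, η, e1, e2, e3, e4⟩ := ih
      refine ⟨m + 1, fun i => if i ≤ m then η i else y, ?_, ?_, ?_, ?_⟩
      · intro i hi
        by_cases him : i ≤ m
        · simp only [him, if_true]; exact e1 i him
        · simp only [him, if_false]; exact h2.2.1
      · intro i hi
        by_cases him : i + 1 ≤ m
        · simp only [him, if_true, (by omega : i ≤ m)]; exact e2 i him
        · obtain rfl : i = m := by omega
          simp only [le_refl, if_true, him, if_false, e4]; exact h2.2.2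
      · simp [e3]
      · simp
  obtain ⟨η, e1, e2, e3, e4⟩ := Nat.find_spec hex
  have hmin := fun k => Nat.find_min hex (m := k)
  set m := Nat.find hex with hm
  clear_value m
  refine ⟨m, η, ⟨e1, e2, ?_, ?_⟩, e3, e4⟩
  · intro i j hij hj hadj
    refine hmin (m - (j - i - 1)) (by omega)
      ⟨fun k => if k ≤ i then η k else η (k + (j - i - 1)), ?_, ?_, ?_, ?_⟩
    · intro k hk
      by_cases hki : k ≤ i
      · simp only [hki, if_true]; exact e1 k (by omega)
      · simp only [hki, if_false]; exact e1 _ (by omega)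
    · intro k hk
      by_cases hki : k + 1 ≤ i
      · simp only [hki, if_true, (by omega : k ≤ i)]; exact e2 k (by omega)
      · by_cases hki' : k ≤ i
        · obtain rfl : k = i := by omega
          have : k + 1 + (j - k - 1) = j := by omega
          simp only [le_refl, if_true, hki, if_false, this]; exact hadj
        · simp only [hki, hki', if_false]
          have : k + 1 + (j - i - 1) = k + (j - i - 1) + 1 := by omega
          rw [this]
          exact e2 _ (by omega)
    · simp [e3]
    · by_cases hki : m - (j - i - 1) ≤ i
      · omega
      · simp only [hki, if_false]
        rw [← e4]; congr 1; omega
  · intro i j hij hj heq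
    refine hmin (m - (j - i)) (by omega)
      ⟨fun k => if k ≤ i then η k else η (k + (j - i)), ?_, ?_, ?_, ?_⟩
    · intro k hk
      by_cases hki : k ≤ i
      · simp only [hki, if_true]; exact e1 k (by omega)
      · simp only [hki, if_false]; exact e1 _ (by omega)
    · intro k hk
      by_cases hki : k + 1 ≤ i
      · simp only [hki, if_true, (by omega : k ≤ i)]; exact e2 k (by omega)
      · by_cases hki' : k ≤ i
        · obtain rfl : k = i := by omega
          have : k + 1 + (j - k) = j + 1 := by omega
          simp only [le_refl, if_true, hki, if_false, this, heq]; exact e2 j (by omega)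
        · simp only [hki, hki', if_false]
          have : k + 1 + (j - i) = k + (j - i) + 1 := by omega
          rw [this]
          exact e2 _ (by omega)
    · simp [e3]
    · by_cases hki : m - (j - i) ≤ i
      · simp only [hki, if_true]
        have h1 : m - (j - i) = i := by omega
        have h2 : j = m := by omega
        rw [h1, heq, h2, e4]
      · simp only [hki, if_false]
        rw [← e4]; congr 1; omega

theorem IsInducedPath.conn {S T : Set Site} {m : ℕ} {η : ℕ → Site} (h : IsInducedPath S m η)
    {i j : ℕ} (hij : i ≤ j) (hj : j ≤ m) (hT : ∀ k, i ≤ k → k ≤ j → η k ∈ T) :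
    Conn T (η i) (η j) := by
  induction j, hij using Nat.le_induction with
  | base => exact Conn.refl _ _
  | succ j hij ih =>
    exact (ih (by omega) fun k h1 h2 => hT k h1 (by omega)).trans
      (Conn.single (hT j hij (by omega)) (hT _ (by omega) le_rfl) (h.adj j (by omega)))

/-! ### Straight arms leaving a rectangle -/

/-- The unit vector `u` points out of the rectangle `[l, h]` at its boundary site `a`. -/
def Outward (l h a u : Site) : Prop :=
  (u = (1, 0) ∧ a.1 = h.1) ∨ (u = (-1, 0) ∧ a.1 = l.1) ∨ (u = (0, 1) ∧ a.2 = h.2) ∨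
    (u = (0, -1) ∧ a.2 = l.2)

/-- The sites on the straight line from `a` in direction `u`. -/
def arm (a u : Site) (k : ℕ) : Site := (a.1 + k * u.1, a.2 + k * u.2)

/-- The nearest-point retraction of the lattice onto the rectangle `[l, h]`. -/
def clamp (l h x : Site) : Site := (max l.1 (min h.1 x.1), max l.2 (min h.2 x.2))

variable {l h a b u v : Site}

theorem arm_zero (a u : Site) : arm a u 0 = a := by simp [arm]

theorem clamp_of_mem {x : Site} (hx : x ∈ Set.Icc l h) : clamp l h x = x := by
  obtain ⟨⟨h1, h2⟩, h3, h4⟩ := hx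
  ext <;> simp only [clamp] <;> omega

theorem clamp_arm (ha : a ∈ Set.Icc l h) (hu : Outward l h a u) (k : ℕ) :
    clamp l h (arm a u k) = a := by
  obtain ⟨⟨h1, h2⟩, h3, h4⟩ := ha
  rcases hu with ⟨rfl, e⟩ | ⟨rfl, e⟩ | ⟨rfl, e⟩ | ⟨rfl, e⟩ <;> ext <;>
    simp only [clamp, arm, mul_zero, mul_one, add_zero, mul_neg] <;> omega

/-- The retraction maps neighbours to neighbours or to the same site. -/
theorem clamp_adj (hlh : l ≤ h) {x y : Site} (hxy : triLattice.Adj x y) :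
    clamp l h x = clamp l h y ∨ triLattice.Adj (clamp l h x) (clamp l h y) := by
  have key : ∀ p q t : ℤ, p ≤ q →
      max p (min q (t + 1)) = max p (min q t) ∨ max p (min q (t + 1)) = max p (min q t) + 1 := by
    intro p q t hpq
    omega
  have key' : ∀ p q t : ℤ, p ≤ q →
      max p (min q (t - 1)) = max p (min q t) ∨ max p (min q (t - 1)) = max p (min q t) - 1 := by
    intro p q t hpq
    omega
  rw [adj_iff] at hxy ⊢
  rw [Prod.ext_iff]
  have a1 := key l.1 h.1 x.1 hlh.1
  have a2 := key l.2 h.2 x.2 hlh.2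
  have a3 := key' l.1 h.1 x.1 hlh.1
  have a4 := key' l.2 h.2 x.2 hlh.2
  simp only [clamp]
  rcases hxy with ⟨e1, e2⟩ | ⟨e1, e2⟩ | ⟨e1, e2⟩ | ⟨e1, e2⟩ | ⟨e1, e2⟩ | ⟨e1, e2⟩ <;> rw [e1, e2]
  · generalize max l.1 (min h.1 (x.1 + 1)) = z₁ at *
    generalize max l.1 (min h.1 x.1) = z₂ at *
    clear a2 a3 a4
    omega
  · generalize max l.1 (min h.1 (x.1 - 1)) = z₁ at *
    generalize max l.1 (min h.1 x.1) = z₂ at *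
    clear a1 a2 a4
    omega
  · generalize max l.2 (min h.2 (x.2 + 1)) = z₁ at *
    generalize max l.2 (min h.2 x.2) = z₂ at *
    clear a1 a3 a4
    omega
  · generalize max l.2 (min h.2 (x.2 - 1)) = z₁ at *
    generalize max l.2 (min h.2 x.2) = z₂ at *
    clear a1 a2 a3
    omega
  · generalize max l.1 (min h.1 (x.1 + 1)) = z₁ at *
    generalize max l.1 (min h.1 x.1) = z₂ at *
    generalize max l.2 (min h.2 (x.2 - 1)) = z₃ at *
    generalize max l.2 (min h.2 x.2) = z₄ at *
    clear a2 a3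
    omega
  · generalize max l.1 (min h.1 (x.1 - 1)) = z₁ at *
    generalize max l.1 (min h.1 x.1) = z₂ at *
    generalize max l.2 (min h.2 (x.2 + 1)) = z₃ at *
    generalize max l.2 (min h.2 x.2) = z₄ at *
    clear a1 a4
    omega

theorem arm_notMem (hu : Outward l h a u) {k : ℕ} (hk : 1 ≤ k) : arm a u k ∉ Set.Icc l h := by
  rintro ⟨⟨h1, h2⟩, h3, h4⟩
  rcases hu with ⟨rfl, e⟩ | ⟨rfl, e⟩ | ⟨rfl, e⟩ | ⟨rfl, e⟩ <;>
    simp only [arm, mul_zero, mul_one, add_zero, mul_neg] at * <;> omega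

theorem arm_not_adj (hu : Outward l h a u) {k : ℕ} (hk : 2 ≤ k) {x : Site}
    (hx : x ∈ Set.Icc l h) : ¬ triLattice.Adj (arm a u k) x := by
  obtain ⟨⟨h1, h2⟩, h3, h4⟩ := hx
  rw [adj_iff]
  rcases hu with ⟨rfl, e⟩ | ⟨rfl, e⟩ | ⟨rfl, e⟩ | ⟨rfl, e⟩ <;>
    simp only [arm, mul_zero, mul_one, add_zero, mul_neg] at * <;> omega

theorem arm_adj_iff (hu : Outward l h a u) {j k : ℕ} :
    triLattice.Adj (arm a u j) (arm a u k) ↔ k = j + 1 ∨ j = k + 1 := by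
  rw [adj_iff]
  rcases hu with ⟨rfl, e⟩ | ⟨rfl, e⟩ | ⟨rfl, e⟩ | ⟨rfl, e⟩ <;>
    simp only [arm, mul_zero, mul_one, add_zero, mul_neg, and_true, true_and] <;> omega

theorem rad_arm (hu : Outward l h a u) (k : ℕ) : rad a (arm a u k) = k := by
  refine le_antisymm (rad_le_iff.2 ?_) (not_lt.1 fun hc => ?_)
  · rcases hu with ⟨rfl, e⟩ | ⟨rfl, e⟩ | ⟨rfl, e⟩ | ⟨rfl, e⟩ <;>
      simp only [arm, mul_zero, mul_one, add_zero, mul_neg] at * <;> omega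
  · have := rad_le_iff.1 (Int.le_sub_one_of_lt hc)
    rcases hu with ⟨rfl, e⟩ | ⟨rfl, e⟩ | ⟨rfl, e⟩ | ⟨rfl, e⟩ <;>
      simp only [arm, mul_zero, mul_one, add_zero, mul_neg] at * <;> omega

theorem arm_injective (hu : Outward l h a u) {j k : ℕ} (hjk : arm a u j = arm a u k) : j = k := by
  have h1 := rad_arm hu j
  rw [hjk, rad_arm hu k] at h1
  exact_mod_cast h1.symm

theorem exists_outward (ha : a.1 = l.1 ∨ a.1 = h.1 ∨ a.2 = l.2 ∨ a.2 = h.2) :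
    ∃ u, Outward l h a u := by
  rcases ha with e | e | e | e
  · exact ⟨_, Or.inr (Or.inl ⟨rfl, e⟩)⟩
  · exact ⟨_, Or.inl ⟨rfl, e⟩⟩
  · exact ⟨_, Or.inr (Or.inr (Or.inr ⟨rfl, e⟩))⟩
  · exact ⟨_, Or.inr (Or.inr (Or.inl ⟨rfl, e⟩))⟩

theorem HasDoublyInfinitePath.mono {ω ω' : Config} (hω : ω ⊆ ω') (hd : HasDoublyInfinitePath ω) :
    HasDoublyInfinitePath ω' := by
  obtain ⟨γ, h1, h2, h3, h4⟩ := hd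
  exact ⟨γ, h1, fun n => hω (h2 n), h3, h4⟩

/-- An injective infinite path inside a finite set and one arm runs through all far sites of the
arm. -/
theorem exists_eq_arm {F : Set Site} (hu : Outward l h a u) {M : ℕ}
    (hM : ∀ x ∈ F, rad a x < M) {γ : ℕ → Site} (hinj : Function.Injective γ)
    (hadj : ∀ n, triLattice.Adj (γ n) (γ (n + 1)))
    (hmem : ∀ n, γ n ∈ F ∨ ∃ k, γ n = arm a u k) (h0 : rad a (γ 0) < M) :
    ∃ n, 0 < n ∧ γ n = arm a u M := by
  classical
  have hex : ∃ n, (M : ℤ) ≤ rad a (γ n) := by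
    by_contra! hc
    exact Set.infinite_range_of_injective hinj
      ((finite_rad_le a M).subset (by rintro _ ⟨n, rfl⟩; exact (hc n).le))
  set n := Nat.find hex with hn
  have h1 : (M : ℤ) ≤ rad a (γ n) := Nat.find_spec hex
  have hpos : 0 < n := by
    rcases Nat.eq_zero_or_pos n with h | h
    · rw [h] at h1; omega
    · exact h
  have h2 : rad a (γ (n - 1)) < M := not_le.1 (Nat.find_min hex (by omega))
  have h3 := hadj (n - 1)
  rw [Nat.sub_add_cancel hpos] at h3
  have h4 := rad_le_of_adj a h3
  refine ⟨n, hpos, ?_⟩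
  rcases hmem n with hF | ⟨k, hk⟩
  · exact absurd (hM _ hF) (by omega)
  · rw [hk, rad_arm hu] at h1 h4
    rw [hk]
    congr 1
    omega

/-- A finite set with a single arm contains no doubly-infinite path. -/
theorem not_hasDoublyInfinitePath_arm {F : Set Site} (hF : F.Finite) (hu : Outward l h a u)
    {γ : ℤ → Site} (hinj : Function.Injective γ)
    (hadj : ∀ n, triLattice.Adj (γ n) (γ (n + 1)))
    (hmem : ∀ n, γ n ∈ F ∨ ∃ k, γ n = arm a u k) : False := by
  obtain ⟨M, hM⟩ : ∃ M : ℕ, ∀ x ∈ insert (γ 0) F, rad a x < M := by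
    obtain ⟨B, hB⟩ := ((hF.insert (γ 0)).image (rad a)).bddAbove
    exact ⟨(B + 1).toNat, fun x hx => by
      have := hB (Set.mem_image_of_mem _ hx)
      omega⟩
  obtain ⟨m, hm, hm'⟩ := exists_eq_arm (F := F) hu (fun x hx => hM x (Or.inr hx))
    (γ := fun n : ℕ => γ n) (fun i j hij => by exact_mod_cast hinj hij)
    (fun n => by exact_mod_cast hadj n) (fun n => hmem n) (hM _ (Or.inl rfl))
  obtain ⟨n, hn, hn'⟩ := exists_eq_arm (F := F) hu (fun x hx => hM x (Or.inr hx))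
    (γ := fun n : ℕ => γ (-n)) (fun i j hij => by have := hinj hij; omega)
    (fun n => by
      have := (hadj (-(n + 1 : ℕ))).symm
      simpa using this) (fun n => hmem _) (by simpa using hM _ (Or.inl rfl))
  have := hinj (hm'.trans hn'.symm)
  omega

/-- Two arms attached to a finite subset of the rectangle at sites that are not connected do not
create a doubly-infinite path. -/
theorem not_hasDoublyInfinitePath_arms {F : Set Site} (hF : F ⊆ Set.Icc l h) (ha : a ∈ F)
    (hb : b ∈ F) (hu : Outward l h a u) (hv : Outward l h b v) (hab : ¬ Conn F a b) :
    ¬ HasDoublyInfinitePath (F ∪ (Set.range (arm a u) ∪ Set.range (arm b v))) := by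
  rintro ⟨γ, hinj, hmem, hadj, -⟩
  have hlh : l ≤ h := (hF ha).1.trans (hF ha).2
  have hFfin : F.Finite := (Set.finite_Icc l h).subset hF
  have hcl : ∀ n, clamp l h (γ n) ∈ F := by
    intro n
    rcases hmem n with h | ⟨k, h⟩ | ⟨k, h⟩
    · rwa [clamp_of_mem (hF h)]
    · rwa [← h, clamp_arm (hF ha) hu]
    · rwa [← h, clamp_arm (hF hb) hv]
  have hstep : ∀ n, Conn F (clamp l h (γ n)) (clamp l h (γ (n + 1))) := fun n =>
    Conn.single_or_eq (hcl n) (hcl _) (clamp_adj hlh (hadj n))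
  have hall : ∀ n, Conn F (clamp l h (γ 0)) (clamp l h (γ n)) := by
    intro n
    induction n using Int.induction_on with
    | zero => exact Conn.refl _ _
    | succ n ih => exact ih.trans (hstep _)
    | pred n ih =>
      have := hstep (-n - 1)
      rw [sub_add_cancel] at this
      exact ih.trans this.symm
  by_cases hc : Conn F a (clamp l h (γ 0))
  · refine not_hasDoublyInfinitePath_arm hFfin hu hinj hadj fun n => ?_
    rcases hmem n with h | ⟨k, h⟩ | ⟨k, h⟩
    · exact Or.inl h
    · exact Or.inr ⟨k, h.symm⟩
    · refine absurd (hc.trans (hall n)) ?_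
      rwa [← h, clamp_arm (hF hb) hv]
  · refine not_hasDoublyInfinitePath_arm hFfin hv hinj hadj fun n => ?_
    rcases hmem n with h | ⟨k, h⟩ | ⟨k, h⟩
    · exact Or.inl h
    · refine absurd (hall n).symm ?_
      rw [← h, clamp_arm (hF ha) hu]
      exact hc
    · exact Or.inr ⟨k, h.symm⟩

/-- Two arms attached at connected sites of a subset of the rectangle create a doubly-infinite
self-repelling path. -/
theorem hasDoublyInfinitePath_arms {F : Set Site} (hF : F ⊆ Set.Icc l h) (ha : a ∈ F)
    (hb : b ∈ F) (hu : Outward l h a u) (hv : Outward l h b v) (hne : a ≠ b)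
    (hnadj : ¬ triLattice.Adj a b) (hab : Conn F a b) :
    HasDoublyInfinitePath (F ∪ (Set.range (arm a u) ∪ Set.range (arm b v))) := by
  have hlh : l ≤ h := (hF ha).1.trans (hF ha).2
  -- The arms do not meet and are not adjacent, as the retraction maps them to `a` and to `b`.
  have hsep : ∀ j k, arm a u j ≠ arm b v k ∧ ¬ triLattice.Adj (arm a u j) (arm b v k) := by
    intro j k
    constructor
    · intro he
      have := clamp_arm (hF ha) hu j
      rw [he, clamp_arm (hF hb) hv] at this
      exact hne this.symm
    · intro he
      have := clamp_adj hlh he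
      rw [clamp_arm (hF ha) hu, clamp_arm (hF hb) hv] at this
      exact this.elim hne hnadj
  -- A shortest path may only run from the first site of one arm to the first site of the other:
  -- the next site of a path in the rectangle can be adjacent to the first site of an arm as well.
  set F' : Set Site := insert (arm a u 1) (insert (arm b v 1) F) with hF'
  have hFF' : F ⊆ F' := fun x hx => Or.inr (Or.inr hx)
  have hconn : Conn F' (arm a u 1) (arm b v 1) := by
    refine (Conn.single (Or.inl rfl) (hFF' ha) ?_).trans
      ((hab.mono hFF').trans (Conn.single (hFF' hb) (Or.inr (Or.inl rfl)) ?_))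
    · have := (arm_adj_iff hu (j := 1) (k := 0)).2 (Or.inr rfl)
      rwa [arm_zero] at this
    · have := (arm_adj_iff hv (j := 0) (k := 1)).2 (Or.inl rfl)
      rwa [arm_zero] at this
  obtain ⟨m, η, hη, h0, hm⟩ := hconn.exists_inducedPath (Or.inl rfl)
  have hfar : ∀ i ≤ m, ∀ k, (1 ≤ k → 0 < i → η i ≠ arm a u k) ∧
      (2 ≤ k → 0 < i → ¬ triLattice.Adj (arm a u k) (η i)) ∧
      (1 ≤ k → i < m → η i ≠ arm b v k) ∧ (2 ≤ k → i < m → ¬ triLattice.Adj (arm b v k) (η i)) := by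
    intro i hi k
    have hA : ∀ i ≤ m, 0 < i → η i ≠ arm a u 1 := fun i h1 h2 => h0 ▸ (hη.ne 0 i h2 h1).symm
    have hB : i < m → η i ≠ arm b v 1 := fun h1 => hm ▸ hη.ne i m h1 le_rfl
    rcases hη.mem i hi with h | h | h
    · refine ⟨fun _ h1 => absurd h (hA i hi h1), fun _ h1 => absurd h (hA i hi h1), fun _ _ => ?_,
        fun _ _ => ?_⟩
      · rw [h]; exact (hsep 1 k).1
      · rw [h]; exact fun hc => (hsep 1 k).2 hc.symm
    · refine ⟨fun _ _ => ?_, fun _ _ => ?_, fun _ h1 => absurd h (hB h1),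
        fun _ h1 => absurd h (hB h1)⟩
      · rw [h]; exact (hsep k 1).1.symm
      · rw [h]; exact (hsep k 1).2
    · exact ⟨fun hk _ e => arm_notMem hu hk (e ▸ hF h), fun hk _ => arm_not_adj hu hk (hF h),
        fun hk _ e => arm_notMem hv hk (e ▸ hF h), fun hk _ => arm_not_adj hv hk (hF h)⟩
  set γ : ℤ → Site := fun n => if n < 0 then arm a u (1 - n).toNat else
    if n ≤ m then η n.toNat else arm b v (n - m + 1).toNat with hγ
  have g1 : ∀ n < 0, γ n = arm a u (1 - n).toNat := fun n hn => if_pos hn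
  have g2 : ∀ n : ℤ, 0 ≤ n → n ≤ m → γ n = η n.toNat := fun n h1 h2 => by
    simp only [hγ, not_lt.2 h1, if_false, h2, if_true]
  have g3 : ∀ n, (m : ℤ) < n → γ n = arm b v (n - m + 1).toNat := fun n h1 => by
    simp only [hγ, not_lt.2 (by omega : 0 ≤ n), if_false, not_le.2 h1]
  have hlt : ∀ i j, i < j → γ i ≠ γ j ∧ (triLattice.Adj (γ i) (γ j) → j = i + 1) := by
    intro i j hij
    rcases lt_or_ge i 0 with hi | hi
    · rw [g1 i hi]
      rcases lt_or_ge j 0 with hj | hj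
      · rw [g1 j hj, arm_adj_iff hu]
        exact ⟨fun hc => by have := arm_injective hu hc; omega, fun hc => by omega⟩
      · rcases le_or_gt j m with hjm | hjm
        · rw [g2 j hj hjm]
          rcases hj.eq_or_lt with rfl | hj
          · rw [Int.toNat_zero, h0, arm_adj_iff hu]
            exact ⟨fun hc => by have := arm_injective hu hc; omega, fun hc => by omega⟩
          · obtain ⟨q1, q2, -, -⟩ := hfar j.toNat (by omega) (1 - i).toNat
            exact ⟨(q1 (by omega) (by omega)).symm, fun hc => absurd hc (q2 (by omega) (by omega))⟩
        · rw [g3 j hjm]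
          exact ⟨(hsep _ _).1, fun hc => absurd hc (hsep _ _).2⟩
    · rcases le_or_gt i m with him | him
      · rw [g2 i hi him]
        rcases le_or_gt j m with hjm | hjm
        · rw [g2 j (by omega) hjm]
          refine ⟨hη.ne _ _ (by omega) (by omega), fun hc => ?_⟩
          by_contra hne
          exact hη.not_adj _ _ (by omega) (by omega) hc
        · rw [g3 j hjm]
          rcases him.eq_or_lt with rfl | him
          · rw [Int.toNat_natCast, hm, arm_adj_iff hv]
            exact ⟨fun hc => by have := arm_injective hv hc; omega, fun hc => by omega⟩
          · obtain ⟨-, -, q1, q2⟩ := hfar i.toNat (by omega) (j - m + 1).toNat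
            exact ⟨q1 (by omega) (by omega), fun hc => absurd hc.symm (q2 (by omega) (by omega))⟩
      · rw [g3 i him, g3 j (by omega), arm_adj_iff hv]
        exact ⟨fun hc => by have := arm_injective hv hc; omega, fun hc => by omega⟩
  refine ⟨γ, ?_, ?_, ?_, ?_⟩
  · intro i j hij
    rcases lt_trichotomy i j with h | h | h
    · exact absurd hij (hlt i j h).1
    · exact h
    · exact absurd hij.symm (hlt j i h).1
  · intro n
    rcases lt_or_ge n 0 with hn | hn
    · rw [g1 n hn]; exact Or.inr (Or.inl ⟨_, rfl⟩)
    · rcases le_or_gt n m with hnm | hnm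
      · rw [g2 n hn hnm]
        rcases hη.mem n.toNat (by omega) with h | h | h
        · rw [h]; exact Or.inr (Or.inl ⟨_, rfl⟩)
        · rw [h]; exact Or.inr (Or.inr ⟨_, rfl⟩)
        · exact Or.inl h
      · rw [g3 n hnm]; exact Or.inr (Or.inr ⟨_, rfl⟩)
  · intro n
    rcases lt_or_ge n 0 with hn | hn
    · rw [g1 n hn]
      rcases lt_or_ge (n + 1) 0 with hn' | hn'
      · rw [g1 _ hn', arm_adj_iff hu]; omega
      · rw [g2 _ hn' (by omega)]
        obtain rfl : n = -1 := by omega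
        rw [show (-1 + 1 : ℤ).toNat = 0 from rfl, h0, arm_adj_iff hu]
        decide
    · rcases lt_or_ge n m with hnm | hnm
      · rw [g2 n hn hnm.le, g2 (n + 1) (by omega) (by omega)]
        have := hη.adj n.toNat (by omega)
        rwa [show (n + 1).toNat = n.toNat + 1 by omega]
      · rw [g3 (n + 1) (by omega)]
        rcases hnm.eq_or_lt with rfl | hnm
        · rw [g2 _ hn le_rfl, Int.toNat_natCast, hm, arm_adj_iff hv]; omega
        · rw [g3 n hnm, arm_adj_iff hv]; omega
  · intro i j hij
    rcases lt_trichotomy i j with h | h | h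
    · exact Or.inl ((hlt i j h).2 hij)
    · exact absurd (h ▸ hij) (triLattice.irrefl)
    · exact Or.inr ((hlt j i h).2 hij.symm)

/-! ### Nonessential enhancements -/

theorem HasDoublyInfinitePath.translate {ω ω' : Config} (x : Site)
    (hx : ∀ y ∈ ω, y + x ∈ ω') (hd : HasDoublyInfinitePath ω) : HasDoublyInfinitePath ω' := by
  obtain ⟨γ, h1, h2, h3, h4⟩ := hd
  have e : ∀ y z : Site, triLattice.Adj (y + x) (z + x) ↔ triLattice.Adj y z := fun y z => by
    change z + x - (y + x) ∈ nbrVectors ↔ z - y ∈ nbrVectors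
    rw [add_sub_add_right_eq_sub]
  exact ⟨fun n => γ n + x, fun i j hij => h1 (add_right_cancel hij), fun n => hx _ (h2 n),
    fun n => (e _ _).2 (h3 n), fun m n hmn => h4 m n ((e _ _).1 hmn)⟩

variable {φ : Config → Config}

theorem enhanceAt_mono (hmono : Monotone φ) (x : Site) {ω ω' : Config} (hω : ω ⊆ ω') :
    enhanceAt φ x ω ⊆ enhanceAt φ x ω' :=
  Set.image_mono (hmono fun _ hy => hω hy)

/-- Activating one site cannot create a doubly-infinite path. -/
theorem not_hasDoublyInfinitePath_enhanceAt (hness : ¬ IsEssential φ) (x : Site) {ω : Config}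
    (hω : ¬ HasDoublyInfinitePath ω) : ¬ HasDoublyInfinitePath (ω ∪ enhanceAt φ x ω) := by
  intro hd
  refine hness ⟨shift x ω, fun hc => hω (hc.translate x fun y hy => hy), ?_⟩
  refine hd.translate (-x) ?_
  rintro y (hy | ⟨z, hz, rfl⟩)
  · exact Or.inl (by simpa [shift] using hy)
  · refine Or.inr ?_
    have : x + z + -x = z := by abel
    simpa only [this] using hz

/-- Activating finitely many sites one after the other dominates their simultaneous activation. -/
theorem exists_superset_not_hasDoublyInfinitePath (hmono : Monotone φ) (hness : ¬ IsEssential φ)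
    {ω : Config} (hω : ¬ HasDoublyInfinitePath ω) (β : Finset Site) :
    ∃ ω', ω ⊆ ω' ∧ (∀ x ∈ β, enhanceAt φ x ω ⊆ ω') ∧ ¬ HasDoublyInfinitePath ω' := by
  classical
  induction β using Finset.induction_on with
  | empty => exact ⟨ω, subset_rfl, by simp, hω⟩
  | insert x β _ ih =>
    obtain ⟨ω', h1, h2, h3⟩ := ih
    refine ⟨ω' ∪ enhanceAt φ x ω', fun y hy => Or.inl (h1 hy), ?_,
      not_hasDoublyInfinitePath_enhanceAt hness x h3⟩
    intro z hz
    rcases Finset.mem_insert.1 hz with rfl | hz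
    · exact fun y hy => Or.inr (enhanceAt_mono hmono z h1 hy)
    · exact fun y hy => Or.inl (h2 z hz hy)

/-- A nonessential enhancement does not connect boundary sites of a rectangle: otherwise straight
arms attached to them would become parts of a doubly-infinite path. -/
theorem conn_of_conn_enhanced (hmono : Monotone φ) (hness : ¬ IsEssential φ) {F α : Set Site}
    (hF : F ⊆ Set.Icc l h) (ha : a ∈ F) (hb : b ∈ F)
    (ha' : a.1 = l.1 ∨ a.1 = h.1 ∨ a.2 = l.2 ∨ a.2 = h.2)
    (hb' : b.1 = l.1 ∨ b.1 = h.1 ∨ b.2 = l.2 ∨ b.2 = h.2)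
    (hab : Conn (Set.Icc l h ∩ enhanced φ F α) a b) : Conn F a b := by
  classical
  by_contra hc
  obtain ⟨u, hu⟩ := exists_outward ha'
  obtain ⟨v, hv⟩ := exists_outward hb'
  set T := Set.range (arm a u) ∪ Set.range (arm b v) with hT
  have hS := not_hasDoublyInfinitePath_arms hF ha hb hu hv hc
  -- One activated site responsible for each enhanced site of the rectangle suffices, so that `α`
  -- may be replaced by a finite set.
  have hex : ∀ z : Site, ∃ x, (∃ x ∈ α, z ∈ enhanceAt φ x F) → z ∈ enhanceAt φ x F := by
    intro z
    by_cases hz : ∃ x ∈ α, z ∈ enhanceAt φ x F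
    · obtain ⟨x, -, hx⟩ := hz
      exact ⟨x, fun _ => hx⟩
    · exact ⟨0, fun h => absurd h hz⟩
  choose g hg using hex
  obtain ⟨Ω, h1, h2, h3⟩ := exists_superset_not_hasDoublyInfinitePath hmono hness hS
    ((Set.finite_Icc l h).toFinset.image g)
  have hsub : Set.Icc l h ∩ enhanced φ F α ⊆ Ω := by
    rintro z ⟨hz, hz'⟩
    rcases hz' with hz' | hz'
    · exact h1 (Or.inl hz')
    · simp only [Set.mem_iUnion] at hz'
      obtain ⟨x, hx, hx'⟩ := hz'
      refine h2 (g z) (Finset.mem_image_of_mem _ ((Set.finite_Icc l h).mem_toFinset.2 hz)) ?_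
      exact enhanceAt_mono hmono _ (fun y hy => Or.inl hy) (hg z ⟨x, hx, hx'⟩)
  have hFE : F ⊆ Set.Icc l h ∩ enhanced φ F α := fun x hx => ⟨hF hx, Or.inl hx⟩
  have hd := hasDoublyInfinitePath_arms Set.inter_subset_left (hFE ha) (hFE hb) hu hv
    (fun e => hc (e ▸ Conn.refl _ _)) (fun e => hc (Conn.single ha hb e)) hab
  exact h3 (hd.mono (Set.union_subset hsub fun x hx => h1 (Or.inr hx)))

end

section

/-- A nonessential monotonic enhancement function, whose range is measured in the sup norm of the
lattice coordinates. -/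
structure Admissible (φ : Config → Config) (R : ℤ) : Prop where
  nonneg : 0 ≤ R
  mono : Monotone φ
  ness : ¬ IsEssential φ
  congr : ∀ ω ω' : Config, (∀ y, rad 0 y ≤ R → (y ∈ ω ↔ y ∈ ω')) → φ ω = φ ω'
  range : ∀ ω, ∀ y ∈ φ ω, rad 0 y ≤ R

theorem rad_zero_shift (x y : Site) : rad x (y + x) = rad 0 y := by
  simp [rad]

theorem exists_admissible {φ : Config → Config} {R₀ : ℝ} (hφ : IsEnhancementFunction φ R₀)
    (hmono : Monotone φ) (hness : ¬ IsEssential φ) : ∃ R, Admissible φ R := by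
  obtain ⟨R, hR⟩ : ∃ R : ℕ, 2 * R₀ ≤ R := exists_nat_ge _
  have hball : ∀ y ∈ siteBall R₀, rad 0 y ≤ R := by
    intro y hy
    have hy : ‖y.pos‖ ≤ R₀ := hy
    have h1 := (Complex.abs_re_le_norm y.pos).trans hy
    have h2 := (Complex.abs_im_le_norm y.pos).trans hy
    simp only [Site.pos] at h1 h2
    have h3 : (1.7 : ℝ) ≤ √3 := Real.le_sqrt_of_sq_le (by norm_num)
    rw [abs_mul, abs_of_nonneg (by positivity)] at h2
    have h4 : |(y.2 : ℝ)| ≤ 2 * R₀ := by nlinarith [abs_nonneg (y.2 : ℝ)]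
    have h4' : |(y.2 : ℝ)| ≤ 1.2 * R₀ := by nlinarith [abs_nonneg (y.2 : ℝ)]
    have h5 : |(y.1 : ℝ)| ≤ 2 * R₀ := by
      have e : (y.1 : ℝ) = (y.1 + y.2 / 2) - y.2 / 2 := by ring
      rw [e]
      refine (abs_sub _ _).trans ?_
      rw [abs_div, abs_two]
      linarith [abs_nonneg (y.2 : ℝ)]
    have h6 : |y.1| ≤ (R : ℤ) := by exact_mod_cast h5.trans hR
    have h7 : |y.2| ≤ (R : ℤ) := by exact_mod_cast h4.trans hR
    simpa [rad] using And.intro h6 h7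
  refine ⟨R, by positivity, hmono, hness, fun ω ω' h => hφ.1 _ _ ?_, fun ω y hy =>
    hball y (hφ.2 ω hy)⟩
  ext y
  exact ⟨fun hy => ⟨(h y (hball y hy.2)).1 hy.1, hy.2⟩,
    fun hy => ⟨(h y (hball y hy.2)).2 hy.1, hy.2⟩⟩

variable {φ : Config → Config} {R : ℤ} {ω ω' α : Config}

theorem Admissible.rad_le (h : Admissible φ R) {x p : Site} (hp : p ∈ enhanceAt φ x ω) :
    rad x p ≤ R := by
  obtain ⟨y, hy, rfl⟩ := hp
  have := h.range _ y hy
  rwa [← rad_zero_shift x y, add_comm y x] at this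

theorem Admissible.enhanceAt_subset (h : Admissible φ R) {x : Site}
    (hω : ∀ y, rad x y ≤ R → y ∈ ω → y ∈ ω') : enhanceAt φ x ω ⊆ enhanceAt φ x ω' := by
  refine Set.image_mono ?_
  rw [h.congr (shift x ω) (shift x ω ∩ {y | rad 0 y ≤ R}) fun y hy =>
    ⟨fun h => ⟨h, hy⟩, fun h => h.1⟩]
  exact h.mono fun y hy => hω _ ((rad_zero_shift x y).trans_le hy.2) hy.1

theorem mem_enhanced_iff {z : Site} :
    z ∈ enhanced φ ω α ↔ z ∈ ω ∨ ∃ x ∈ α, z ∈ enhanceAt φ x ω := by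
  simp [enhanced]

theorem subset_enhanced : ω ⊆ enhanced φ ω α := fun _ hx => Or.inl hx

/-- Box version of `conn_of_conn_enhanced`. -/
theorem Admissible.conn_of_conn (h : Admissible φ R) {F : Set Site} {c : Site} {n : ℤ}
    (hF : ∀ x ∈ F, rad c x ≤ n) {a b : Site} (ha : a ∈ F) (hb : b ∈ F) (ha' : rad c a = n)
    (hb' : rad c b = n) (hab : Conn ({x | rad c x ≤ n} ∩ enhanced φ F α) a b) : Conn F a b := by
  have e : {x | rad c x ≤ n} = Set.Icc (c.1 - n, c.2 - n) (c.1 + n, c.2 + n) := by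
    ext x
    rw [Set.mem_ofPred_eq, rad_le_iff]
    exact ⟨fun h => ⟨⟨h.1, h.2.2.1⟩, ⟨h.2.1, h.2.2.2⟩⟩, fun h => ⟨h.1.1, h.2.1, h.1.2, h.2.2⟩⟩
  have hbd : ∀ a : Site, rad c a = n → a.1 = c.1 - n ∨ a.1 = c.1 + n ∨ a.2 = c.2 - n ∨
      a.2 = c.2 + n := by
    intro a ha
    have h1 := rad_le_iff.1 ha.le
    have h2 := lt_rad_iff.1 ((sub_one_lt n).trans_eq ha.symm)
    omega
  refine conn_of_conn_enhanced h.mono h.ness (l := (c.1 - n, c.2 - n)) (h := (c.1 + n, c.2 + n))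
    ?_ ha hb (hbd a ha') (hbd b hb') (e ▸ hab)
  rw [← e]
  exact hF

/-! ### Self-repelling closed paths survive the enhancement -/

set_option maxRecDepth 10000 in
/-- The neighbours of a site form a hexagon. If `q` and `o` are distinct and not adjacent in it, then
from a neighbour `d` of `q` one gets in at most two steps, avoiding `q` and `o`, to a neighbour of
`o`. -/
theorem exists_around : ∀ d ∈ nbrVectors, ∀ q ∈ nbrVectors, ∀ o ∈ nbrVectors, q - d ∈ nbrVectors →
    q ≠ o → o - q ∉ nbrVectors → ∃ s ∈ nbrVectors, (d = s ∨ s - d ∈ nbrVectors) ∧ s ≠ q ∧ s ≠ o ∧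
      ∃ t ∈ nbrVectors, (s = t ∨ t - s ∈ nbrVectors) ∧ t ≠ q ∧ t ≠ o ∧ o - t ∈ nbrVectors := by
  decide

/-- Turning around `z`, from a common neighbour of `q` and `z` to a common neighbour of `z`
and `o`. -/
theorem exists_conn_around {z q o c : Site} (hq : triLattice.Adj z q) (ho : triLattice.Adj z o)
    (hc : triLattice.Adj z c) (hcq : triLattice.Adj c q) (hqo : q ≠ o)
    (hqo' : ¬ triLattice.Adj q o) {S : Set Site}
    (hS : ∀ y, triLattice.Adj z y → y ≠ q → y ≠ o → y ∈ S) :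
    ∃ c', triLattice.Adj z c' ∧ triLattice.Adj c' o ∧ Conn S c c' := by
  have hadj : ∀ x y : Site, triLattice.Adj x y ↔ y - x ∈ nbrVectors := fun _ _ => Iff.rfl
  have hsub : ∀ x y : Site, x - z - (y - z) = x - y := fun x y => sub_sub_sub_cancel_right _ _ _
  have hcS : c ∈ S := hS c hc hcq.ne fun h => hqo' (h ▸ hcq.symm)
  obtain ⟨s, hs, hs1, hs2, hs3, t, ht, ht1, ht2, ht3, ht4⟩ :=
    exists_around (c - z) hc (q - z) hq (o - z) ho (by rwa [hsub]) (by simpa using hqo)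
      (by rwa [hsub])
  have hsS : s + z ∈ S := by
    refine hS _ ((hadj _ _).2 (by simpa using hs)) ?_ ?_
    · rintro rfl; exact hs2 (by simp)
    · rintro rfl; exact hs3 (by simp)
  have htS : t + z ∈ S := by
    refine hS _ ((hadj _ _).2 (by simpa using ht)) ?_ ?_
    · rintro rfl; exact ht2 (by simp)
    · rintro rfl; exact ht3 (by simp)
  refine ⟨t + z, (hadj _ _).2 (by simpa using ht), (hadj _ _).2 ?_,
    (Conn.single_or_eq hcS hsS ?_).trans (Conn.single_or_eq hsS htS ?_)⟩
  · rwa [← sub_sub, sub_right_comm]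
  · rcases hs1 with h | h
    · left; rw [← h]; simp
    · right
      rw [hadj, show s + z - c = s - (c - z) by abel]
      exact h
  · rcases ht1 with h | h
    · left; rw [h]
    · right
      rw [hadj, add_sub_add_right_eq_sub]
      exact h

theorem IsInducedPath.adj_cases {S : Set Site} {m : ℕ} {η : ℕ → Site} (h : IsInducedPath S m η)
    {i j : ℕ} (hi : i ≤ m) (hj : j ≤ m) (hij : triLattice.Adj (η i) (η j)) :
    j = i + 1 ∨ i = j + 1 := by
  rcases lt_trichotomy i j with hlt | rfl | hlt
  · by_contra hc
    exact h.not_adj i j (by omega) hj hij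
  · exact absurd hij triLattice.irrefl
  · by_contra hc
    exact h.not_adj j i (by omega) hi hij.symm

/-- Sites beside a self-repelling path can be followed, off the path, to its end. -/
theorem IsInducedPath.exists_conn_beside {S : Set Site} {m : ℕ} {η : ℕ → Site}
    (h : IsInducedPath S m η) {j : ℕ} (hj : j < m) {c : Site} (hc : triLattice.Adj (η j) c)
    (hc' : triLattice.Adj c (η (j + 1))) :
    ∃ c', triLattice.Adj c' (η m) ∧ Conn {y | ∀ i ≤ m, y ≠ η i} c c' := by
  obtain ⟨n, hn⟩ : ∃ n, m = j + 1 + n := ⟨m - (j + 1), by omega⟩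
  induction n generalizing j c with
  | zero => exact ⟨c, by rwa [hn], Conn.refl _ _⟩
  | succ n ih =>
    obtain ⟨c', h1, h2, h3⟩ := exists_conn_around (z := η (j + 1)) (q := η j) (o := η (j + 2))
      (S := {y | ∀ i ≤ m, y ≠ η i}) (h.adj j hj).symm (h.adj (j + 1) (by omega)) hc'.symm hc.symm
      (h.ne j (j + 2) (by omega) (by omega)) (h.not_adj j (j + 2) (by omega) (by omega)) (by
        rintro y hy hyq hyo i hi rfl
        rcases h.adj_cases (by omega) hi hy with rfl | hi
        · exact hyo rfl
        · exact hyq (by rw [show i = j by omega]))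
    obtain ⟨c'', h4, h5⟩ := ih (j := j + 1) (by omega) h1 h2 (by omega)
    exact ⟨c'', h4, h3.trans h5⟩

/-- A self-repelling closed path from outside the range of the activated site `x` to outside is not
touched by the enhancement at `x`. Otherwise an enhanced site of the path would join the two sides
of the path. -/
theorem Admissible.notMem_enhanceAt (h : Admissible φ R) {m : ℕ} {η : ℕ → Site}
    (hη : IsInducedPath ωᶜ m η) {x : Site} (h0 : R + 1 < rad x (η 0)) (hm : R + 1 < rad x (η m))
    {k : ℕ} (hk : k ≤ m) : η k ∉ enhanceAt φ x ω := by
  intro hp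
  have hpR := h.rad_le hp
  have hk0 : 0 < k := by
    rcases Nat.eq_zero_or_pos k with rfl | h
    · omega
    · exact h
  have hkm : k < m := by
    rcases hk.eq_or_lt with rfl | h
    · omega
    · exact h
  set G : Set Site := {y | ∀ i ≤ m, y ≠ η i} with hG
  set F : Set Site := G ∩ {y | rad x y ≤ R + 1} with hF
  obtain ⟨τ, i, hτ, hτ'⟩ := exists_side (hη.adj k hkm)
  obtain ⟨j, -, hj1, hj2⟩ := exists_nbr_nbr τ i
  -- Each of the two common neighbours of `η k` and `η (k + 1)` is connected, off the path, to the
  -- boundary of the box of radius `R + 1`.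
  have hside : ∀ c, triLattice.Adj (η k) c → triLattice.Adj c (η (k + 1)) →
      c ∈ F ∧ ∃ e ∈ F, rad x e = R + 1 ∧ Conn F c e := by
    intro c hc hc'
    have hcG : c ∈ G := by
      rintro i hi rfl
      have h1 := hη.adj_cases hk hi hc
      have h2 := hη.adj_cases hi hkm hc'
      omega
    have hcR : rad x c ≤ R + 1 := (rad_le_of_adj x hc).trans (by omega)
    obtain ⟨c', h1, h2⟩ := hη.exists_conn_beside hkm hc hc'
    have h3 := rad_le_of_adj x h1
    obtain ⟨e, he, he', he''⟩ := h2.exists_first (h := rad x) (fun _ _ => rad_le_of_adj x) hcG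
      (t := R + 1) hcR (by omega)
    exact ⟨⟨hcG, hcR⟩, e, ⟨he, he'.le⟩, he', he''⟩
  have e2 : ∀ i : Fin 3, i ≠ i + 2 ∧ i + 2 ≠ i + 1 ∧ i + 1 ≠ i + 2 := by decide
  have hlp : triLattice.Adj (η k) (vtx τ (i + 2)) := hτ ▸ vtx_adj_of_ne (e2 i).1
  have hln : triLattice.Adj (vtx τ (i + 2)) (η (k + 1)) := hτ' ▸ vtx_adj_of_ne (e2 i).2.1
  have hrp : triLattice.Adj (η k) (vtx (nbr τ i) (j + 2)) := by
    rw [← hτ, ← hj2]; exact vtx_adj_of_ne (e2 j).2.2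
  have hrn : triLattice.Adj (vtx (nbr τ i) (j + 2)) (η (k + 1)) := by
    rw [← hτ', ← hj1]; exact vtx_adj_of_ne (e2 j).1.symm
  obtain ⟨hl, a, ha, ha', hla⟩ := hside _ hlp hln
  obtain ⟨hr, b, hb, hb', hrb⟩ := hside _ hrp hrn
  -- The two sides of the path are connected through its site `η k` in the enhanced configuration.
  have hpF : η k ∈ {y | rad x y ≤ R + 1} ∩ enhanced φ F {x} := by
    have hsub : enhanceAt φ x ω ⊆ enhanceAt φ x F := h.enhanceAt_subset fun y hy hyω =>
      ⟨by rintro i hi rfl; exact hη.mem i hi hyω, by rw [Set.mem_ofPred_eq]; omega⟩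
    exact ⟨by rw [Set.mem_ofPred_eq]; omega, mem_enhanced_iff.2 (Or.inr ⟨x, rfl, hsub hp⟩)⟩
  have hFE : F ⊆ {y | rad x y ≤ R + 1} ∩ enhanced φ F {x} := fun y hy =>
    ⟨hy.2, subset_enhanced hy⟩
  have hab : Conn F a b := h.conn_of_conn (fun y hy => hy.2) ha hb ha' hb'
    ((hla.symm.mono hFE).trans ((Conn.single (hFE hl) hpF hlp.symm).trans
      ((Conn.single hpF (hFE hr) hrp).trans (hrb.mono hFE))))
  have hlr : Conn F (vtx τ (i + 2)) (vtx (nbr τ i) (j + 2)) := hla.trans (hab.trans hrb.symm)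
  -- By planarity they are not connected off the path, as both ends of the path lie outside.
  have hmemF : ∀ y, Conn F (vtx τ (i + 2)) y → y ∈ F := fun y hy => hy.mem hl
  set B : Set Site := {y | R + 1 < rad x y} ∪ {y | ∃ i ≤ m, i ≠ k ∧ y = η i} with hB
  have hBη : ∀ i ≤ m, i ≠ k → η i ∈ B := fun i h1 h2 => Or.inr ⟨i, h1, h2, rfl⟩
  have hout : ∀ y z, R + 1 < rad x y → R + 1 < rad x z → Conn B y z := fun y z hy hz =>
    (conn_outside_box hy hz).mono fun _ h => Or.inl h
  have hBm : ∀ y ∈ B, Conn B y (η m) := by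
    rintro y (hy | ⟨i, hi, hik, rfl⟩)
    · exact hout _ _ hy hm
    · rcases lt_or_gt_of_ne hik with hlt | hlt
      · exact (hη.conn (T := B) (Nat.zero_le i) hi fun n _ h2 =>
          hBη n (by omega) (by omega)).symm.trans (hout _ _ h0 hm)
      · exact hη.conn hi le_rfl fun n h1 h2 => hBη n h2 (by omega)
  refine not_interlaced (A := {y | Conn F (vtx τ (i + 2)) y}) (B := B)
    ((finite_rad_le x (R + 1)).subset fun y hy => (hmemF y hy).2)
    (fun y hy z hz => hy.cluster.symm.trans hz.cluster)
    (fun y hy z hz => (hBm y hy).trans (hBm z hz).symm) ?_ (τ := τ) (i := i) (j := j + 2) ?_ ?_ ?_ (Conn.refl _ _) hlr (q := η (k - 1))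
    (hBη _ (by omega) (by omega)) ?_ ?_
  · rintro y hy (hy' | ⟨i, hi, -, rfl⟩)
    · have := (hmemF y hy).2
      simp only [Set.mem_ofPred_eq] at this hy'
      omega
    · exact (hmemF _ hy).1 i hi rfl
  · rw [hτ]
    exact fun hy => (hmemF _ hy).1 k hk rfl
  · rw [hτ]
    rintro (hy | ⟨i, hi, hik, he⟩)
    · simp only [Set.mem_ofPred_eq] at hy
      omega
    · rcases lt_or_gt_of_ne hik with hlt | hlt
      · exact hη.ne i k hlt hk he.symm
      · exact hη.ne k i hlt hi he
  · rw [hτ']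
    exact hBη _ hkm (by omega)
  · rw [hτ]
    have := hη.adj (k - 1) (by omega)
    rw [Nat.sub_add_cancel hk0] at this
    exact this.symm
  · rw [hτ']
    exact hη.ne _ _ (by omega) (by omega)

/-- Long connected sets of closed sites contain long connected sets of sites that remain closed. -/
theorem Admissible.exists_conn_closed (h : Admissible φ R) {Y : Set Site} (hY : Y ⊆ ωᶜ)
    {u v : Site} (hu : u ∈ Y) (huv : Conn Y u v) (hfar : 4 * R + 4 ≤ rad u v) :
    ∃ e e', e ∈ Y ∩ (enhanced φ ω α)ᶜ ∧ Conn Y u e ∧ Conn (Y ∩ (enhanced φ ω α)ᶜ) e e' ∧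
      rad u e = 2 * R + 2 ∧ rad v e' = 2 * R + 2 := by
  have hR := h.nonneg
  obtain ⟨m, η, hη, h0, hm⟩ := huv.exists_inducedPath hu
  have hη' : IsInducedPath ωᶜ m η := ⟨fun i hi => hY (hη.mem i hi), hη.adj, hη.not_adj, hη.ne⟩
  set S : Set Site := {y | ∃ i ≤ m, y = η i} with hS
  have hSY : S ⊆ Y := by
    rintro y ⟨i, hi, rfl⟩
    exact hη.mem i hi
  have hconn : Conn S u v := by
    rw [← h0, ← hm]
    exact hη.conn (Nat.zero_le m) le_rfl fun i _ hi => ⟨i, hi, rfl⟩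
  have huS : u ∈ S := ⟨0, by omega, h0.symm⟩
  have hvS : v ∈ S := ⟨m, le_rfl, hm.symm⟩
  have hlip : ∀ c x y, triLattice.Adj x y → -rad c y ≤ -rad c x + 1 := by
    intro c x y hxy
    have := rad_le_of_adj c hxy.symm
    omega
  obtain ⟨e, he, he', hve⟩ := hconn.symm.exists_first (hlip u) hvS (t := -(2 * R + 2))
    (by omega) (by rw [rad_self]; omega)
  have heu : rad u e = 2 * R + 2 := by omega
  have heS : e ∈ S ∩ {x | -rad u x ≤ -(2 * R + 2)} := ⟨he, he'.le⟩
  have htri := rad_triangle u e v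
  rw [rad_comm e v] at htri
  obtain ⟨e', he1, he2, hee⟩ := hve.symm.exists_first (hlip v) heS (t := -(2 * R + 2))
    (by omega) (by rw [rad_self]; omega)
  have hsub : S ∩ {x | -rad u x ≤ -(2 * R + 2)} ∩ {x | -rad v x ≤ -(2 * R + 2)} ⊆
      Y ∩ (enhanced φ ω α)ᶜ := by
    rintro y ⟨⟨hy, hyu⟩, hyv⟩
    refine ⟨hSY hy, fun hc => ?_⟩
    simp only [Set.mem_ofPred_eq] at hyu hyv
    obtain ⟨i, hi, rfl⟩ := hy
    rcases mem_enhanced_iff.1 hc with hc | ⟨x, -, hx⟩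
    · exact hη'.mem i hi hc
    · have h1 := h.rad_le hx
      have h2 := rad_triangle u x (η i)
      have h3 := rad_triangle v x (η i)
      rw [rad_comm u x] at h2
      rw [rad_comm v x] at h3
      exact h.notMem_enhanceAt hη' (x := x) (by rw [h0]; omega) (by rw [hm]; omega) hi hx
  refine ⟨e, e', hsub ⟨heS, ?_⟩, ?_, hee.mono hsub, heu, by omega⟩
  · rw [Set.mem_ofPred_eq]; omega
  · exact (hconn.trans (hve.mono fun _ hy => hy.1)).mono hSY

/-- A closed cluster of `ω` contains at most one large closed cluster of the enhanced
configuration: a shortest connection between two such clusters would be part of a long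
self-repelling closed path, and hence remain closed. -/
theorem Admissible.conn_closed (h : Admissible φ R) {u w : Site} (hu : u ∉ enhanced φ ω α)
    (hw : w ∉ enhanced φ ω α) (huw : Conn ωᶜ u w)
    (hLu : ∀ x, ∃ z, Conn (enhanced φ ω α)ᶜ u z ∧ R + 1 < rad x z)
    (hLw : ∀ x, ∃ z, Conn (enhanced φ ω α)ᶜ w z ∧ R + 1 < rad x z) :
    Conn (enhanced φ ω α)ᶜ u w := by
  classical
  by_contra hno
  set E := enhanced φ ω α with hE
  have hQ : ∀ z, Conn Eᶜ u z → z ∉ E := fun z hz => hz.mem hu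
  have hQ' : ∀ z, Conn Eᶜ w z → z ∉ E := fun z hz => hz.mem hw
  have hEω : ∀ z, z ∉ E → z ∈ ωᶜ := fun z hz hc => hz (subset_enhanced hc)
  have hex : ∃ m : ℕ, ∃ ρ : ℕ → Site, (∀ i ≤ m, ρ i ∈ ωᶜ) ∧
      (∀ i < m, triLattice.Adj (ρ i) (ρ (i + 1))) ∧ Conn Eᶜ u (ρ 0) ∧ Conn Eᶜ w (ρ m) := by
    obtain ⟨m, ρ, hρ, h0, hm⟩ := huw.exists_inducedPath (hEω u hu)
    exact ⟨m, ρ, hρ.mem, hρ.adj, h0 ▸ Conn.refl _ _, hm ▸ Conn.refl _ _⟩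
  obtain ⟨ρ, e1, e2, e3, e4⟩ := Nat.find_spec hex
  have hmin := fun k => Nat.find_min hex (m := k)
  set m := Nat.find hex with hm
  clear_value m
  have hm0 : 0 < m := by
    rcases Nat.eq_zero_or_pos m with rfl | h
    · exact absurd (e3.trans e4.symm) hno
    · exact h
  have hnot : ∀ i, 1 ≤ i → i ≤ m → ¬ Conn Eᶜ u (ρ i) := by
    intro i hi him hc
    refine hmin (m - i) (by omega) ⟨fun k => ρ (k + i), fun k hk => e1 _ (by omega), fun k hk => ?_,
      by simpa using hc, by simpa [Nat.sub_add_cancel him] using e4⟩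
    have := e2 (k + i) (by omega)
    rwa [show k + i + 1 = k + 1 + i by omega] at this
  have hnadj : ∀ i, 2 ≤ i → i ≤ m → ∀ q, Conn Eᶜ u q → ¬ triLattice.Adj q (ρ i) := by
    intro i hi him q hq hadj
    refine hmin (m - i + 1) (by omega) ⟨fun k => if k = 0 then q else ρ (k + i - 1), ?_, ?_, ?_, ?_⟩
    · intro k hk
      by_cases hk0 : k = 0
      · simp only [hk0, if_true]; exact hEω q (hQ q hq)
      · simp only [hk0, if_false]; exact e1 _ (by omega)
    · intro k hk
      by_cases hk0 : k = 0
      · simp only [hk0, if_true, zero_add, one_ne_zero, if_false, Nat.add_sub_cancel_left]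
        exact hadj
      · simp only [hk0, if_false, Nat.succ_ne_zero]
        rw [show k + 1 + i - 1 = k + i - 1 + 1 by omega]
        exact e2 _ (by omega)
    · simpa using hq
    · simpa [show m - i + 1 + i - 1 = m by omega] using e4
  -- The site `ρ 1` next to the cluster of `u` is opened by some activated site `x`, although every
  -- shortest path from far away in one cluster to far away in the other passes through it.
  have hpE : ρ 1 ∈ E := by
    by_contra hc
    exact hnot 1 le_rfl hm0 (e3.trans (Conn.single (hQ _ e3) hc (e2 0 hm0)))
  obtain ⟨x, -, hx⟩ : ∃ x ∈ α, ρ 1 ∈ enhanceAt φ x ω :=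
    (mem_enhanced_iff.1 hpE).resolve_left (e1 1 hm0)
  obtain ⟨z, hz, hzx⟩ := hLu x
  obtain ⟨z', hz', hzx'⟩ := hLw x
  set S : Set Site := {y | Conn Eᶜ u y} ∪ {y | ∃ i ≤ m, y = ρ i} ∪ {y | Conn Eᶜ w y} with hS
  have hSω : S ⊆ ωᶜ := by
    rintro y ((hy | ⟨i, hi, rfl⟩) | hy)
    · exact hEω y (hQ y hy)
    · exact e1 i hi
    · exact hEω y (hQ' y hy)
  have hρ : ∀ i ≤ m, Conn S (ρ 0) (ρ i) := by
    intro i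
    induction i with
    | zero => exact fun _ => Conn.refl _ _
    | succ i ih =>
      exact fun hi => (ih (by omega)).trans (Conn.single (Or.inl (Or.inr ⟨i, by omega, rfl⟩))
        (Or.inl (Or.inr ⟨i + 1, hi, rfl⟩)) (e2 i (by omega)))
  have hconn : Conn S z z' :=
    ((hz.cluster.symm.trans e3.cluster).mono fun _ hy => Or.inl (Or.inl hy)).trans
      ((hρ m le_rfl).trans ((e4.cluster.symm.trans hz'.cluster).mono fun _ hy => Or.inr hy))
  obtain ⟨n, η, hη, hη0, hηn⟩ := hconn.exists_inducedPath (Or.inl (Or.inl hz))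
  have hη' : IsInducedPath ωᶜ n η := ⟨fun i hi => hSω (hη.mem i hi), hη.adj, hη.not_adj, hη.ne⟩
  obtain ⟨k, hk, hkp⟩ : ∃ k ≤ n, η k = ρ 1 := by
    by_contra! hc
    have hall : ∀ k ≤ n, Conn Eᶜ u (η k) := by
      intro k
      induction k with
      | zero => exact fun _ => hη0 ▸ hz
      | succ k ih =>
        intro hk
        have ihk := ih (by omega)
        have hadj := hη.adj k (by omega)
        rcases hη.mem (k + 1) hk with (hy | ⟨i, hi, hy⟩) | hy
        · exact hy
        · rcases Nat.lt_or_ge i 1 with h1 | h1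
          · rw [hy, show i = 0 by omega]; exact e3
          · rcases h1.eq_or_lt with rfl | h1
            · exact absurd hy (hc _ hk)
            · exact absurd (hy ▸ hadj) (hnadj i h1 hi _ ihk)
        · exact absurd ((ihk.trans (Conn.single (hQ _ ihk) (hQ' _ hy) hadj)).trans hy.symm) hno
    exact hno ((hall n le_rfl).trans (by rw [hηn]; exact hz'.symm))
  refine h.notMem_enhanceAt hη' (x := x) (by rwa [hη0]) (by rwa [hηn]) hk ?_
  rwa [hkp]

/-- A long connected set of closed sites meets the large enhanced closed cluster inside the closed
cluster to which it belongs. -/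
theorem Admissible.exists_conn_of_far (h : Admissible φ R) {Y : Set Site} (hY : Y ⊆ ωᶜ)
    {u v w : Site} (hu : u ∈ Y) (huv : Conn Y u v) (hfar : 6 * R + 6 < rad u v)
    (hw : w ∉ enhanced φ ω α) (hwu : Conn ωᶜ w u)
    (hLw : ∀ x, ∃ z, Conn (enhanced φ ω α)ᶜ w z ∧ R + 1 < rad x z) :
    ∃ y ∈ Y, Conn (enhanced φ ω α)ᶜ w y := by
  have hR := h.nonneg
  obtain ⟨e, e', he, hue, hee, h1, h2⟩ := h.exists_conn_closed (α := α) hY hu huv (by omega)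
  refine ⟨e, he.1, h.conn_closed hw he.2 (hwu.trans (hue.mono hY)) hLw fun x => ?_⟩
  by_contra! hc
  have h3 := hc e (Conn.refl _ _)
  have h4 := hc e' (hee.mono Set.inter_subset_right)
  have h5 := rad_triangle u e v
  have h6 := rad_triangle e e' v
  have h7 := rad_triangle e x e'
  rw [rad_comm e' v] at h6
  rw [rad_comm e x] at h7
  omega

end

section

/-! ### Coupling two sequences along a staircase -/

/-- There is a staircase from `p` to `q` in `ℕ × ℕ`, moving up by one in one coordinate at a time,
all of whose points satisfy `r`. -/
def Stair (r : ℕ → ℕ → Prop) : ℕ × ℕ → ℕ × ℕ → Prop :=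
  Relation.ReflTransGen fun p q => r p.1 p.2 ∧ r q.1 q.2 ∧
    (q = (p.1 + 1, p.2) ∨ q = (p.1, p.2 + 1))

theorem Stair.trans {r : ℕ → ℕ → Prop} {p q q' : ℕ × ℕ} (h : Stair r p q) (h' : Stair r q q') :
    Stair r p q' :=
  Relation.ReflTransGen.trans h h'

theorem stair_horizontal {r : ℕ → ℕ → Prop} {i i' j : ℕ} (hi : i ≤ i')
    (h : ∀ a, i ≤ a → a ≤ i' → r a j) : Stair r (i, j) (i', j) := by
  induction i', hi using Nat.le_induction with
  | base => exact Relation.ReflTransGen.refl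
  | succ n hn ih =>
    exact Relation.ReflTransGen.tail (ih fun a h1 h2 => h a h1 (by omega))
      ⟨h n hn (by omega), h (n + 1) (by omega) le_rfl, Or.inl rfl⟩

theorem stair_vertical {r : ℕ → ℕ → Prop} {i j j' : ℕ} (hj : j ≤ j')
    (h : ∀ b, j ≤ b → b ≤ j' → r i b) : Stair r (i, j) (i, j') := by
  induction j', hj using Nat.le_induction with
  | base => exact Relation.ReflTransGen.refl
  | succ n hn ih =>
    exact Relation.ReflTransGen.tail (ih fun a h1 h2 => h a h1 (by omega))
      ⟨h n hn (by omega), h (n + 1) (by omega) le_rfl, Or.inr rfl⟩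

/-- Two maps have the same first return map to `G`, and between the returns their orbits are close
in the sense of `r`. -/
def CommonReturns {β : Type*} (g g' : β → β) (G : Set β) (r : β → β → Prop) : Prop :=
  ∀ s ∈ G, ∃ n n', 0 < n ∧ 0 < n' ∧ g^[n] s ∈ G ∧ g^[n] s = g'^[n'] s ∧
    (∀ t, 0 < t → t < n → g^[t] s ∉ G) ∧ (∀ t, 0 < t → t < n' → g'^[t] s ∉ G) ∧
    ∀ a ≤ n, ∀ b ≤ n', r (g^[a] s) (g'^[b] s)

variable {β : Type*} {g g' : β → β} {G : Set β} {r : β → β → Prop}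

theorem CommonReturns.swap (h : CommonReturns g g' G r) :
    CommonReturns g' g G (fun x y => r y x) := by
  intro s hs
  obtain ⟨n, n', h1, h2, h3, h4, h5, h6, h7⟩ := h s hs
  exact ⟨n', n, h2, h1, h4 ▸ h3, h4.symm, h6, h5, fun a ha b hb => h7 b hb a ha⟩

theorem ne_of_pos_of_lt_minimalPeriod {s : β} {t : ℕ} (h0 : 0 < t)
    (h : t < Function.minimalPeriod g s) : g^[t] s ≠ s :=
  fun he => Function.not_isPeriodicPt_of_pos_of_lt_minimalPeriod h0.ne' h he

theorem CommonReturns.stair_of_lt (h : CommonReturns g g' G r) {s : β} (hs : s ∈ G) {i j m : ℕ}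
    (hi : i < Function.minimalPeriod g s) (hj : j < Function.minimalPeriod g' s)
    (hij : g^[i] s = g'^[j] s) (hG : g^[i] s ∈ G) (hm : ∀ t, i < t → t ≤ i + m → g^[t] s ∉ G) :
    Stair (fun a b => r (g^[a] s) (g'^[b] s)) (i + m, j)
      (Function.minimalPeriod g s, Function.minimalPeriod g' s) := by
  obtain ⟨k, hk⟩ : ∃ k, k = Function.minimalPeriod g s - i := ⟨_, rfl⟩
  induction k using Nat.strong_induction_on generalizing i j m with
  | _ k ih =>
    obtain ⟨n, n', h1, h2, h3, h4, h5, h6, h7⟩ := h _ hG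
    have e1 : ∀ t, g^[t] (g^[i] s) = g^[i + t] s := fun t => by
      rw [add_comm, Function.iterate_add_apply]
    have e2 : ∀ t, g'^[t] (g^[i] s) = g'^[j + t] s := fun t => by
      rw [hij, add_comm, Function.iterate_add_apply]
    simp only [e1, e2] at h3 h4 h5 h6 h7
    have hmn : m < n := by
      by_contra hc
      exact hm (i + n) (by omega) (by omega) h3
    have hn : i + n ≤ Function.minimalPeriod g s := by
      by_contra hc
      have := h5 (Function.minimalPeriod g s - i) (by omega) (by omega)
      rw [Nat.add_sub_cancel' hi.le, Function.iterate_minimalPeriod] at this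
      exact this hs
    have hn' : j + n' ≤ Function.minimalPeriod g' s := by
      by_contra hc
      have := h6 (Function.minimalPeriod g' s - j) (by omega) (by omega)
      rw [Nat.add_sub_cancel' hj.le, Function.iterate_minimalPeriod] at this
      exact this hs
    have hrect : Stair (fun a b => r (g^[a] s) (g'^[b] s)) (i + m, j) (i + n, j + n') := by
      refine (stair_horizontal (by omega) fun a ha ha' => ?_).trans
        (stair_vertical (by omega) fun b hb hb' => ?_)
      · have := h7 (a - i) (by omega) 0 (by omega)
        rwa [Nat.add_sub_cancel' (by omega : i ≤ a), add_zero] at this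
      · have := h7 n le_rfl (b - j) (by omega)
        rwa [Nat.add_sub_cancel' (by omega : j ≤ b)] at this
    refine hrect.trans ?_
    rcases hn.eq_or_lt with he | hlt
    · have : j + n' = Function.minimalPeriod g' s := by
        by_contra hc
        refine ne_of_pos_of_lt_minimalPeriod (by omega) (lt_of_le_of_ne hn' hc) ?_
        rw [← h4, he, Function.iterate_minimalPeriod]
      rw [he, this]
      exact Relation.ReflTransGen.refl
    · have hlt' : j + n' < Function.minimalPeriod g' s := by
        refine lt_of_le_of_ne hn' fun hc => ?_
        refine ne_of_pos_of_lt_minimalPeriod (by omega) hlt ?_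
        rw [h4, hc, Function.iterate_minimalPeriod]
      exact @ih _ (by omega) (i + n) (j + n') 0 hlt hlt' h4 h3 (fun t ht ht' => by omega) rfl

/-- The coupling of the two periodic orbits through a point of `G`; the first one may start before
its first return to `G`. -/
theorem CommonReturns.stair (h : CommonReturns g g' G r) {s : β} (hs : s ∈ G)
    (hk : 0 < Function.minimalPeriod g s) (hk' : 0 < Function.minimalPeriod g' s) {m : ℕ}
    (hm : ∀ t, 0 < t → t ≤ m → g^[t] s ∉ G) :
    Stair (fun a b => r (g^[a] (g^[m] s)) (g'^[b] s)) (0, 0)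
      (Function.minimalPeriod g s, Function.minimalPeriod g' s) := by
  have h1 := h.stair_of_lt hs hk hk' (i := 0) (j := 0) (m := m) rfl hs
    (fun t h1 h2 => hm t h1 (by omega))
  have h2 : Stair (fun a b => r (g^[a] s) (g'^[b] s))
      (Function.minimalPeriod g s, Function.minimalPeriod g' s)
      (m + Function.minimalPeriod g s, Function.minimalPeriod g' s) := by
    refine stair_horizontal (by omega) fun a ha ha' => ?_
    obtain ⟨n, n', hn, -, h3, -, -, -, h7⟩ := h s hs
    obtain ⟨a, rfl⟩ := Nat.exists_eq_add_of_le' ha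
    have hmn : m < n := by
      by_contra hc
      exact hm n hn (by omega) h3
    simp only [Function.iterate_add_apply, Function.iterate_minimalPeriod]
    exact h7 a (by omega) 0 (by omega)
  have h3 := h1.trans h2
  rw [zero_add] at h3
  have key : ∀ p q : ℕ × ℕ, Stair (fun a b => r (g^[a] s) (g'^[b] s)) p q → m ≤ p.1 →
      m ≤ q.1 ∧
        Stair (fun a b => r (g^[a] (g^[m] s)) (g'^[b] s)) (p.1 - m, p.2) (q.1 - m, q.2) := by
    intro p q hpq hp
    induction hpq with
    | refl => exact ⟨hp, Relation.ReflTransGen.refl⟩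
    | @tail x y _ hxy ih =>
      obtain ⟨h1, h2, h3⟩ := hxy
      have hy : x.1 ≤ y.1 := by rcases h3 with h3 | h3 <;> simp [h3]
      refine ⟨by omega, ih.2.tail ⟨?_, ?_, ?_⟩⟩
      · simp only [← Function.iterate_add_apply]
        rwa [Nat.sub_add_cancel ih.1]
      · simp only [← Function.iterate_add_apply]
        rwa [Nat.sub_add_cancel (by omega)]
      · have := ih.1
        rcases h3 with h3 | h3
        · left; rw [h3]; simp only [Prod.mk.injEq, and_true]; omega
        · right; rw [h3]
  have h4 := (key _ _ h3 le_rfl).2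
  simpa using h4

end

section

/-! ### Gaps between consecutive gates -/

variable {φ : Config → Config} {R : ℤ} {ω α : Config} {A B : Set Site} {s : DualSite}

/-- `A` is a large open cluster of `ω` and `B` is a large closed cluster of the enhancement of
`ω`. -/
structure Matched (φ : Config → Config) (R : ℤ) (ω α : Config) (A B : Set Site) : Prop where
  left : Separated ω A B
  right : Separated (enhanced φ ω α) A B
  closed_left : ∀ x ∈ A, ∀ y, Conn ω x y → y ∈ A
  closed_right : ∀ x ∈ B, ∀ y, Conn (enhanced φ ω α)ᶜ x y → y ∈ B
  large_left : ∀ c, ∃ a ∈ A, 8 * R + 11 ≤ rad c a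
  large_right : ∀ c, ∃ b ∈ B, R + 1 < rad c b

/-- An orbit of `nxt ω` does not go far away from a gate before it reaches the next gate: the closed
sites along a long stretch would meet `B`. -/
theorem Matched.rad_left_le (hM : Matched φ R ω α A B) (h : Admissible φ R) (hs : s ∈ gates A B)
    {n : ℕ} (hn : ∀ t < n, (nxt ω)^[t] (nxt ω s) ∉ gates A B) {t : ℕ} (ht : t < n) :
    rad s.1 ((nxt ω)^[t] (nxt ω s)).1 ≤ 6 * R + 9 := by
  by_contra! hc
  have hm := hM.left.mixed hs
  have hB := hM.left.cls_mem hs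
  set Y : Set Site := {y | ∃ t < n, y = cls ω ((nxt ω)^[t] (nxt ω s))} with hY
  have hYω : Y ⊆ ωᶜ := by
    rintro y ⟨t, -, rfl⟩
    exact (hm.nxt.iterate t).cls_notMem
  have hconn : Conn Y (cls ω (nxt ω s)) (cls ω ((nxt ω)^[t] (nxt ω s))) :=
    hm.nxt.conn_cls (S := Y) (Nat.zero_le t) fun t' _ h2 => ⟨t', by omega, rfl⟩
  have h1 := rad_nxt ω s
  have h2 := rad_cls ω (nxt ω s)
  have h3 := rad_cls ω ((nxt ω)^[t] (nxt ω s))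
  have h4 := rad_triangle s.1 (nxt ω s).1 ((nxt ω)^[t] (nxt ω s)).1
  have h5 := rad_triangle (nxt ω s).1 (cls ω (nxt ω s)) ((nxt ω)^[t] (nxt ω s)).1
  have h6 := rad_triangle (cls ω (nxt ω s)) (cls ω ((nxt ω)^[t] (nxt ω s)))
    ((nxt ω)^[t] (nxt ω s)).1
  rw [rad_comm (cls ω ((nxt ω)^[t] (nxt ω s))) ((nxt ω)^[t] (nxt ω s)).1] at h6
  obtain ⟨y, ⟨t', ht', rfl⟩, hy⟩ := h.exists_conn_of_far (α := α) (u := cls ω (nxt ω s))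
    (w := cls ω s) hYω
    ⟨0, by omega, rfl⟩ hconn (by omega)
    (hM.right.notMem _ hB) (Conn.single_or_eq hm.cls_notMem hm.nxt.cls_notMem hm.cls_step)
    (fun x => by
      obtain ⟨b, hb, hb'⟩ := hM.large_right x
      exact ⟨b, (hM.right.conn_right _ hB _ hb).mono hM.right.notMem, hb'⟩)
  refine hn t' ht' (mem_gates (hM.closed_right _ hB _ hy)
    (hM.closed_left _ (hM.left.opn_mem hs) _ ?_))
  have := hm.conn_opn (S := ω) (Nat.zero_le (t' + 1)) fun t _ _ => (hm.iterate t).opn_mem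
  rwa [Function.iterate_succ_apply] at this

/-- Neither does an orbit for the enhanced configuration: the open sites along a long stretch form,
together with `A`, a connection which is created by the enhancement within a box. -/
theorem Matched.rad_right_le (hM : Matched φ R ω α A B) (h : Admissible φ R) (hs : s ∈ gates A B)
    {n n' : ℕ} (hn : ∀ t < n, (nxt ω)^[t] (nxt ω s) ∉ gates A B)
    (hn' : ∀ t < n', (nxt (enhanced φ ω α))^[t] (nxt (enhanced φ ω α) s) ∉ gates A B)
    (heq : (nxt ω)^[n] (nxt ω s) = (nxt (enhanced φ ω α))^[n'] (nxt (enhanced φ ω α) s))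
    (hper : n' ≤ Function.minimalPeriod (nxt (enhanced φ ω α)) (nxt (enhanced φ ω α) s))
    {t : ℕ} (ht : t < n') :
    rad s.1 ((nxt (enhanced φ ω α))^[t] (nxt (enhanced φ ω α) s)).1 ≤ 8 * R + 12 := by
  have hR := h.nonneg
  have hfar := fun t ht => hM.rad_left_le h hs hn (t := t) ht
  obtain ⟨f, hf, hfA, hfB⟩ := hM.left.exists_potential hM.right hs heq
  have hm := hM.right.mixed hs
  have hmω := hM.left.mixed hs
  have hωE : ω ⊆ enhanced φ ω α := subset_enhanced
  have hsA := hM.right.opn_mem hs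
  have hsB := hM.right.cls_mem hs
  set E := enhanced φ ω α with hE
  have hfAB : f (cls E s) = f (opn E s) := by
    refine zmod_eq_of_add_eq_zero ?_
    rw [← hf _ _ (cls_adj_opn E s),
      orbitCrossings_eq_zero_of_notMem_gates hM.left hn hsB hsA hmω.nxt,
      orbitCrossings_eq_zero_of_notMem_gates hM.right hn' hsB hsA hm.nxt, add_zero]
  set X : Set Site := {y | ∃ t < n', y = opn E ((nxt E)^[t] (nxt E s))} with hX
  have hXE : X ⊆ E := by
    rintro y ⟨t, -, rfl⟩
    exact (hm.nxt.iterate t).opn_mem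
  have hclsB : ∀ t, cls E ((nxt E)^[t] (nxt E s)) ∈ B := by
    intro t
    refine hM.closed_right _ hsB _ ?_
    have := hm.conn_cls (S := Eᶜ) (Nat.zero_le (t + 1)) fun t _ _ => (hm.iterate t).cls_notMem
    rwa [Function.iterate_succ_apply] at this
  -- The colouring separates `X` from `A`.
  have hfX : ∀ x ∈ X, ∀ a ∈ A, f a ≠ f x := by
    rintro x ⟨t, ht, rfl⟩ a ha
    rw [hfA a ha _ hsA, ← hfAB, hfB _ hsB _ (hclsB t)]
    refine zmod_ne_of_add_eq_one ?_
    rw [← hf _ _ (cls_adj_opn _ _), orbitCrossings_eq_one hm.nxt hper ht, orbitCrossings_eq_zero,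
      zero_add]
    · rintro t' ht' ⟨e1, e2⟩
      refine hn t' ht' (mem_gates (e1 ▸ hclsB t) (hM.closed_left _ (hM.left.opn_mem hs) _ ?_))
      have := hmω.conn_opn (S := ω) (Nat.zero_le (t' + 1)) fun t _ _ => (hmω.iterate t).opn_mem
      rwa [Function.iterate_succ_apply] at this
    · rintro t' - ⟨e1, e2⟩
      exact hM.right.notMem _ (hclsB t) (hωE (e2 ▸ (hmω.nxt.iterate t').opn_mem))
  -- Hence `A` and `X` touch only along the interface of `ω`, which stays close to `s`.
  have hadjX : ∀ a ∈ A, ∀ x ∈ X, triLattice.Adj a x → rad s.1 x ≤ 6 * R + 10 := by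
    intro a ha x hx hax
    have h1 := hf a x hax
    rw [orbitCrossings_eq_zero_left (A := E) (ω := E) subset_rfl hm.nxt (hωE (hM.left.subset ha))
      (hXE hx), add_zero] at h1
    have h2 : orbitCrossings ω (nxt ω s) n a x ≠ 0 := fun h0 =>
      hfX x hx a ha (zmod_eq_of_add_eq_zero (h0 ▸ h1))
    obtain ⟨t, ht, ht'⟩ := exists_of_orbitCrossings_ne_zero h2
    have h3 := hfar t ht
    have h4 := rad_cls ω ((nxt ω)^[t] (nxt ω s))
    have h5 := rad_opn ω ((nxt ω)^[t] (nxt ω s))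
    have h6 := rad_triangle s.1 ((nxt ω)^[t] (nxt ω s)).1 x
    rcases ht' with ⟨-, e⟩ | ⟨e, -⟩ <;> subst e <;> omega
  by_contra! hc
  have hL := rad_opn E ((nxt E)^[t] (nxt E s))
  have hL' := rad_triangle s.1 (opn E ((nxt E)^[t] (nxt E s))) ((nxt E)^[t] (nxt E s)).1
  rw [rad_comm (opn E ((nxt E)^[t] (nxt E s))) ((nxt E)^[t] (nxt E s)).1] at hL'
  have hXc : Conn X (opn E (nxt E s)) (opn E ((nxt E)^[t] (nxt E s))) :=
    hm.nxt.conn_opn (S := X) (Nat.zero_le t) fun t' _ h2 => ⟨t', by omega, rfl⟩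
  have hx0 : opn E (nxt E s) ∈ X := ⟨0, by omega, rfl⟩
  have hx0r : rad s.1 (opn E (nxt E s)) ≤ 2 := by
    have h1 := rad_nxt E s
    have h2 := rad_opn E (nxt E s)
    have h3 := rad_triangle s.1 (nxt E s).1 (opn E (nxt E s))
    omega
  obtain ⟨b, hbX, hb, hxb⟩ := hXc.exists_first (h := rad s.1) (fun _ _ => rad_le_of_adj _) hx0
    (t := 8 * R + 11) (by omega) (by omega)
  obtain ⟨a', ha', hfar'⟩ := hM.large_left s.1
  have hsr := rad_opn E s
  obtain ⟨a, haA, ha, hsa⟩ := (hM.left.conn_left _ hsA _ ha').exists_first (h := rad s.1)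
    (fun _ _ => rad_le_of_adj _) hsA (t := 8 * R + 11) (by omega) (by omega)
  -- In the box, the sites of `X` near the boundary are added to `ω`, which makes up for the
  -- enhancement from outside. Then `A` and `X` are connected in the box after the enhancement,
  -- hence before it, in contradiction to the bound on the places where they touch.
  set F : Set Site := {x | rad s.1 x ≤ 8 * R + 11 ∧ (x ∈ ω ∨ x ∈ X ∧ 6 * R + 10 < rad s.1 x)}
    with hF
  have hAF : A ∩ {x | rad s.1 x ≤ 8 * R + 11} ⊆ {x | rad s.1 x ≤ 8 * R + 11} ∩ enhanced φ F α :=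
    fun x hx => ⟨hx.2, subset_enhanced ⟨hx.2, Or.inl (hM.left.subset hx.1)⟩⟩
  have hXF : X ∩ {x | rad s.1 x ≤ 8 * R + 11} ⊆ {x | rad s.1 x ≤ 8 * R + 11} ∩ enhanced φ F α := by
    rintro x ⟨hx, hx'⟩
    refine ⟨hx', ?_⟩
    by_cases hcol : 6 * R + 10 < rad s.1 x
    · exact subset_enhanced ⟨hx', Or.inr ⟨hx, hcol⟩⟩
    · rcases mem_enhanced_iff.1 (hXE hx) with hxω | ⟨y, hy, hyx⟩
      · exact subset_enhanced ⟨hx', Or.inl hxω⟩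
      · refine mem_enhanced_iff.2 (Or.inr ⟨y, hy, h.enhanceAt_subset (fun z hz hzω => ?_) hyx⟩)
        have h1 := h.rad_le hyx
        have h2 := rad_triangle s.1 x z
        have h3 := rad_triangle x y z
        rw [rad_comm x y] at h3
        exact ⟨by omega, Or.inl hzω⟩
  have hab : Conn F a b := by
    refine h.conn_of_conn (α := α) (c := s.1) (n := 8 * R + 11) (fun x hx => hx.1)
      ⟨ha.le, Or.inl (hM.left.subset haA)⟩ ⟨hb.le, Or.inr ⟨hbX, by omega⟩⟩ ha hb ?_
    refine (hsa.symm.mono hAF).trans ((Conn.single_or_eq (hAF ⟨hsA, ?_⟩) (hXF ⟨hx0, ?_⟩)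
      hm.opn_step).trans (hxb.mono hXF))
    · rw [Set.mem_ofPred_eq]; omega
    · rw [Set.mem_ofPred_eq]; omega
  refine hfX b hbX b (hab.invariant (P := fun x => x ∈ A) (fun x y _ hy hxy hx => ?_) haA) rfl
  rcases hy.2 with hy | ⟨hy, hy'⟩
  · exact hM.closed_left x hx y (Conn.single (hM.left.subset hx) hy hxy)
  · have := hadjX x hx y hy hxy
    omega

theorem Separated.exists_first_return (h : Separated ω A B) (hs : s ∈ gates A B) :
    ∃ n < Function.minimalPeriod (nxt ω) s, (nxt ω)^[n] (nxt ω s) ∈ gates A B ∧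
      ∀ t < n, (nxt ω)^[t] (nxt ω s) ∉ gates A B := by
  classical
  have hpos := minimalPeriod_pos h.finite s
  have hlast : (nxt ω)^[Function.minimalPeriod (nxt ω) s - 1] (nxt ω s) ∈ gates A B := by
    rw [← Function.iterate_succ_apply, Nat.succ_eq_add_one, Nat.sub_add_cancel hpos,
      Function.iterate_minimalPeriod]
    exact hs
  have hex : ∃ n, (nxt ω)^[n] (nxt ω s) ∈ gates A B := ⟨_, hlast⟩
  refine ⟨Nat.find hex, ?_, Nat.find_spec hex, fun t ht => Nat.find_min hex ht⟩
  have := Nat.find_min' hex hlast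
  omega

theorem Matched.commonReturns (hM : Matched φ R ω α A B) (h : Admissible φ R) :
    CommonReturns (nxt ω) (nxt (enhanced φ ω α)) (gates A B)
      fun ξ ζ => rad ξ.1 ζ.1 ≤ 16 * R + 26 := by
  intro s hs
  have hR := h.nonneg
  obtain ⟨n, hnk, hnG, hn⟩ := hM.left.exists_first_return hs
  obtain ⟨n', hnk', hnG', hn'⟩ := hM.right.exists_first_return hs
  have heq := hM.left.first_return_eq hM.right hs hnG hn hnG' hn'
  have h1 : ∀ t ≤ n, rad s.1 ((nxt ω)^[t] (nxt ω s)).1 ≤ 8 * R + 13 := by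
    intro t ht
    rcases ht.lt_or_eq with ht | rfl
    · have := hM.rad_left_le h hs hn ht
      omega
    · rcases t with _ | t
      · have := rad_nxt ω s
        simp only [Function.iterate_zero_apply]
        omega
      · have h1 := hM.rad_left_le h hs hn (t := t) (by omega)
        have h2 := rad_nxt ω ((nxt ω)^[t] (nxt ω s))
        have h3 := rad_triangle s.1 ((nxt ω)^[t] (nxt ω s)).1 ((nxt ω)^[t + 1] (nxt ω s)).1
        rw [Function.iterate_succ_apply'] at h3 ⊢
        omega
  have h2 : ∀ t ≤ n', rad s.1 ((nxt (enhanced φ ω α))^[t] (nxt (enhanced φ ω α) s)).1 ≤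
      8 * R + 13 := by
    intro t ht
    rcases ht.lt_or_eq with ht | rfl
    · have := hM.rad_right_le h hs hn hn' heq (by
        rw [Function.minimalPeriod_apply (Function.minimalPeriod_pos_iff_mem_periodicPts.1
          (minimalPeriod_pos hM.right.finite s))]
        exact hnk'.le) ht
      omega
    · rw [← heq]
      exact h1 n le_rfl
  have e1 : ∀ t ≤ n + 1, rad s.1 ((nxt ω)^[t] s).1 ≤ 8 * R + 13 := by
    rintro (_ | t) ht
    · rw [Function.iterate_zero_apply, rad_self]; omega
    · exact h1 t (by omega)
  have e2 : ∀ t ≤ n' + 1, rad s.1 ((nxt (enhanced φ ω α))^[t] s).1 ≤ 8 * R + 13 := by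
    rintro (_ | t) ht
    · rw [Function.iterate_zero_apply, rad_self]; omega
    · exact h2 t (by omega)
  refine ⟨n + 1, n' + 1, n.succ_pos, n'.succ_pos, hnG, heq, ?_, ?_, ?_⟩
  · rintro (_ | t) h0 ht
    · omega
    · exact hn t (by omega)
  · rintro (_ | t) h0 ht
    · omega
    · exact hn' t (by omega)
  · intro a ha b hb
    have h3 := rad_triangle ((nxt ω)^[a] s).1 s.1 ((nxt (enhanced φ ω α))^[b] s).1
    rw [rad_comm _ s.1] at h3
    have := e1 a ha
    have := e2 b hb
    omega

end

section

/-! ### Coupling the loops of a finite configuration and of its enhancement -/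

theorem CommonReturns.exists_stair {β : Type*} {g g' : β → β} {G : Set β} {r : β → β → Prop}
    (h : CommonReturns g g' G r) (hpos : ∀ s ∈ G, 0 < Function.minimalPeriod g s)
    (hpos' : ∀ s ∈ G, 0 < Function.minimalPeriod g' s) {x : β} (hx : x ∈ G) (M : ℕ) :
    ∃ s ∈ G, Stair (fun a b => r (g^[a] (g^[M] x)) (g'^[b] s)) (0, 0)
      (Function.minimalPeriod g (g^[M] x), Function.minimalPeriod g' s) := by
  classical
  -- The starting point belongs to the last visit of the first orbit to `G` before time `M`.
  set t := Nat.findGreatest (fun t => g^[t] x ∈ G) M with ht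
  have htM : t ≤ M := Nat.findGreatest_le M
  have hs : g^[t] x ∈ G := Nat.findGreatest_spec (P := fun t => g^[t] x ∈ G) (Nat.zero_le M) hx
  have e : g^[M] x = g^[M - t] (g^[t] x) := by
    rw [← Function.iterate_add_apply, Nat.sub_add_cancel htM]
  refine ⟨_, hs, ?_⟩
  have := h.stair hs (hpos _ hs) (hpos' _ hs) (m := M - t) (fun u hu hu' => by
    rw [← Function.iterate_add_apply]
    exact Nat.findGreatest_is_greatest (P := fun t => g^[t] x ∈ G) (n := M) (by omega) (by omega))
  rwa [e, Function.minimalPeriod_apply_iterate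
    (Function.minimalPeriod_pos_iff_mem_periodicPts.1 (hpos _ hs))]

variable {φ : Config → Config} {R : ℤ} {ω α : Config} {ξ ζ : DualSite}

theorem Admissible.finite_enhanced (h : Admissible φ R) (hω : ω.Finite) (hα : α.Finite) :
    (enhanced φ ω α).Finite := by
  refine (hω.union (hα.biUnion fun x _ => finite_rad_le x R)).subset fun z hz => ?_
  rcases mem_enhanced_iff.1 hz with hz | ⟨x, hx, hz⟩
  · exact Or.inl hz
  · exact Or.inr (Set.mem_biUnion hx (h.rad_le hz))

theorem exists_le_rad {S : Set Site} {a b : Site} (hab : Conn S a b) {n : ℤ} (hn : 2 * n ≤ rad a b)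
    (c : Site) : ∃ z, Conn S a z ∧ n ≤ rad c z := by
  have := rad_triangle a c b
  rw [rad_comm a c] at this
  by_cases h : n ≤ rad c a
  · exact ⟨a, Conn.refl _ _, h⟩
  · exact ⟨b, hab, by omega⟩

theorem rad_le_rad_opn (ω : Config) (ξ ζ : DualSite) :
    rad ξ.1 ζ.1 ≤ rad (opn ω ξ) (opn ω ζ) + 2 := by
  have h1 := rad_opn ω ξ
  have h2 := rad_opn ω ζ
  have h3 := rad_triangle ξ.1 (opn ω ξ) ζ.1
  have h4 := rad_triangle (opn ω ξ) (opn ω ζ) ζ.1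
  rw [rad_comm (opn ω ζ) ζ.1] at h4
  omega

theorem rad_le_rad_cls (ω : Config) (ξ ζ : DualSite) :
    rad ξ.1 ζ.1 ≤ rad (cls ω ξ) (cls ω ζ) + 2 := by
  have h1 := rad_cls ω ξ
  have h2 := rad_cls ω ζ
  have h3 := rad_triangle ξ.1 (cls ω ξ) ζ.1
  have h4 := rad_triangle (cls ω ξ) (cls ω ζ) ζ.1
  rw [rad_comm (cls ω ζ) ζ.1] at h4
  omega

theorem exists_iterate_eq_of_iterate_eq {β : Type*} {g : β → β} {x y : β}
    (hx : 0 < Function.minimalPeriod g x) {m : ℕ} (h : g^[m] x = y) : ∃ M, g^[M] y = x := by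
  refine ⟨Function.minimalPeriod g x * m - m, ?_⟩
  rw [← h, ← Function.iterate_add_apply, Nat.sub_add_cancel (Nat.le_mul_of_pos_left m hx),
    Function.iterate_mul]
  exact Function.iterate_fixed Function.iterate_minimalPeriod m

theorem Matched.of_conn (h : Admissible φ R) (hω : ω.Finite) (hα : α.Finite) {a a' b b' : Site}
    (ha : a ∈ ω) (haa : Conn ω a a') (hb : b ∉ enhanced φ ω α)
    (hbb : Conn (enhanced φ ω α)ᶜ b b') (hra : 16 * R + 22 ≤ rad a a')
    (hrb : 2 * R + 4 ≤ rad b b') :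
    Matched φ R ω α {x | Conn ω a x} {x | Conn (enhanced φ ω α)ᶜ b x} := by
  have hA : ∀ x ∈ {x | Conn ω a x}, ∀ y ∈ {x | Conn ω a x}, Conn {x | Conn ω a x} x y :=
    fun x hx y hy => (Conn.cluster hx).symm.trans (Conn.cluster hy)
  have hB : ∀ x ∈ {x | Conn (enhanced φ ω α)ᶜ b x}, ∀ y ∈ {x | Conn (enhanced φ ω α)ᶜ b x},
      Conn {x | Conn (enhanced φ ω α)ᶜ b x} x y :=
    fun x hx y hy => (Conn.cluster hx).symm.trans (Conn.cluster hy)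
  have hAω : {x | Conn ω a x} ⊆ ω := fun x hx => Conn.mem hx ha
  have hBE : ∀ x ∈ {x | Conn (enhanced φ ω α)ᶜ b x}, x ∉ enhanced φ ω α :=
    fun x hx => Conn.mem hx hb
  exact ⟨⟨hω, hAω, fun x hx hc => hBE x hx (subset_enhanced hc), hA, hB⟩,
    ⟨h.finite_enhanced hω hα, fun x hx => subset_enhanced (hAω hx), hBE, hA, hB⟩,
    fun x hx y hy => Conn.trans hx hy, fun x hx y hy => Conn.trans hx hy,
    fun c => exists_le_rad haa (by omega) c,
    fun c => (exists_le_rad hbb (n := R + 2) (by omega) c).imp fun z hz =>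
      ⟨hz.1, by have := hz.2; omega⟩⟩

/-- Each large loop of `ω` follows a loop of the enhancement: part of its right side stays closed,
which provides a gate. -/
theorem Admissible.exists_stair_of_finite (h : Admissible φ R) (hω : ω.Finite) (hα : α.Finite)
    (hζ : Mixed ω ζ) {t : ℕ} (ht : 20 * R + 30 < rad ζ.1 ((nxt ω)^[t] ζ).1) :
    ∃ s, Mixed (enhanced φ ω α) s ∧
      Stair (fun a b => rad ((nxt ω)^[a] ζ).1 ((nxt (enhanced φ ω α))^[b] s).1 ≤ 16 * R + 26) (0, 0)
        (Function.minimalPeriod (nxt ω) ζ, Function.minimalPeriod (nxt (enhanced φ ω α)) s) := by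
  have hR := h.nonneg
  set Y : Set Site := {y | ∃ t, y = cls ω ((nxt ω)^[t] ζ)} with hY
  have hYω : Y ⊆ ωᶜ := by
    rintro y ⟨t, rfl⟩
    exact (hζ.iterate t).cls_notMem
  have hconn : Conn Y (cls ω ζ) (cls ω ((nxt ω)^[t] ζ)) :=
    hζ.conn_cls (S := Y) (Nat.zero_le t) fun t _ _ => ⟨t, rfl⟩
  have hcls := rad_le_rad_cls ω ζ ((nxt ω)^[t] ζ)
  have hopn := rad_le_rad_opn ω ζ ((nxt ω)^[t] ζ)
  obtain ⟨e, e', ⟨⟨m, he⟩, heE⟩, -, hee, h1, h2⟩ := h.exists_conn_closed (α := α)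
    (u := cls ω ζ) hYω ⟨0, rfl⟩ hconn
    (by omega)
  have htri := rad_triangle (cls ω ζ) e (cls ω ((nxt ω)^[t] ζ))
  have htri' := rad_triangle e e' (cls ω ((nxt ω)^[t] ζ))
  rw [rad_comm e' (cls ω ((nxt ω)^[t] ζ))] at htri'
  have hM := Matched.of_conn h hω hα hζ.opn_mem
    (hζ.conn_opn (Nat.zero_le t) fun t _ _ => (hζ.iterate t).opn_mem) heE
    (hee.mono Set.inter_subset_right) (by omega) (by omega)
  have hgate : (nxt ω)^[m] ζ ∈ gates {x | Conn ω (opn ω ζ) x}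
      {x | Conn (enhanced φ ω α)ᶜ e x} :=
    mem_gates (ω := ω) (by rw [← he]; exact Conn.refl _ _)
      (hζ.conn_opn (Nat.zero_le m) fun t _ _ => (hζ.iterate t).opn_mem)
  obtain ⟨M, hMζ⟩ := exists_iterate_eq_of_iterate_eq (minimalPeriod_pos hω ζ) (m := m) rfl
  obtain ⟨s, hs, hst⟩ := (hM.commonReturns h).exists_stair (fun s _ => minimalPeriod_pos hω s)
    (fun s _ => minimalPeriod_pos hM.right.finite s) hgate M
  rw [hMζ] at hst
  exact ⟨s, hM.right.mixed hs, hst⟩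

/-- A rectangle which is cut out by `lo ≤ co ≤ hi` within a box of radius `M`. -/
theorem exists_slab {co : Site → ℤ} (hco : co = Prod.fst ∨ co = Prod.snd) (lo hi M : ℤ) :
    ∃ l h : Site, (∀ x ∈ Set.Icc l h, lo ≤ co x ∧ co x ≤ hi) ∧
      (∀ x, lo ≤ co x → co x ≤ hi → rad 0 x ≤ M → x ∈ Set.Icc l h) ∧
      ∀ x, co x = lo ∨ co x = hi → x.1 = l.1 ∨ x.1 = h.1 ∨ x.2 = l.2 ∨ x.2 = h.2 := by
  rcases hco with rfl | rfl
  · refine ⟨(lo, -M), (hi, M), fun x hx => ⟨hx.1.1, hx.2.1⟩, fun x h1 h2 h3 => ?_, fun x hx => ?_⟩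
    · rw [rad_le_iff] at h3
      simp only [Prod.fst_zero, Prod.snd_zero] at h3
      exact ⟨⟨h1, by simp only; omega⟩, ⟨h2, by simp only; omega⟩⟩
    · simp only; omega
  · refine ⟨(-M, lo), (M, hi), fun x hx => ⟨hx.1.2, hx.2.2⟩, fun x h1 h2 h3 => ?_, fun x hx => ?_⟩
    · rw [rad_le_iff] at h3
      simp only [Prod.fst_zero, Prod.snd_zero] at h3
      exact ⟨⟨by simp only; omega, h1⟩, ⟨by simp only; omega, h2⟩⟩
    · simp only; omega

theorem abs_coord_sub_le_rad {co : Site → ℤ} (hco : co = Prod.fst ∨ co = Prod.snd) (x y : Site) :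
    |co y - co x| ≤ rad x y := by
  rcases hco with rfl | rfl
  · exact le_max_left _ _
  · exact le_max_right _ _

/-- A long connected set of open sites of the enhancement meets, or is adjacent to, a large open
cluster of `ω`. -/
theorem Admissible.exists_cluster_near (h : Admissible φ R) {X : Set Site} (hXf : X.Finite)
    (hX : X ⊆ enhanced φ ω α) {co : Site → ℤ} (hco : co = Prod.fst ∨ co = Prod.snd) {a b : Site}
    (ha : a ∈ X) (hab : Conn X a b) (hfar : 4 * R + 2 ≤ co b - co a) :
    ∃ p q o χ, p ∈ ω ∧ Conn ω p q ∧ co b - co a - 4 * R - 2 ≤ rad p q ∧ Conn ω p o ∧ χ ∈ X ∧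
      (o = χ ∨ triLattice.Adj o χ) := by
  have hR := h.nonneg
  have hlip : ∀ x y, triLattice.Adj x y → co y ≤ co x + 1 := fun x y hxy => by
    have h1 := abs_coord_sub_le_rad hco x y
    have h2 := rad_adj hxy
    have h3 := le_abs_self (co y - co x)
    omega
  have hlip' : ∀ x y, triLattice.Adj x y → -co y ≤ -co x + 1 := fun x y hxy => by
    have := hlip y x hxy.symm
    omega
  obtain ⟨M, hM⟩ : ∃ M, ∀ x ∈ X, rad 0 x ≤ M := by
    obtain ⟨M, hM⟩ := (hXf.image (rad 0)).bddAbove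
    exact ⟨M, fun x hx => hM (Set.mem_image_of_mem _ hx)⟩
  obtain ⟨l, u, hl, hlu, hbd⟩ := exists_slab hco (co a) (co b) (M + 2 * R)
  obtain ⟨b', hb', hb'e, hab'⟩ := hab.exists_first hlip ha (t := co b) (by omega) le_rfl
  obtain ⟨a', ha', ha'e, hba'⟩ := hab'.symm.exists_first hlip' ⟨hb', hb'e.le⟩ (t := -co a)
    (by omega) le_rfl
  have ha'e : co a' = co a := by omega
  -- The sites of `X` in two strips along the boundary of the rectangle are added to `ω`, so that
  -- `X` crosses the rectangle in the enhancement of `F`, hence `F` itself is crossed.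
  set F : Set Site := {x | x ∈ Set.Icc l u ∧
    (x ∈ ω ∨ x ∈ X ∧ (co x ≤ co a + 2 * R ∨ co b - 2 * R ≤ co x))} with hF
  have hXI : ∀ x ∈ X, co a ≤ co x → co x ≤ co b → x ∈ Set.Icc l u := fun x hx h1 h2 =>
    hlu x h1 h2 ((hM x hx).trans (by omega))
  have hXF : X ∩ {x | co x ≤ co b} ∩ {x | -co x ≤ -co a} ⊆ Set.Icc l u ∩ enhanced φ F α := by
    rintro x ⟨⟨hx, h1⟩, h2⟩
    simp only [Set.mem_ofPred_eq] at h1 h2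
    have hxI := hXI x hx (by omega) h1
    refine ⟨hxI, ?_⟩
    by_cases hnear : co x ≤ co a + 2 * R ∨ co b - 2 * R ≤ co x
    · exact subset_enhanced ⟨hxI, Or.inr ⟨hx, hnear⟩⟩
    · rcases mem_enhanced_iff.1 (hX hx) with hxω | ⟨y, hy, hyx⟩
      · exact subset_enhanced ⟨hxI, Or.inl hxω⟩
      · refine mem_enhanced_iff.2 (Or.inr ⟨y, hy, h.enhanceAt_subset (fun z hz hzω => ?_) hyx⟩)
        have h3 := h.rad_le hyx
        have h4 := rad_triangle x y z
        rw [rad_comm x y] at h4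
        have h5 := abs_le.1 (abs_coord_sub_le_rad hco x z)
        have h6 := rad_triangle 0 x z
        have h7 := hM x hx
        exact ⟨hlu z (by omega) (by omega) (by omega), Or.inl hzω⟩
  have haF : a' ∈ F := ⟨hXI a' ha'.1 (by omega) ha'.2, Or.inr ⟨ha'.1, Or.inl (by omega)⟩⟩
  have hbF : b' ∈ F := ⟨hXI b' hb' (by omega) (by omega), Or.inr ⟨hb', Or.inr (by omega)⟩⟩
  have hconn : Conn F a' b' := conn_of_conn_enhanced h.mono h.ness (fun x hx => hx.1) haF hbF
    (hbd _ (Or.inl ha'e)) (hbd _ (Or.inr hb'e)) (hba'.symm.mono hXF)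
  obtain ⟨q, hq, hqe, haq⟩ := hconn.exists_first hlip haF (t := co b - 2 * R - 1) (by omega)
    (by omega)
  obtain ⟨p, hp, hpe, hqp⟩ := haq.symm.exists_first hlip' ⟨hq, hqe.le⟩ (t := -(co a + 2 * R + 1))
    (by omega) (by omega)
  -- Between the two strips the crossing consists of open sites of `ω`.
  have hmid : F ∩ {x | co x ≤ co b - 2 * R - 1} ∩ {x | -co x ≤ -(co a + 2 * R + 1)} ⊆ ω := by
    rintro x ⟨⟨⟨-, hx⟩, h1⟩, h2⟩
    simp only [Set.mem_ofPred_eq] at h1 h2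
    exact hx.resolve_right fun hc => by omega
  have hpω : p ∈ ω := hmid ⟨hp, by rw [Set.mem_ofPred_eq]; omega⟩
  have hpa : Conn F p a' := (hqp.symm.mono fun x hx => hx.1.1).trans
    (haq.symm.mono fun x hx => hx.1)
  have key : ∀ y, Conn F p y → (y ∈ ω ∧ Conn ω p y) ∨ ∃ o χ, Conn ω p o ∧ χ ∈ X ∧
      (o = χ ∨ triLattice.Adj o χ) := by
    intro y hy
    refine hy.invariant (P := fun y => (y ∈ ω ∧ Conn ω p y) ∨ ∃ o χ, Conn ω p o ∧ χ ∈ X ∧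
      (o = χ ∨ triLattice.Adj o χ)) ?_ (Or.inl ⟨hpω, Conn.refl _ _⟩)
    rintro y z - hz hyz (⟨hyω, hpy⟩ | hc)
    · rcases hz.2 with hz | hz
      · exact Or.inl ⟨hz, hpy.trans (Conn.single hyω hz hyz)⟩
      · exact Or.inr ⟨y, z, hpy, hz.1, Or.inr hyz⟩
    · exact Or.inr hc
  have hrad := (le_abs_self _).trans (abs_coord_sub_le_rad hco p q)
  rcases key a' hpa with ⟨-, hk⟩ | ⟨o, χ, h1, h2, h3⟩
  · exact ⟨p, q, a', a', hpω, hqp.symm.mono hmid, by omega, hk, ha'.1, Or.inl rfl⟩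
  · exact ⟨p, q, o, χ, hpω, hqp.symm.mono hmid, by omega, h1, h2, h3⟩

theorem exists_coord_rad_eq (a b : Site) : ∃ co : Site → ℤ, (co = Prod.fst ∨ co = Prod.snd) ∧
    (rad a b = co b - co a ∨ rad a b = co a - co b) := by
  unfold rad
  rcases max_choice |b.1 - a.1| |b.2 - a.2| with h | h <;> rw [h]
  · refine ⟨Prod.fst, Or.inl rfl, ?_⟩
    rcases abs_choice (b.1 - a.1) with h | h <;> omega
  · refine ⟨Prod.snd, Or.inr rfl, ?_⟩
    rcases abs_choice (b.2 - a.2) with h | h <;> omega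

/-- Each large loop of the enhancement follows a loop of `ω`: a large open cluster of `ω` lies at its
left side, and the interface of `ω` along this cluster provides a gate. -/
theorem Admissible.exists_stair_enhanced_of_finite (h : Admissible φ R) (hω : ω.Finite)
    (hα : α.Finite) (hζ : Mixed (enhanced φ ω α) ζ) {t : ℕ}
    (ht : 20 * R + 30 < rad ζ.1 ((nxt (enhanced φ ω α))^[t] ζ).1) :
    ∃ s, Mixed ω s ∧
      Stair (fun a b => rad ((nxt (enhanced φ ω α))^[a] ζ).1 ((nxt ω)^[b] s).1 ≤ 16 * R + 26) (0, 0)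
        (Function.minimalPeriod (nxt (enhanced φ ω α)) ζ, Function.minimalPeriod (nxt ω) s) := by
  have hR := h.nonneg
  have hEfin := h.finite_enhanced hω hα
  have hωE : ω ⊆ enhanced φ ω α := subset_enhanced
  have hcls := rad_le_rad_cls (enhanced φ ω α) ζ ((nxt (enhanced φ ω α))^[t] ζ)
  have hopn := rad_le_rad_opn (enhanced φ ω α) ζ ((nxt (enhanced φ ω α))^[t] ζ)
  set E := enhanced φ ω α with hE
  have hcB : ∀ j, Conn Eᶜ (cls E ζ) (cls E ((nxt E)^[j] ζ)) := fun j =>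
    hζ.conn_cls (Nat.zero_le j) fun t _ _ => (hζ.iterate t).cls_notMem
  set X : Set Site := {y | ∃ j ≤ t, y = opn E ((nxt E)^[j] ζ)} with hX
  have hXE : X ⊆ E := by
    rintro y ⟨j, -, rfl⟩
    exact (hζ.iterate j).opn_mem
  have hXf : X.Finite := hEfin.subset hXE
  have hXc : Conn X (opn E ζ) (opn E ((nxt E)^[t] ζ)) :=
    hζ.conn_opn (S := X) (Nat.zero_le t) fun j _ hj => ⟨j, hj, rfl⟩
  have h0X : opn E ζ ∈ X := ⟨0, Nat.zero_le t, rfl⟩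
  have htX : opn E ((nxt E)^[t] ζ) ∈ X := ⟨t, le_rfl, rfl⟩
  obtain ⟨p, q, o, χ, hp, hpq, hrad, hpo, ⟨j, hj, hχ⟩, hoχ⟩ :
      ∃ p q o χ, p ∈ ω ∧ Conn ω p q ∧ 16 * R + 22 ≤ rad p q ∧ Conn ω p o ∧ χ ∈ X ∧
        (o = χ ∨ triLattice.Adj o χ) := by
    obtain ⟨co, hco, he | he⟩ := exists_coord_rad_eq (opn E ζ) (opn E ((nxt E)^[t] ζ))
    · obtain ⟨p, q, o, χ, h1, h2, h3, h4⟩ :=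
        h.exists_cluster_near (α := α) hXf hXE hco h0X hXc (by omega)
      exact ⟨p, q, o, χ, h1, h2, by omega, h4⟩
    · obtain ⟨p, q, o, χ, h1, h2, h3, h4⟩ :=
        h.exists_cluster_near (α := α) hXf hXE hco htX hXc.symm (by omega)
      exact ⟨p, q, o, χ, h1, h2, by omega, h4⟩
  have hM := Matched.of_conn h hω hα hp hpq hζ.cls_notMem (hcB t) hrad (by omega)
  rw [← hE] at hM
  have ho : o ∈ ω := hpo.mem hp
  obtain ⟨x, hx, hxo⟩ : ∃ x ∈ gates {x | Conn ω p x} {x | Conn Eᶜ (cls E ζ) x},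
      Conn E (opn E ζ) (opn E x) := by
    have hχE : Conn E (opn E ζ) χ := by
      rw [hχ]
      exact hζ.conn_opn (Nat.zero_le j) fun t _ _ => (hζ.iterate t).opn_mem
    by_cases hχω : χ ∈ ω
    · refine ⟨(nxt E)^[j] ζ, mem_gates (ω := E) (hcB j) ?_, hχ ▸ hχE⟩
      rw [← hχ]
      exact hpo.trans (Conn.single_or_eq ho hχω hoχ)
    -- Otherwise the loop of `ω` through the edge `χ o` is large and hence meets `B`.
    · have hoχ : triLattice.Adj o χ := hoχ.resolve_left fun he => hχω (he ▸ ho)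
      obtain ⟨η, i, hi, hi'⟩ := exists_side hoχ.symm
      have hη : Mixed ω η := ⟨i, by rwa [hi], by rwa [hi']⟩
      have hexit : exitSide ω η = i := exitSide_eq (by rwa [hi]) (by rwa [hi'])
      have hηc : cls ω η = χ := by rw [cls, hexit, hi]
      have hηo : opn ω η = o := by rw [opn, hexit, hi']
      have hw : cls E ((nxt E)^[j] ζ) ∉ E := (hζ.iterate j).cls_notMem
      have hEω : Eᶜ ⊆ ωᶜ := Set.compl_subset_compl.2 hωE
      have hwχ : Conn ωᶜ (cls E ((nxt E)^[j] ζ)) χ :=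
        Conn.single (hEω hw) hχω (hχ ▸ cls_adj_opn _ _)
      have hlarge : ∀ c : Site, ∃ z, Conn Eᶜ (cls E ((nxt E)^[j] ζ)) z ∧ 6 * R + 10 ≤ rad c z := by
        intro c
        obtain ⟨z, hz, hz'⟩ := exists_le_rad (hcB t) (n := 6 * R + 10) (by omega) c
        exact ⟨z, (hcB j).symm.trans hz, hz'⟩
      obtain ⟨t', ht'⟩ : ∃ t', 6 * R + 8 < rad η.1 ((nxt ω)^[t'] η).1 := by
        by_contra! hc
        obtain ⟨a, ha, ha'⟩ := hM.large_left η.1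
        obtain ⟨b, hb, hb'⟩ := hlarge η.1
        exact not_conn_of_orbit_in_box hω hη (c := η.1) (n := 6 * R + 8) hc (a := a) (b := b)
          (hηo ▸ hpo.symm.trans ha) (hηc ▸ hwχ.symm.trans (hb.mono hEω)) (by omega) (by omega)
      have hcl := rad_le_rad_cls ω η ((nxt ω)^[t'] η)
      obtain ⟨y, ⟨k, rfl⟩, hy⟩ := h.exists_conn_of_far (α := α)
        (Y := {y | ∃ k, y = cls ω ((nxt ω)^[k] η)}) (u := cls ω η) (w := cls E ((nxt E)^[j] ζ))
        (by rintro y ⟨k, rfl⟩; exact (hη.iterate k).cls_notMem) ⟨0, rfl⟩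
        (hη.conn_cls (Nat.zero_le t') fun k _ _ => ⟨k, rfl⟩) (by omega) hw (hηc ▸ hwχ)
        (fun c => (hlarge c).imp fun z hz => ⟨hz.1, by have := hz.2; omega⟩)
      have hok : Conn ω o (opn ω ((nxt ω)^[k] η)) := by
        rw [← hηo]
        exact hη.conn_opn (Nat.zero_le k) fun t _ _ => (hη.iterate t).opn_mem
      have hg : (nxt ω)^[k] η ∈ gates {x | Conn ω p x} {x | Conn Eᶜ (cls E ζ) x} :=
        mem_gates (ω := ω) ((hcB j).trans hy) (hpo.trans hok)
      refine ⟨_, hg, ?_⟩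
      rw [← hM.left.opn_eq hM.right hg]
      exact hχE.trans ((Conn.single (hXE ⟨j, hj, hχ⟩) (hωE ho) hoχ.symm).trans (hok.mono hωE))
  obtain ⟨m, hm⟩ := exists_iterate_eq hEfin hζ (hM.right.mixed hx) hxo (hM.right.cls_mem hx)
  obtain ⟨N, hN⟩ := exists_iterate_eq_of_iterate_eq (minimalPeriod_pos hEfin ζ) hm
  obtain ⟨s, hs, hst⟩ := (hM.commonReturns h).swap.exists_stair
    (fun s _ => minimalPeriod_pos hEfin s) (fun s _ => minimalPeriod_pos hω s) hx N
  rw [hN] at hst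
  refine ⟨s, hM.left.mixed hs, ?_⟩
  simpa only [rad_comm] using hst

end

section

/-! ### Localization: finite loops of arbitrary configurations -/

theorem nxt_congr {ω ω' : Config} {ξ : DualSite} (h : ∀ y, rad ξ.1 y ≤ 1 → (y ∈ ω ↔ y ∈ ω')) :
    nxt ω ξ = nxt ω' ξ := by
  have hv : ∀ i, vtx ξ i ∈ ω ↔ vtx ξ i ∈ ω' := fun i => h _ (rad_vtx ξ i)
  have hm : Mixed ω ξ ↔ Mixed ω' ξ := by simp only [Mixed, hv]
  by_cases hω : Mixed ω ξ
  · have hω' := hm.1 hω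
    obtain ⟨i, h1, h2⟩ := hω
    rw [Mixed.nxt_eq ⟨i, h1, h2⟩, hω'.nxt_eq, exitSide_eq h1 h2,
      exitSide_eq (fun hc => h1 ((hv _).2 hc)) ((hv _).1 h2)]
  · rw [nxt, if_neg hω, nxt, if_neg fun hc => hω (hm.2 hc)]

theorem mixed_congr {ω ω' : Config} {ξ : DualSite} (h : ∀ y, rad ξ.1 y ≤ 1 → (y ∈ ω ↔ y ∈ ω')) :
    Mixed ω ξ ↔ Mixed ω' ξ := by
  have hv : ∀ i, vtx ξ i ∈ ω ↔ vtx ξ i ∈ ω' := fun i => h _ (rad_vtx ξ i)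
  simp only [Mixed, hv]

theorem iterate_nxt_congr {ω ω' : Config} {ξ : DualSite} {c : Site} {N : ℤ}
    (h : ∀ y, rad c y ≤ N → (y ∈ ω ↔ y ∈ ω')) (hξ : ∀ t, rad c ((nxt ω)^[t] ξ).1 + 1 ≤ N) (t : ℕ) :
    (nxt ω)^[t] ξ = (nxt ω')^[t] ξ := by
  induction t with
  | zero => rfl
  | succ t ih =>
    rw [Function.iterate_succ_apply', Function.iterate_succ_apply', ← ih]
    exact nxt_congr fun y hy => h y ((rad_triangle c ((nxt ω)^[t] ξ).1 y).trans (by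
      have := hξ t
      omega))

theorem minimalPeriod_nxt_congr {ω ω' : Config} {ξ : DualSite}
    (h : ∀ t, (nxt ω)^[t] ξ = (nxt ω')^[t] ξ) :
    Function.minimalPeriod (nxt ω) ξ = Function.minimalPeriod (nxt ω') ξ :=
  Function.minimalPeriod_eq_minimalPeriod_iff.2 fun n => by
    rw [Function.IsPeriodicPt, Function.IsPeriodicPt, Function.IsFixedPt, Function.IsFixedPt, h]

theorem Stair.exists_of_le {r : ℕ → ℕ → Prop} {p q : ℕ × ℕ} (h : Stair r p q) (hpq : p ≠ q) {j : ℕ}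
    (hj : p.2 ≤ j) (hj' : j ≤ q.2) : ∃ i, r i j := by
  have key : q = p ∨ ∀ j, p.2 ≤ j → j ≤ q.2 → ∃ i, r i j := by
    clear hpq hj'
    induction h with
    | refl => exact Or.inl rfl
    | @tail x y _ hxy ih =>
      obtain ⟨h1, h2, h3⟩ := hxy
      have hy : y.2 ≤ x.2 + 1 := by rcases h3 with h3 | h3 <;> simp [h3]
      right
      intro j hj hj'
      rcases ih with rfl | ih
      · rcases hj.eq_or_lt with rfl | hj
        · exact ⟨_, h1⟩
        · rw [show j = y.2 by omega]
          exact ⟨_, h2⟩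
      · by_cases hjx : j ≤ x.2
        · exact ih j hj hjx
        · rw [show j = y.2 by omega]
          exact ⟨_, h2⟩
  rcases key with h | h
  · exact absurd h.symm hpq
  · exact h j hj hj'

/-- A coupling within a large box does not depend on the configurations outside the box. -/
theorem exists_stair_of_local {S S' T T' : Config} {N M K : ℤ}
    (hS : ∀ y, rad 0 y ≤ N → (y ∈ S ↔ y ∈ S')) (hT : ∀ y, rad 0 y ≤ N → (y ∈ T ↔ y ∈ T'))
    (hT' : T'.Finite) (hN : M + K + 1 ≤ N) (hK : 0 ≤ K) {ζ : DualSite}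
    (hζ : ∀ t, rad 0 ((nxt S)^[t] ζ).1 ≤ M) (hpos : 0 < Function.minimalPeriod (nxt S) ζ)
    (h : ∃ s, Mixed T' s ∧ Stair (fun a b => rad ((nxt S')^[a] ζ).1 ((nxt T')^[b] s).1 ≤ K) (0, 0)
      (Function.minimalPeriod (nxt S') ζ, Function.minimalPeriod (nxt T') s)) :
    ∃ s, Mixed T s ∧ 0 < Function.minimalPeriod (nxt T) s ∧
      Stair (fun a b => rad ((nxt S)^[a] ζ).1 ((nxt T)^[b] s).1 ≤ K) (0, 0)
      (Function.minimalPeriod (nxt S) ζ, Function.minimalPeriod (nxt T) s) := by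
  obtain ⟨s, hs, hst⟩ := h
  have e1 := iterate_nxt_congr hS (ξ := ζ) (fun t => by have := hζ t; omega)
  have e2 := minimalPeriod_nxt_congr e1
  have hspos := minimalPeriod_pos hT' s
  have hsb : ∀ t, rad 0 ((nxt T')^[t] s).1 + 1 ≤ N := by
    intro t
    rw [← Function.iterate_mod_minimalPeriod_eq]
    obtain ⟨i, hi⟩ := hst.exists_of_le (j := t % Function.minimalPeriod (nxt T') s)
      (by rw [← e2]; simp; omega) (Nat.zero_le _) (Nat.mod_lt _ hspos).le
    have h1 := hζ i
    rw [e1] at h1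
    have h2 := rad_triangle 0 ((nxt S')^[i] ζ).1
      ((nxt T')^[t % Function.minimalPeriod (nxt T') s] s).1
    omega
  have e3 := iterate_nxt_congr (fun y hy => (hT y hy).symm) hsb
  have e4 := minimalPeriod_nxt_congr e3
  refine ⟨s, (mixed_congr fun y hy => hT y ?_).2 hs, e4 ▸ hspos, ?_⟩
  · have h1 := hsb 0
    rw [Function.iterate_zero_apply] at h1
    exact (rad_triangle 0 s.1 y).trans (by omega)
  · simpa only [e1, e2, ← e3, ← e4] using hst

theorem exists_forall_rad_le {ω : Config} {ζ : DualSite}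
    (hpos : 0 < Function.minimalPeriod (nxt ω) ζ) : ∃ M, ∀ t, rad 0 ((nxt ω)^[t] ζ).1 ≤ M := by
  refine ⟨∑ t ∈ Finset.range (Function.minimalPeriod (nxt ω) ζ), rad 0 ((nxt ω)^[t] ζ).1,
    fun t => ?_⟩
  rw [← Function.iterate_mod_minimalPeriod_eq]
  exact Finset.single_le_sum (f := fun t => rad 0 ((nxt ω)^[t] ζ).1) (fun t _ => rad_nonneg _ _)
    (Finset.mem_range.2 (Nat.mod_lt _ hpos))

variable {φ : Config → Config} {R : ℤ} {ω α : Config} {ζ : DualSite}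

theorem Admissible.mem_enhanced_local (h : Admissible φ R) {N : ℤ} {y : Site}
    (hy : rad 0 y ≤ N - 2 * R) : y ∈ enhanced φ ω α ↔
      y ∈ enhanced φ (ω ∩ {x | rad 0 x ≤ N}) (α ∩ {x | rad 0 x ≤ N}) := by
  have hR := h.nonneg
  rw [mem_enhanced_iff, mem_enhanced_iff]
  constructor
  · rintro (hω | ⟨x, hx, hyx⟩)
    · exact Or.inl ⟨hω, by rw [Set.mem_ofPred_eq]; omega⟩
    · have h1 := h.rad_le hyx
      have h2 := rad_triangle 0 y x
      rw [rad_comm y x] at h2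
      have hsub : enhanceAt φ x ω ⊆ enhanceAt φ x (ω ∩ {x | rad 0 x ≤ N}) :=
        h.enhanceAt_subset fun z hz hzω => ⟨hzω, by
          have h3 := rad_triangle 0 x z
          rw [Set.mem_ofPred_eq]
          omega⟩
      exact Or.inr ⟨x, ⟨hx, by rw [Set.mem_ofPred_eq]; omega⟩, hsub hyx⟩
  · rintro (hω | ⟨x, hx, hyx⟩)
    · exact Or.inl hω.1
    · exact Or.inr ⟨x, hx.1, enhanceAt_mono h.mono x Set.inter_subset_left hyx⟩

/-- Each large finite loop of a configuration follows a loop of its enhancement. -/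
theorem Admissible.exists_stair (h : Admissible φ R) (hζ : Mixed ω ζ)
    (hpos : 0 < Function.minimalPeriod (nxt ω) ζ) {t : ℕ}
    (ht : 20 * R + 30 < rad ζ.1 ((nxt ω)^[t] ζ).1) :
    ∃ s, Mixed (enhanced φ ω α) s ∧ 0 < Function.minimalPeriod (nxt (enhanced φ ω α)) s ∧
      Stair (fun a b => rad ((nxt ω)^[a] ζ).1 ((nxt (enhanced φ ω α))^[b] s).1 ≤ 16 * R + 26) (0, 0)
        (Function.minimalPeriod (nxt ω) ζ, Function.minimalPeriod (nxt (enhanced φ ω α)) s) := by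
  have hR := h.nonneg
  obtain ⟨M, hM⟩ := exists_forall_rad_le hpos
  obtain ⟨N, hN⟩ : ∃ N, N = M + (16 * R + 26) + 1 + 2 * R := ⟨_, rfl⟩
  have hω : ∀ y, rad 0 y ≤ N - 2 * R → (y ∈ ω ↔ y ∈ ω ∩ {x | rad 0 x ≤ N}) := fun y hy =>
    ⟨fun hyω => ⟨hyω, by rw [Set.mem_ofPred_eq]; omega⟩, fun hyω => hyω.1⟩
  have hfin : ∀ S : Set Site, (S ∩ {x | rad 0 x ≤ N}).Finite := fun S =>
    (finite_rad_le 0 N).subset Set.inter_subset_right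
  refine exists_stair_of_local hω (fun y hy => h.mem_enhanced_local hy)
    (h.finite_enhanced (hfin ω) (hfin α)) (by omega) (by omega) hM hpos ?_
  have e := iterate_nxt_congr hω (ξ := ζ) (fun t => by have := hM t; omega)
  refine h.exists_stair_of_finite (hfin ω) (hfin α) ((mixed_congr fun y hy => hω y ?_).1 hζ)
    (t := t) (by rwa [← e])
  have h1 := hM 0
  rw [Function.iterate_zero_apply] at h1
  exact (rad_triangle 0 ζ.1 y).trans (by omega)

/-- Each large finite loop of the enhancement of a configuration follows a loop of the
configuration. -/
theorem Admissible.exists_stair_enhanced (h : Admissible φ R) (hζ : Mixed (enhanced φ ω α) ζ)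
    (hpos : 0 < Function.minimalPeriod (nxt (enhanced φ ω α)) ζ) {t : ℕ}
    (ht : 20 * R + 30 < rad ζ.1 ((nxt (enhanced φ ω α))^[t] ζ).1) :
    ∃ s, Mixed ω s ∧ 0 < Function.minimalPeriod (nxt ω) s ∧
      Stair (fun a b => rad ((nxt (enhanced φ ω α))^[a] ζ).1 ((nxt ω)^[b] s).1 ≤ 16 * R + 26) (0, 0)
        (Function.minimalPeriod (nxt (enhanced φ ω α)) ζ, Function.minimalPeriod (nxt ω) s) := by
  have hR := h.nonneg
  obtain ⟨M, hM⟩ := exists_forall_rad_le hpos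
  obtain ⟨N, hN⟩ : ∃ N, N = M + (16 * R + 26) + 1 + 2 * R := ⟨_, rfl⟩
  have hω : ∀ y, rad 0 y ≤ N - 2 * R → (y ∈ ω ↔ y ∈ ω ∩ {x | rad 0 x ≤ N}) := fun y hy =>
    ⟨fun hyω => ⟨hyω, by rw [Set.mem_ofPred_eq]; omega⟩, fun hyω => hyω.1⟩
  have hE : ∀ y, rad 0 y ≤ N - 2 * R → (y ∈ enhanced φ ω α ↔
      y ∈ enhanced φ (ω ∩ {x | rad 0 x ≤ N}) (α ∩ {x | rad 0 x ≤ N})) :=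
    fun y hy => h.mem_enhanced_local hy
  have hfin : ∀ S : Set Site, (S ∩ {x | rad 0 x ≤ N}).Finite := fun S =>
    (finite_rad_le 0 N).subset Set.inter_subset_right
  refine exists_stair_of_local hE hω (hfin ω) (by omega) (by omega) hM hpos ?_
  have e := iterate_nxt_congr hE (ξ := ζ) (fun t => by have := hM t; omega)
  refine h.exists_stair_enhanced_of_finite (hfin ω) (hfin α)
    ((mixed_congr fun y hy => hE y ?_).1 hζ) (t := t) (by rwa [← e])
  have h1 := hM 0
  rw [Function.iterate_zero_apply] at h1
  exact (rad_triangle 0 ζ.1 y).trans (by omega)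

end

/-! ### The distance between curves -/

/-- The length of the straight segment bounds `sphereDist`. -/
theorem sphereDist_le {u v : ℂ} {c : ℝ}
    (hc : ∀ t ∈ Set.Icc (0 : ℝ) 1, (1 + ‖u + t • (v - u)‖ ^ 2)⁻¹ ≤ c) :
    sphereDist u v ≤ c * ‖v - u‖ := by
  have hd : ∀ t : ℝ, HasDerivAt (fun t : ℝ => u + t • (v - u)) (v - u) t := fun t => by
    simpa using ((hasDerivAt_id t).smul_const (v - u)).const_add u
  have hcont : ContDiff ℝ ((⊤ : ℕ∞) : WithTop ℕ∞) fun t : ℝ => u + t • (v - u) := by fun_prop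
  have hle : sphereDist u v ≤ ∫ t in (0 : ℝ)..1, (1 + ‖u + t • (v - u)‖ ^ 2)⁻¹ *
      ‖deriv (fun t : ℝ => u + t • (v - u)) t‖ := by
    refine csInf_le ⟨0, ?_⟩ ⟨fun t : ℝ => u + t • (v - u), hcont, by simp, by simp, rfl⟩
    rintro r ⟨f, -, -, -, rfl⟩
    exact intervalIntegral.integral_nonneg zero_le_one fun t _ => by positivity
  refine hle.trans ?_
  · have e : ∀ t : ℝ, deriv (fun t : ℝ => u + t • (v - u)) t = v - u := fun t => (hd t).deriv
    simp only [e]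
    have h1 : ∫ t in (0 : ℝ)..1, (1 + ‖u + t • (v - u)‖ ^ 2)⁻¹ * ‖v - u‖ ≤
        ∫ t in (0 : ℝ)..1, c * ‖v - u‖ := by
      refine intervalIntegral.integral_mono_on zero_le_one ?_ (by simp) fun t ht =>
        mul_le_mul_of_nonneg_right (hc t ht) (norm_nonneg _)
      refine Continuous.intervalIntegrable ?_ _ _
      refine Continuous.mul (Continuous.inv₀ (by fun_prop) fun t => ?_) continuous_const
      positivity
    simpa using h1

theorem sphereDist_le_norm (u v : ℂ) : sphereDist u v ≤ ‖u - v‖ := by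
  rw [norm_sub_rev]
  refine (sphereDist_le (c := 1) fun t _ => ?_).trans_eq (one_mul _)
  exact inv_le_one_of_one_le₀ (by nlinarith [sq_nonneg ‖u + t • (v - u)‖])

theorem sphereDist_comm (u v : ℂ) : sphereDist u v = sphereDist v u := by
  have key : ∀ u v : ℂ, {r : ℝ | ∃ f : ℝ → ℂ, ContDiff ℝ ((⊤ : ℕ∞) : WithTop ℕ∞) f ∧ f 0 = u ∧
      f 1 = v ∧ r = ∫ t in (0 : ℝ)..1, (1 + ‖f t‖ ^ 2)⁻¹ * ‖deriv f t‖} ⊆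
      {r : ℝ | ∃ f : ℝ → ℂ, ContDiff ℝ ((⊤ : ℕ∞) : WithTop ℕ∞) f ∧ f 0 = v ∧
      f 1 = u ∧ r = ∫ t in (0 : ℝ)..1, (1 + ‖f t‖ ^ 2)⁻¹ * ‖deriv f t‖} := by
    rintro u v r ⟨f, hf, h0, h1, rfl⟩
    refine ⟨fun t => f (1 - t), hf.comp (by fun_prop), by simpa using h1, by simpa using h0, ?_⟩
    have e : ∀ t, deriv (fun t => f (1 - t)) t = -deriv f (1 - t) := fun t =>
      deriv_comp_const_sub f 1 t
    simp only [e, norm_neg]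
    rw [intervalIntegral.integral_comp_sub_left
      (fun t => (1 + ‖f t‖ ^ 2)⁻¹ * ‖deriv f t‖) 1]
    simp
  exact congrArg sInf ((key u v).antisymm (key v u))

theorem curveDist_comm (C C' : Curve) : curveDist C C' = curveDist C' C := by
  have key : ∀ C C' : Curve, curveDist C C' ≤ curveDist C' C := fun C C' =>
    le_iInf₂ fun f₁ h₁ => le_iInf₂ fun f₂ h₂ =>
      iInf₂_le_of_le f₂ h₂ (iInf₂_le_of_le f₁ h₁ (by simp only [sphereDist_comm]; rfl))
  exact (key C C').antisymm (key C' C)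

theorem curveDist_le_of_reparams {C C' : Curve} {f₁ f₂ : C(unitInterval, unitInterval)}
    (h₁ : f₁ ∈ reparams) (h₂ : f₂ ∈ reparams) {ε : ℝ}
    (h : ∀ t, sphereDist (C (f₁ t)) (C' (f₂ t)) ≤ ε) : curveDist C C' ≤ ENNReal.ofReal ε :=
  iInf₂_le_of_le f₁ h₁ (iInf₂_le_of_le f₂ h₂ (iSup_le fun t => ENNReal.ofReal_le_ofReal (h t)))

theorem curveDist_le {C C' : Curve} {ε : ℝ} (h : ∀ t t', sphereDist (C t) (C' t') ≤ ε) :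
    curveDist C C' ≤ ENNReal.ofReal ε :=
  curveDist_le_of_reparams (f₁ := ContinuousMap.id _) (f₂ := ContinuousMap.id _)
    ⟨Or.inl monotone_id, Function.surjective_id⟩ ⟨Or.inl monotone_id, Function.surjective_id⟩
    fun _ => h _ _

/-- The curve run through in the opposite direction. -/
def Curve.reverse (C : Curve) : Curve := C.comp ⟨unitInterval.symm, unitInterval.continuous_symm⟩

theorem curveDist_reverse_le (C C' : Curve) : curveDist C.reverse C' ≤ curveDist C C' := by
  refine le_iInf₂ fun f₁ h₁ => le_iInf₂ fun f₂ h₂ =>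
    iInf₂_le_of_le ((⟨unitInterval.symm, unitInterval.continuous_symm⟩ :
      C(unitInterval, unitInterval)).comp f₁) ⟨?_, ?_⟩
      (iInf₂_le_of_le f₂ h₂ (le_of_eq ?_))
  · have hs : Antitone unitInterval.symm := fun a b hab => unitInterval.symm_le_symm.2 hab
    rcases h₁.1 with h | h
    · exact Or.inr (hs.comp_monotone h)
    · exact Or.inl (hs.comp h)
  · exact unitInterval.symm_bijective.surjective.comp h₁.2
  · simp [Curve.reverse]

/-! ### Polygonal curves -/

/-- The piecewise affine interpolation of `q 0, …, q k` at the times `0, …, k`. -/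
def interp {E : Type*} [AddCommGroup E] [Module ℝ E] (q : ℕ → E) (k : ℕ) (x : ℝ) : E :=
  q 0 + ∑ i ∈ Finset.range k, (max 0 (min 1 (x - i)) : ℝ) • (q (i + 1) - q i)

theorem polyline_apply (q : ℕ → ℂ) (k : ℕ) (t : unitInterval) :
    polyline q k t = interp q k (k * t) := rfl

theorem interp_eq {E : Type*} [AddCommGroup E] [Module ℝ E] (q : ℕ → E) {k i : ℕ} (hi : i < k)
    {θ : ℝ} (h0 : 0 ≤ θ) (h1 : θ ≤ 1) : interp q k (i + θ) = q i + θ • (q (i + 1) - q i) := by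
  unfold interp
  obtain ⟨m, rfl⟩ : ∃ m, k = i + 1 + m := ⟨k - (i + 1), by omega⟩
  rw [Finset.sum_range_add, Finset.sum_range_succ]
  have e1 : ∑ j ∈ Finset.range i, (max 0 (min 1 ((i : ℝ) + θ - j)) : ℝ) • (q (j + 1) - q j) =
      q i - q 0 := by
    rw [← Finset.sum_range_sub]
    refine Finset.sum_congr rfl fun j hj => ?_
    have hj : (j : ℝ) + 1 ≤ i := by exact_mod_cast Finset.mem_range.1 hj
    rw [min_eq_left (by linarith), max_eq_right zero_le_one, one_smul]
  have e2 : ∑ j ∈ Finset.range m, (max 0 (min 1 ((i : ℝ) + θ - ((i + 1 + j : ℕ) : ℝ))) : ℝ) •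
      (q (i + 1 + j + 1) - q (i + 1 + j)) = 0 := by
    refine Finset.sum_eq_zero fun j _ => ?_
    rw [max_eq_left, zero_smul]
    refine (min_le_right _ _).trans ?_
    push_cast
    have : (0 : ℝ) ≤ j := j.cast_nonneg
    linarith
  rw [e1, e2, add_sub_cancel_left, min_eq_right h1, max_eq_right h0]
  abel

theorem interp_natCast {E : Type*} [AddCommGroup E] [Module ℝ E] (q : ℕ → E) {k i : ℕ}
    (hi : i ≤ k) : interp q k i = q i := by
  rcases hi.lt_or_eq with hi | rfl
  · simpa using interp_eq q hi (θ := 0) le_rfl zero_le_one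
  · rcases i with _ | i
    · simp [interp]
    · have := interp_eq q (Nat.lt_succ_self i) (θ := 1) zero_le_one le_rfl
      rw [one_smul, add_sub_cancel] at this
      rw [← this]
      push_cast
      rfl

theorem exists_eq_add {k : ℕ} (hk : 0 < k) {x : ℝ} (h0 : 0 ≤ x) (h1 : x ≤ k) :
    ∃ i < k, ∃ θ : ℝ, 0 ≤ θ ∧ θ ≤ 1 ∧ x = i + θ := by
  rcases h1.lt_or_eq with h1 | rfl
  · exact ⟨⌊x⌋₊, (Nat.floor_lt h0).2 h1, x - ⌊x⌋₊, sub_nonneg.2 (Nat.floor_le h0),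
      by linarith [Nat.lt_floor_add_one x], by ring⟩
  · refine ⟨k - 1, by omega, 1, zero_le_one, le_rfl, ?_⟩
    rw [Nat.cast_sub hk]
    push_cast
    ring

theorem mul_mem_Icc (k : ℕ) (t : unitInterval) : 0 ≤ (k : ℝ) * t ∧ (k : ℝ) * t ≤ k :=
  ⟨mul_nonneg k.cast_nonneg t.2.1, mul_le_of_le_one_right k.cast_nonneg t.2.2⟩

theorem polyline_reverse {q q' : ℕ → ℂ} {k : ℕ} (hq : ∀ i ≤ k, q' i = q (k - i)) :
    polyline q' k = (polyline q k).reverse := by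
  ext t
  have hsymm : (polyline q k).reverse t = interp q k (k * (1 - t)) := rfl
  rw [hsymm, polyline_apply]
  rcases Nat.eq_zero_or_pos k with rfl | hk
  · simp [interp, hq 0 le_rfl]
  · obtain ⟨i, hi, θ, h0, h1, hx⟩ := exists_eq_add hk (mul_mem_Icc k t).1 (mul_mem_Icc k t).2
    have e : (k : ℝ) * (1 - t) = ((k - 1 - i : ℕ) : ℝ) + (1 - θ) := by
      rw [mul_sub, hx, Nat.sub_sub, Nat.cast_sub (by omega)]
      push_cast
      ring
    rw [hx, e, interp_eq q' hi h0 h1, interp_eq q (by omega) (by linarith) (by linarith),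
      hq i hi.le, hq (i + 1) hi, show k - 1 - i = k - (i + 1) by omega,
      show k - (i + 1) + 1 = k - i by omega]
    simp only [sub_smul, one_smul]
    module

/-- A polygonal curve stays in every ball that contains its vertices. -/
theorem norm_polyline_sub_le {q : ℕ → ℂ} {k : ℕ} (hk : 0 < k) {z : ℂ} {r : ℝ}
    (h : ∀ i ≤ k, ‖q i - z‖ ≤ r) (t : unitInterval) : ‖polyline q k t - z‖ ≤ r := by
  obtain ⟨i, hi, θ, h0, h1, hx⟩ := exists_eq_add hk (mul_mem_Icc k t).1 (mul_mem_Icc k t).2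
  rw [polyline_apply, hx, interp_eq q hi h0 h1]
  have e : q i + θ • (q (i + 1) - q i) - z = (1 - θ) • (q i - z) + θ • (q (i + 1) - z) := by
    module
  rw [e]
  refine (norm_add_le _ _).trans ?_
  rw [norm_smul, norm_smul, Real.norm_of_nonneg h0, Real.norm_of_nonneg (sub_nonneg.2 h1)]
  have := mul_le_mul_of_nonneg_left (h i hi.le) (sub_nonneg.2 h1)
  have := mul_le_mul_of_nonneg_left (h (i + 1) hi) h0
  linarith

theorem Stair.exists_path {r : ℕ → ℕ → Prop} {p q : ℕ × ℕ} (h : Stair r p q) (hpq : p ≠ q) :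
    ∃ (N : ℕ) (I J : ℕ → ℕ), 0 < N ∧ (I 0, J 0) = p ∧ (I N, J N) = q ∧
      (∀ n ≤ N, r (I n) (J n)) ∧ (∀ n < N, I (n + 1) = I n ∨ I (n + 1) = I n + 1) ∧
      ∀ n < N, J (n + 1) = J n ∨ J (n + 1) = J n + 1 := by
  have key : q = p ∨ ∃ (N : ℕ) (f : ℕ → ℕ × ℕ), 0 < N ∧ f 0 = p ∧ f N = q ∧
      (∀ n ≤ N, r (f n).1 (f n).2) ∧ ∀ n < N, (f (n + 1) = ((f n).1 + 1, (f n).2) ∨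
        f (n + 1) = ((f n).1, (f n).2 + 1)) := by
    clear hpq
    induction h with
    | refl => exact Or.inl rfl
    | @tail x y _ hxy ih =>
      obtain ⟨h1, h2, h3⟩ := hxy
      right
      rcases ih with rfl | ⟨N, f, hN, hf0, hfN, hf, hs⟩
      · refine ⟨1, fun n => if n = 0 then x else y, one_pos, by simp, by simp, fun n _ => ?_,
          fun n hn => ?_⟩
        · dsimp only
          split_ifs
          · exact h1
          · exact h2
        · obtain rfl : n = 0 := by omega
          simpa using h3
      · refine ⟨N + 1, fun n => if n ≤ N then f n else y, by omega, by simpa using hf0, by simp,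
          fun n hn => ?_, fun n hn => ?_⟩
        · dsimp only
          split_ifs with hnN
          · exact hf n hnN
          · exact h2
        · dsimp only
          rw [if_pos (by omega : n ≤ N)]
          split_ifs with hnN
          · exact hs n (by omega)
          · obtain rfl : n = N := by omega
            rw [hfN]
            exact h3
  rcases key with h | ⟨N, f, h1, h2, h3, h4, h5⟩
  · exact absurd h.symm hpq
  · refine ⟨N, fun n => (f n).1, fun n => (f n).2, h1, h2, h3, h4, fun n hn => ?_, fun n hn => ?_⟩
    · rcases h5 n hn with h | h <;> simp [h]
    · rcases h5 n hn with h | h <;> simp [h]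

theorem continuous_interp (q : ℕ → ℝ) (k : ℕ) : Continuous (interp q k) := by
  unfold interp
  fun_prop

/-- The time change of a polygonal curve with `k` sides that is at the vertex number `I n` at time
`n / N`. -/
theorem exists_reparam {N k : ℕ} (hN : 0 < N) (hk : 0 < k) {I : ℕ → ℕ} (h0 : I 0 = 0)
    (hIN : I N = k) (hI : ∀ n < N, I (n + 1) = I n ∨ I (n + 1) = I n + 1) :
    ∃ f ∈ reparams, ∀ q : ℕ → ℂ, ∀ t, polyline q k (f t) =
      interp (fun n => q (I n)) N (N * t) := by
  have hk' : (0 : ℝ) < k := Nat.cast_pos.2 hk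
  have hmonoI : ∀ n ≤ N, ∀ m ≤ n, I m ≤ I n := by
    intro n hn m hm
    induction n, hm using Nat.le_induction with
    | base => exact le_rfl
    | succ n hm ih =>
      have := ih (by omega)
      rcases hI n (by omega) with h | h <;> omega
  have hlek : ∀ n ≤ N, I n ≤ k := fun n hn => hIN ▸ hmonoI N le_rfl n hn
  set F : ℝ → ℝ := interp (fun n => (I n : ℝ)) N with hF
  have hmono : Monotone F := by
    intro x y hxy
    refine add_le_add le_rfl (Finset.sum_le_sum fun i hi => ?_)
    have hi := Finset.mem_range.1 hi
    have h1 : (I i : ℝ) ≤ I (i + 1) := by exact_mod_cast hmonoI (i + 1) hi i (by omega)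
    simp only [smul_eq_mul]
    gcongr
  have hF0 : F 0 = 0 := by
    have := interp_natCast (fun n => (I n : ℝ)) (Nat.zero_le N)
    simpa [h0] using this
  have hFN : F N = k := by
    have := interp_natCast (fun n => (I n : ℝ)) (le_refl N)
    simpa [hIN] using this
  have hmem : ∀ t : unitInterval, F (N * t) / k ∈ unitInterval := by
    intro t
    have h1 := hmono (mul_mem_Icc N t).1
    have h2 := hmono (mul_mem_Icc N t).2
    rw [hF0] at h1
    rw [hFN] at h2
    exact ⟨div_nonneg h1 hk'.le, (div_le_one hk').2 h2⟩
  have hcont : Continuous fun t : unitInterval => (⟨F (N * t) / k, hmem t⟩ : unitInterval) := by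
    have := continuous_interp (fun n => (I n : ℝ)) N
    exact Continuous.subtype_mk (by fun_prop) _
  refine ⟨⟨_, hcont⟩, ⟨Or.inl ?_, ?_⟩, ?_⟩
  · intro s t hst
    refine Subtype.mk_le_mk.2 (div_le_div_of_nonneg_right (hmono ?_) hk'.le)
    exact mul_le_mul_of_nonneg_left hst N.cast_nonneg
  · intro y
    have h1 : (⟨F (N * (0 : unitInterval)) / k, hmem 0⟩ : unitInterval) ≤ y := by
      refine Subtype.coe_le_coe.1 ?_
      simpa [hF0] using y.2.1
    have h2 : y ≤ (⟨F (N * (1 : unitInterval)) / k, hmem 1⟩ : unitInterval) := by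
      refine Subtype.coe_le_coe.1 ?_
      simpa [hFN, hk'.ne'] using y.2.2
    obtain ⟨t, ht⟩ := mem_range_of_exists_le_of_exists_ge hcont ⟨0, h1⟩ ⟨1, h2⟩
    exact ⟨t, ht⟩
  · intro q t
    have e : (k : ℝ) * ((⟨F (N * t) / k, hmem t⟩ : unitInterval) : ℝ) = F (N * t) :=
      mul_div_cancel₀ _ hk'.ne'
    rw [polyline_apply, ContinuousMap.coe_mk, e]
    obtain ⟨n, hn, θ, hθ0, hθ1, hx⟩ := exists_eq_add hN (mul_mem_Icc N t).1 (mul_mem_Icc N t).2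
    rw [hx, hF, interp_eq _ hn hθ0 hθ1, interp_eq _ hn hθ0 hθ1]
    rcases hI n hn with h | h
    · rw [h]
      simp only [sub_self, smul_zero, add_zero]
      exact interp_natCast q (hlek n hn.le)
    · have hlt : I n < k := by
        have := hlek (n + 1) hn
        omega
      rw [h]
      push_cast
      simp only [add_sub_cancel_left, smul_eq_mul, mul_one]
      exact interp_eq q hlt hθ0 hθ1

/-- Coupled sequences of vertices have close polygonal curves. -/
theorem curveDist_polyline_le {q q' : ℕ → ℂ} {k k' : ℕ} (hk : 0 < k) (hk' : 0 < k') {ε : ℝ}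
    (h : Stair (fun a b => ‖q a - q' b‖ ≤ ε) (0, 0) (k, k')) :
    curveDist (polyline q k) (polyline q' k') ≤ ENNReal.ofReal ε := by
  obtain ⟨N, I, J, hN, h0, hNk, hr, hI, hJ⟩ := h.exists_path fun he => by
    have := congrArg Prod.fst he
    simp only at this
    omega
  simp only [Prod.mk.injEq] at h0 hNk
  obtain ⟨f, hf, hfq⟩ := exists_reparam hN hk h0.1 hNk.1 hI
  obtain ⟨f', hf', hfq'⟩ := exists_reparam hN hk' h0.2 hNk.2 hJ
  refine curveDist_le_of_reparams hf hf' fun t => (sphereDist_le_norm _ _).trans ?_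
  rw [hfq, hfq']
  obtain ⟨n, hn, θ, hθ0, hθ1, hx⟩ := exists_eq_add hN (mul_mem_Icc N t).1 (mul_mem_Icc N t).2
  rw [hx, interp_eq _ hn hθ0 hθ1, interp_eq _ hn hθ0 hθ1]
  have e : q (I n) + θ • (q (I (n + 1)) - q (I n)) - (q' (J n) + θ • (q' (J (n + 1)) - q' (J n))) =
      (1 - θ) • (q (I n) - q' (J n)) + θ • (q (I (n + 1)) - q' (J (n + 1))) := by
    module
  rw [e]
  refine (norm_add_le _ _).trans ?_
  rw [norm_smul, norm_smul, Real.norm_of_nonneg hθ0, Real.norm_of_nonneg (sub_nonneg.2 hθ1)]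
  have := mul_le_mul_of_nonneg_left (hr n hn.le) (sub_nonneg.2 hθ1)
  have := mul_le_mul_of_nonneg_left (hr (n + 1) hn) hθ0
  linarith

section

/-! ### Loops of the boundary graph -/

variable {ω : Config} {ξ ζ : DualSite} {δ : ℝ}

theorem nbr_injective (ξ : DualSite) : Function.Injective (nbr ξ) := by
  intro i j h
  rcases ξ with ⟨⟨a, b⟩, _ | _⟩ <;> fin_cases i <;> fin_cases j <;> simp [nbr] at h ⊢ <;> omega

theorem Mixed.adj_nxt (h : Mixed ω ξ) : (boundaryGraph ω).Adj ξ (EnhPerc.nxt ω ξ) := by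
  obtain ⟨j, -, h1, h2⟩ := exists_nbr_nbr ξ (exitSide ω ξ)
  refine ⟨h.nxt_ne.symm, opn ω ξ, cls ω ξ, h.opn_mem, h.cls_notMem, mem_vertices_iff.2 ⟨_, rfl⟩,
    mem_vertices_iff.2 ⟨_, rfl⟩, ?_, ?_⟩ <;> rw [h.nxt_eq, mem_vertices_iff]
  · exact ⟨_, h1⟩
  · exact ⟨_, h2⟩

theorem eq_nxt_of_sides {i j : Fin 3} (h1 : vtx ξ i ∉ ω) (h2 : vtx ξ (i + 1) ∈ ω)
    (h3 : vtx ζ j = vtx ξ (i + 1)) (h4 : vtx ζ (j + 1) = vtx ξ i) : ζ = nxt ω ξ := by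
  obtain ⟨k, -, h5, h6⟩ := exists_nbr_nbr ξ i
  rw [Mixed.nxt_eq ⟨i, h1, h2⟩, exitSide_eq h1 h2]
  exact (side_injective (h3.trans h5.symm) (h4.trans h6.symm)).1

/-- The edges of the boundary graph are the steps along the interfaces. -/
theorem mixed_of_adj (h : (boundaryGraph ω).Adj ξ ζ) :
    Mixed ω ξ ∧ (ζ = nxt ω ξ ∨ ξ = nxt ω ζ) := by
  obtain ⟨hne, x, y, hx, hy, h1, h2, h3, h4⟩ := h
  rw [mem_vertices_iff] at h1 h2 h3 h4
  obtain ⟨i, rfl⟩ := h1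
  obtain ⟨j, rfl⟩ := h2
  obtain ⟨i', h3⟩ := h3
  obtain ⟨j', h4⟩ := h4
  have hij : i = j + 1 ∨ j = i + 1 := by
    have : i ≠ j := fun he => hy (he ▸ hx)
    revert this
    clear * -
    revert i j
    decide
  have hij' : i' = j' + 1 ∨ j' = i' + 1 := by
    have : i' ≠ j' := fun he => hy (by rw [← h4, ← he, h3]; exact hx)
    revert this
    clear * -
    revert i' j'
    decide
  rcases hij with rfl | rfl <;> rcases hij' with rfl | rfl
  · exact absurd (side_injective h4 h3).1.symm hne
  · exact ⟨⟨j, hy, hx⟩, Or.inl (eq_nxt_of_sides hy hx h3 h4)⟩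
  · have hζ : ξ = nxt ω ζ :=
      eq_nxt_of_sides (by rwa [h4]) (by rwa [h3]) h3.symm h4.symm
    exact ⟨hζ ▸ Mixed.nxt ⟨j', by rwa [h4], by rwa [h3]⟩, Or.inr hζ⟩
  · exact absurd (side_injective h3 h4).1.symm hne

theorem Mixed.nxt_nxt_ne (h : Mixed ω ξ) : EnhPerc.nxt ω (EnhPerc.nxt ω ξ) ≠ ξ := by
  intro he
  obtain ⟨j, h0, h1, h2⟩ := exists_nbr_nbr ξ (exitSide ω ξ)
  rw [← h.nxt_eq] at h0 h1 h2
  have e := h.nxt.nxt_eq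
  rw [he] at e
  have hj : j = exitSide ω (EnhPerc.nxt ω ξ) := nbr_injective _ (h0.trans e)
  have h3 : cls ω (EnhPerc.nxt ω ξ) = opn ω ξ := by rw [cls, ← hj]; exact h1
  exact h.nxt.cls_notMem (h3 ▸ h.opn_mem)

theorem Mixed.three_le_minimalPeriod (h : Mixed ω ξ)
    (hpos : 0 < Function.minimalPeriod (EnhPerc.nxt ω) ξ) :
    3 ≤ Function.minimalPeriod (EnhPerc.nxt ω) ξ := by
  have hk := Function.iterate_minimalPeriod (f := EnhPerc.nxt ω) (x := ξ)
  by_contra hc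
  have : Function.minimalPeriod (EnhPerc.nxt ω) ξ = 1 ∨
    Function.minimalPeriod (EnhPerc.nxt ω) ξ = 2 := by omega
  rcases this with e | e <;> rw [e] at hk
  · exact h.nxt_ne hk
  · exact h.nxt_nxt_ne hk

/-- A closed walk without repetitions that follows an injective map in one direction or the other at
each step keeps the direction. -/
theorem getVert_eq_iterate {V : Type*} {G : SimpleGraph V} {g : V → V}
    (hg : Function.Injective g) (hG : ∀ x y, G.Adj x y → y = g x ∨ x = g y) {v : V}
    {w : G.Walk v v} (hw : w.IsCycle) (h1 : w.getVert 1 = g v) :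
    (∀ i ≤ w.length, w.getVert i = g^[i] v) ∧ w.length = Function.minimalPeriod g v := by
  have h3 := hw.three_le_length
  have key : ∀ i, i + 1 ≤ w.length → w.getVert i = g^[i] v ∧ w.getVert (i + 1) = g^[i + 1] v := by
    intro i
    induction i with
    | zero => exact fun _ => ⟨w.getVert_zero, h1⟩
    | succ i ih =>
      intro hi
      obtain ⟨e1, e2⟩ := ih (by omega)
      refine ⟨e2, ?_⟩
      rcases hG _ _ (w.adj_getVert_succ (i := i + 1) (by omega)) with h | h
      · rw [h, e2, Function.iterate_succ_apply' g (i + 1)]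
      · exfalso
        have he : w.getVert i = w.getVert (i + 1 + 1) := by
          refine hg ?_
          rw [← h, e2, e1, Function.iterate_succ_apply']
        by_cases hlt : i + 2 < w.length
        · have := hw.getVert_injOn' (by rw [Set.mem_ofPred_eq]; omega)
            (by rw [Set.mem_ofPred_eq]; omega) he
          omega
        · have := hw.getVert_injOn (by rw [Set.mem_ofPred_eq]; omega)
            (by rw [Set.mem_ofPred_eq]; omega) he
          omega
  have hall : ∀ i ≤ w.length, w.getVert i = g^[i] v := by
    rintro (_ | i) hi
    · exact w.getVert_zero
    · exact (key i hi).2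
  refine ⟨hall, ?_⟩
  have hper : Function.IsPeriodicPt g w.length v := by
    have := hall _ le_rfl
    rw [SimpleGraph.Walk.getVert_length] at this
    exact this.symm
  have hle := hper.minimalPeriod_le (by omega)
  have hpos := hper.minimalPeriod_pos (by omega)
  refine le_antisymm (not_lt.1 fun hlt => ?_) hle
  have he : w.getVert (Function.minimalPeriod g v) = w.getVert 0 := by
    rw [hall _ hle, Function.iterate_minimalPeriod, w.getVert_zero]
  have := hw.getVert_injOn' (by rw [Set.mem_ofPred_eq]; omega)
    (by rw [Set.mem_ofPred_eq]; omega) he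
  omega

theorem Mixed.exists_walk (h : Mixed ω ξ) (n : ℕ) :
    ∃ w : (boundaryGraph ω).Walk ξ ((EnhPerc.nxt ω)^[n] ξ), w.length = n ∧
      ∀ i ≤ n, w.getVert i = (EnhPerc.nxt ω)^[i] ξ := by
  induction n generalizing ξ with
  | zero => exact ⟨SimpleGraph.Walk.nil, rfl, fun i hi => by
      obtain rfl : i = 0 := by omega
      rfl⟩
  | succ n ih =>
    obtain ⟨w, hw, hw'⟩ := ih h.nxt
    rw [Function.iterate_succ_apply]
    refine ⟨SimpleGraph.Walk.cons h.adj_nxt w, by simpa using hw, ?_⟩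
    rintro (_ | i) hi
    · simp
    · rw [SimpleGraph.Walk.getVert_cons_succ, hw' i (by omega), Function.iterate_succ_apply]

/-- Finite orbits of `nxt ω` are cycles of the boundary graph. -/
theorem Mixed.exists_isCycle (h : Mixed ω ξ)
    (hpos : 0 < Function.minimalPeriod (EnhPerc.nxt ω) ξ) :
    ∃ w : (boundaryGraph ω).Walk ξ ξ, w.IsCycle ∧
      w.length = Function.minimalPeriod (EnhPerc.nxt ω) ξ ∧
      ∀ i ≤ w.length, w.getVert i = (EnhPerc.nxt ω)^[i] ξ := by
  have h3 := h.three_le_minimalPeriod hpos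
  obtain ⟨k, hk⟩ : ∃ k, Function.minimalPeriod (EnhPerc.nxt ω) ξ = k + 1 :=
    ⟨Function.minimalPeriod (EnhPerc.nxt ω) ξ - 1, by omega⟩
  have hinj : ∀ i j, i < k + 1 → j < k + 1 → (EnhPerc.nxt ω)^[i] ξ = (EnhPerc.nxt ω)^[j] ξ →
      i = j := fun i j hi hj he =>
    Function.iterate_injOn_Iio_minimalPeriod (f := EnhPerc.nxt ω) (x := ξ)
      (Set.mem_Iio.2 (by omega)) (Set.mem_Iio.2 (by omega)) he
  have hper : (EnhPerc.nxt ω)^[k + 1] ξ = ξ := by rw [← hk]; exact Function.iterate_minimalPeriod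
  obtain ⟨p₀, hp₀, hp₀'⟩ := h.nxt.exists_walk k
  have hend : (EnhPerc.nxt ω)^[k] (EnhPerc.nxt ω ξ) = ξ := by
    rw [← Function.iterate_succ_apply, hper]
  obtain ⟨p, rfl, hp'⟩ : ∃ p : (boundaryGraph ω).Walk (EnhPerc.nxt ω ξ) ξ, p.length = k ∧
      ∀ i ≤ k, p.getVert i = (EnhPerc.nxt ω)^[i + 1] ξ :=
    ⟨p₀.copy rfl hend, by simpa using hp₀, fun i hi => by
      rw [SimpleGraph.Walk.getVert_copy, hp₀' i hi, Function.iterate_succ_apply]⟩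
  have hnot : ∀ i, 0 < i → i < p.length + 1 → (EnhPerc.nxt ω)^[i] ξ ≠ ξ := fun i h0 hi he =>
    h0.ne' (hinj i 0 hi (by omega) he)
  refine ⟨SimpleGraph.Walk.cons h.adj_nxt p, (SimpleGraph.Walk.cons_isCycle_iff _ _).2 ⟨?_, ?_⟩,
    by simpa using hk.symm, ?_⟩
  · refine (SimpleGraph.Walk.IsPath.getVert_injOn_iff p).1 fun i hi j hj he => ?_
    rw [Set.mem_ofPred_eq] at hi hj
    rw [hp' i hi, hp' j hj, Function.iterate_succ_apply', Function.iterate_succ_apply'] at he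
    exact hinj i j (by omega) (by omega) (nxt_injective ω he)
  · rw [SimpleGraph.Walk.mk_mem_edges_iff_exists]
    rintro ⟨i, hi, he⟩
    rw [hp' i hi.le, hp' (i + 1) hi, Sym2.eq_iff] at he
    rcases he with ⟨he, -⟩ | ⟨he, he'⟩
    · exact hnot (i + 1) (by omega) (by omega) he
    · have := hinj (i + 1) 1 (by omega) (by omega) he
      obtain rfl : i = 0 := by omega
      exact h.nxt_nxt_ne he'
  · rintro (_ | i) hi
    · simp
    · rw [SimpleGraph.Walk.length_cons] at hi
      rw [SimpleGraph.Walk.getVert_cons_succ, hp' i (by omega)]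

/-- The b-loop of step size `δ` through the mixed face `ξ`, with open sites on its left. -/
def loopCurve (δ : ℝ) (ω : Config) (ξ : DualSite) : Curve :=
  polyline (fun i => (δ : ℂ) * ((nxt ω)^[i] ξ).pos) (Function.minimalPeriod (nxt ω) ξ)

theorem polyline_congr {q q' : ℕ → ℂ} {k : ℕ} (h : ∀ i ≤ k, q i = q' i) :
    polyline q k = polyline q' k := by
  ext t
  change q 0 + _ = q' 0 + _
  rw [h 0 (Nat.zero_le k)]
  congr 1
  refine Finset.sum_congr rfl fun i hi => ?_
  have hi := Finset.mem_range.1 hi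
  rw [h i hi.le, h (i + 1) hi]

theorem loopCurve_mem_bLoops (h : Mixed ω ξ) (hpos : 0 < Function.minimalPeriod (nxt ω) ξ) :
    loopCurve δ ω ξ ∈ bLoops δ ω := by
  obtain ⟨w, hw, hlen, hv⟩ := h.exists_isCycle hpos
  refine ⟨ξ, w, hw, ?_⟩
  rw [loopCurve, ← hlen]
  exact polyline_congr fun i hi => by rw [hv i hi]

theorem exists_of_mem_bLoops {C : Curve} (hC : C ∈ bLoops δ ω) :
    ∃ ξ, Mixed ω ξ ∧ 0 < Function.minimalPeriod (nxt ω) ξ ∧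
      (C = loopCurve δ ω ξ ∨ C = (loopCurve δ ω ξ).reverse) := by
  obtain ⟨ξ, w, hw, rfl⟩ := hC
  have h3 := hw.three_le_length
  have hadj := w.adj_getVert_succ (i := 0) (by omega)
  rw [w.getVert_zero, zero_add] at hadj
  have hm := (mixed_of_adj hadj).1
  have hG : ∀ x y, (boundaryGraph ω).Adj x y → y = nxt ω x ∨ x = nxt ω y := fun x y h =>
    (mixed_of_adj h).2
  rcases hG _ _ hadj with h1 | h1
  · obtain ⟨hv, hlen⟩ := getVert_eq_iterate (nxt_injective ω) hG hw h1
    refine ⟨ξ, hm, by omega, Or.inl ?_⟩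
    rw [loopCurve, ← hlen]
    exact polyline_congr fun i hi => by rw [hv i hi]
  · have hG' : ∀ x y, (boundaryGraph ω).Adj x y → y = nxt ωᶜ x ∨ x = nxt ωᶜ y := by
      intro x y hxy
      rcases hG x y hxy with rfl | rfl
      · exact Or.inr (nxt_compl_nxt ω x).symm
      · exact Or.inl (nxt_compl_nxt ω y).symm
    obtain ⟨hv, hlen⟩ := getVert_eq_iterate (nxt_injective ωᶜ) hG' hw
      ((nxt_compl_nxt ω _).symm.trans (congrArg (nxt ωᶜ) h1.symm))
    have hback : ∀ i x, (nxt ωᶜ)^[i] ((nxt ω)^[i] x) = x := fun i x =>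
      (Function.LeftInverse.iterate (nxt_compl_nxt ω) i) x
    have hforth : ∀ i x, (nxt ω)^[i] ((nxt ωᶜ)^[i] x) = x := fun i x =>
      (Function.LeftInverse.iterate (fun y => by
        have := nxt_compl_nxt ωᶜ y
        rwa [compl_compl] at this) i) x
    have hper : Function.minimalPeriod (nxt ω) ξ = w.length := by
      rw [hlen]
      refine Function.minimalPeriod_eq_minimalPeriod_iff.2 fun n => ⟨fun h => ?_, fun h => ?_⟩
      · have := hback n ξ
        rwa [h] at this
      · have := hforth n ξ
        rwa [h] at this
    refine ⟨ξ, hm, by omega, Or.inr ?_⟩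
    rw [loopCurve, hper]
    refine polyline_reverse fun i hi => ?_
    have h2 : (nxt ω)^[w.length - i] ξ = w.getVert i := by
      have h4 := hforth (w.length - i) ((nxt ωᶜ)^[i] ξ)
      rw [← Function.iterate_add_apply, Nat.sub_add_cancel hi, hlen,
        Function.iterate_minimalPeriod, ← hlen] at h4
      rw [hv i hi, h4]
    rw [h2]

/-! ### Positions in the plane -/

theorem norm_pos_sub_le (x y : Site) : ‖x.pos - y.pos‖ ≤ 3 * rad x y := by
  have h1 : |(y.1 : ℝ) - x.1| ≤ rad x y := by
    have : |y.1 - x.1| ≤ rad x y := le_max_left _ _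
    exact_mod_cast this
  have h2 : |(y.2 : ℝ) - x.2| ≤ rad x y := by
    have : |y.2 - x.2| ≤ rad x y := le_max_right _ _
    exact_mod_cast this
  have h3 : √3 ≤ 2 := Real.sqrt_le_iff.2 ⟨by norm_num, by norm_num⟩
  refine (Complex.norm_le_abs_re_add_abs_im _).trans ?_
  simp only [Site.pos, Complex.sub_re, Complex.sub_im]
  have e1 : |(x.1 : ℝ) + x.2 / 2 - (y.1 + y.2 / 2)| ≤ rad x y + rad x y / 2 := by
    rw [abs_le] at h1 h2 ⊢
    constructor <;> linarith
  have e2 : |√3 / 2 * (x.2 : ℝ) - √3 / 2 * y.2| ≤ rad x y := by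
    rw [← mul_sub, abs_mul, abs_of_nonneg (by positivity), abs_sub_comm]
    calc √3 / 2 * |(y.2 : ℝ) - x.2| ≤ 1 * |(y.2 : ℝ) - x.2| := by
          gcongr; linarith
      _ ≤ rad x y := by linarith
  have : (0 : ℝ) ≤ rad x y := by exact_mod_cast rad_nonneg x y
  linarith

theorem rad_zero_le_norm (x : Site) : (rad 0 x : ℝ) ≤ 2 * ‖x.pos‖ := by
  have h1 := Complex.abs_re_le_norm x.pos
  have h2 := Complex.abs_im_le_norm x.pos
  simp only [Site.pos] at h1 h2
  have h3 : (1.7 : ℝ) ≤ √3 := Real.le_sqrt_of_sq_le (by norm_num)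
  rw [abs_mul, abs_of_nonneg (by positivity)] at h2
  change _ ≤ 2 * ‖Site.pos x‖
  set n := ‖Site.pos x‖
  have h4 : |(x.2 : ℝ)| ≤ 1.2 * n := by
    have : (0 : ℝ) ≤ |(x.2 : ℝ)| := abs_nonneg _
    have : 1.7 / 2 * |(x.2 : ℝ)| ≤ √3 / 2 * |(x.2 : ℝ)| := by gcongr
    change √3 / 2 * |(x.2 : ℝ)| ≤ n at h2
    linarith
  change |(x.1 : ℝ) + x.2 / 2| ≤ n at h1
  have h5 : |(x.1 : ℝ)| ≤ 2 * n := by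
    rw [abs_le] at h1 h4 ⊢
    constructor <;> linarith
  have h0 : 0 ≤ n := norm_nonneg _
  have e : (rad 0 x : ℝ) = max |(x.1 : ℝ)| |(x.2 : ℝ)| := by simp [rad]
  rw [e]
  exact max_le h5 (by linarith)

theorem sum_vertices (ξ : DualSite) (f : Site → ℂ) : ∑ x ∈ ξ.vertices, f x = ∑ i, f (vtx ξ i) := by
  rcases ξ with ⟨⟨a, b⟩, _ | _⟩
  · rw [DualSite.vertices, Finset.sum_insert (by simp), Finset.sum_insert (by simp),
      Finset.sum_singleton, Fin.sum_univ_three]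
    simp only [vtx, Matrix.cons_val_zero, Matrix.cons_val_one, Matrix.cons_val]
    ring
  · rw [DualSite.vertices, Finset.sum_insert (by simp), Finset.sum_insert (by simp),
      Finset.sum_singleton, Fin.sum_univ_three]
    simp only [vtx, Matrix.cons_val_zero, Matrix.cons_val_one, Matrix.cons_val]
    ring

theorem norm_dualPos_sub_le (ξ : DualSite) (x : Site) : ‖ξ.pos - x.pos‖ ≤ 3 * rad ξ.1 x + 3 := by
  have e : ξ.pos - x.pos = (∑ i, ((vtx ξ i).pos - x.pos)) / 3 := by
    rw [DualSite.pos, sum_vertices, Finset.sum_sub_distrib]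
    simp
    ring
  have h : ∀ i, ‖(vtx ξ i).pos - x.pos‖ ≤ 3 * rad ξ.1 x + 3 := by
    intro i
    have h1 := rad_triangle (vtx ξ i) ξ.1 x
    have h2 := rad_vtx ξ i
    rw [rad_comm] at h2
    have h3 : (rad (vtx ξ i) x : ℝ) ≤ rad ξ.1 x + 1 := by
      have : rad (vtx ξ i) x ≤ rad ξ.1 x + 1 := by omega
      exact_mod_cast this
    have := norm_pos_sub_le (vtx ξ i) x
    linarith
  rw [e, norm_div, Complex.norm_ofNat, div_le_iff₀ (by norm_num)]
  refine (norm_sum_le _ _).trans ?_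
  rw [Fin.sum_univ_three]
  linarith [h 0, h 1, h 2]

theorem norm_dualPos_sub_dualPos_le (ξ ζ : DualSite) :
    ‖ξ.pos - ζ.pos‖ ≤ 3 * rad ξ.1 ζ.1 + 6 := by
  have h1 := norm_dualPos_sub_le ξ ζ.1
  have h2 := norm_dualPos_sub_le ζ ζ.1
  rw [rad_self, norm_sub_rev] at h2
  have h3 := norm_sub_le_norm_sub_add_norm_sub ξ.pos ζ.1.pos ζ.pos
  push_cast at h2
  linarith

end

section

/-! ### Small loops near isolated open sites -/

variable {φ : Config → Config} {R : ℤ} {ω α : Config}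

/-- The site `c` is the only open site in the box of radius two around it. -/
def Isolated (ω : Config) (c : Site) : Prop := ∀ y, rad c y ≤ 2 → (y ∈ ω ↔ y = c)

/-- Near every site there is an isolated open site, at a distance which is negligible with respect
to the distance to the origin. -/
def DenselyIsolated (ω : Config) : Prop :=
  ∀ η : ℝ, 0 < η → ∃ r : ℤ, ∀ x, r ≤ rad 0 x → ∃ c, Isolated ω c ∧ (rad x c : ℝ) ≤ η * rad 0 x

/-- An isolated open site is surrounded by a loop. -/
theorem Isolated.exists_loop {c : Site} (h : Isolated ω c) :
    ∃ ξ, Mixed ω ξ ∧ 0 < Function.minimalPeriod (nxt ω) ξ ∧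
      ∀ t, rad c ((nxt ω)^[t] ξ).1 ≤ 1 := by
  have hm : Mixed {c} (c, true) := ⟨2, by simp [vtx, Prod.ext_iff], by simp [vtx]⟩
  have hrad : ∀ t, rad c ((nxt {c})^[t] (c, true)).1 ≤ 1 := by
    intro t
    have h1 : opn {c} ((nxt {c})^[t] (c, true)) = c := (hm.iterate t).opn_mem
    have h2 := rad_opn {c} ((nxt {c})^[t] (c, true))
    rwa [h1, rad_comm] at h2
  have e := iterate_nxt_congr (ω := {c}) (ω' := ω) (ξ := (c, true)) (c := c) (N := 2)
    (fun y hy => (h y hy).symm) fun t => by have := hrad t; omega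
  refine ⟨(c, true), (mixed_congr fun y hy => ?_).1 hm, ?_, fun t => e t ▸ hrad t⟩
  · exact (h y (by dsimp only at hy; omega)).symm
  · rw [← minimalPeriod_nxt_congr e]
    exact minimalPeriod_pos (Set.finite_singleton c) _

theorem norm_loopCurve_sub_le {δ : ℝ} (hδ : 0 ≤ δ) {ξ : DualSite}
    (hpos : 0 < Function.minimalPeriod (nxt ω) ξ) {c : Site} {n : ℤ}
    (h : ∀ t, rad c ((nxt ω)^[t] ξ).1 ≤ n) (t : unitInterval) :
    ‖loopCurve δ ω ξ t - δ * c.pos‖ ≤ δ * (3 * n + 3) := by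
  refine norm_polyline_sub_le hpos (fun i _ => ?_) t
  rw [← mul_sub, norm_mul, Complex.norm_real, Real.norm_of_nonneg hδ]
  refine mul_le_mul_of_nonneg_left ((norm_dualPos_sub_le _ _).trans ?_) hδ
  have h1 := h i
  rw [rad_comm] at h1
  have : (rad ((nxt ω)^[i] ξ).1 c : ℝ) ≤ n := by exact_mod_cast h1
  linarith

theorem norm_segment_sub_le {u v z : ℂ} {r : ℝ} (hu : ‖u - z‖ ≤ r) (hv : ‖v - z‖ ≤ r) {t : ℝ}
    (ht : t ∈ Set.Icc (0 : ℝ) 1) : ‖u + t • (v - u) - z‖ ≤ r := by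
  have e : u + t • (v - u) - z = (1 - t) • (u - z) + t • (v - z) := by module
  rw [e]
  refine (norm_add_le _ _).trans ?_
  rw [norm_smul, norm_smul, Real.norm_of_nonneg ht.1, Real.norm_of_nonneg (sub_nonneg.2 ht.2)]
  have := mul_le_mul_of_nonneg_left hu (sub_nonneg.2 ht.2)
  have := mul_le_mul_of_nonneg_left hv ht.1
  linarith

/-- Far from the origin, the metric `sphereDist` is so small that a distance of `η ρ` lattice units
at distance `ρ` from the origin is short, uniformly in the mesh. -/
theorem sphereDist_le_of_far {u v z : ℂ} {δ ρ a η : ℝ} (hδ : 0 ≤ δ) (hρ : 0 ≤ ρ) (ha : 0 ≤ a)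
    (hη : 0 ≤ η) (hz : δ * (ρ / 2) ≤ ‖z‖) (hu : ‖u - z‖ ≤ δ * (a + 3 * (η * ρ)))
    (hv : ‖v - z‖ ≤ δ * (a + 3 * (η * ρ))) (huv : ‖v - u‖ ≤ δ * (a + 3 * (η * ρ)))
    (haρ : a ≤ ρ / 8) (hη' : η ≤ 1 / 24) : sphereDist u v ≤ δ * a + 6 * η := by
  have hδρ : 0 ≤ δ * ρ := mul_nonneg hδ hρ
  have hpos : 0 < 1 + (δ * ρ / 4) ^ 2 := by positivity
  refine (sphereDist_le (c := (1 + (δ * ρ / 4) ^ 2)⁻¹) fun t ht => ?_).trans ?_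
  · refine inv_anti₀ hpos (add_le_add le_rfl (pow_le_pow_left₀ (by positivity) ?_ 2))
    have h1 := norm_segment_sub_le hu hv ht
    have h2 : ‖z‖ ≤ ‖u + t • (v - u)‖ + ‖u + t • (v - u) - z‖ := by
      have := norm_sub_le (u + t • (v - u)) (u + t • (v - u) - z)
      rwa [sub_sub_cancel] at this
    have h3 : δ * (a + 3 * (η * ρ)) ≤ δ * (ρ / 4) := by
      refine mul_le_mul_of_nonneg_left ?_ hδ
      have := mul_le_mul_of_nonneg_right hη' hρ
      linarith
    linarith
  · rw [inv_mul_le_iff₀ hpos]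
    refine huv.trans ?_
    have h1 : 0 ≤ δ * a * (δ * ρ / 4) ^ 2 := by positivity
    have h2 : 0 ≤ 6 * η * (δ * ρ / 4 - 1) ^ 2 := by positivity
    nlinarith

/-- Small loops of any configuration are close to loops of a configuration with densely spread
isolated open sites. -/
theorem DenselyIsolated.eventually_small {T : Config} (hT : DenselyIsolated T) {L : ℤ} (hL : 0 ≤ L)
    {ε : ℝ} (hε : 0 < ε) : ∀ᶠ δ : ℝ in 𝓝[>] 0, ∀ (S : Config) (ζ : DualSite),
      0 < Function.minimalPeriod (nxt S) ζ → (∀ t, rad ζ.1 ((nxt S)^[t] ζ).1 ≤ L) →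
      ∃ ξ, Mixed T ξ ∧ 0 < Function.minimalPeriod (nxt T) ξ ∧
        curveDist (loopCurve δ S ζ) (loopCurve δ T ξ) ≤ ENNReal.ofReal ε := by
  have hL' : (0 : ℝ) ≤ L := by exact_mod_cast hL
  set η : ℝ := min (1 / 24) (ε / 12) with hη
  have hη0 : 0 < η := by positivity
  obtain ⟨r₀, hr₀⟩ := hT η hη0
  set r : ℤ := max r₀ (8 * (3 * L + 9)) with hr
  have hr0 : 0 ≤ r := by omega
  have hrad : rad 0 (r, 0) = r := by simp [rad, abs_of_nonneg hr0, hr0]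
  obtain ⟨c₀, hc₀, -⟩ := hr₀ (r, 0) (by omega)
  have hr' : (0 : ℝ) ≤ r := by exact_mod_cast hr0
  have hρ₀ : (0 : ℝ) ≤ rad 0 c₀ := by exact_mod_cast rad_nonneg 0 c₀
  set K : ℝ := 3 * L + 9 + 3 * (r + rad 0 c₀) with hK
  have hK0 : 0 < K := by positivity
  have hev : ∀ᶠ δ : ℝ in 𝓝[>] 0, δ < ε / (2 * K) :=
    mem_nhdsWithin_of_mem_nhds (Iio_mem_nhds (by positivity))
  filter_upwards [hev, self_mem_nhdsWithin] with δ hδK hδ S ζ hpos hsmall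
  have hδ : 0 < δ := hδ
  have hδK' : δ * K ≤ ε / 2 := by
    rw [lt_div_iff₀ (by positivity)] at hδK
    linarith
  have hpair : ∀ c ξ, 0 < Function.minimalPeriod (nxt T) ξ →
      (∀ t, rad c ((nxt T)^[t] ξ).1 ≤ 1) → ∀ t t',
      ‖loopCurve δ S ζ t - δ * ζ.1.pos‖ ≤ δ * (3 * L + 9 + 3 * rad ζ.1 c) ∧
      ‖loopCurve δ T ξ t' - δ * ζ.1.pos‖ ≤ δ * (3 * L + 9 + 3 * rad ζ.1 c) ∧
      ‖loopCurve δ T ξ t' - loopCurve δ S ζ t‖ ≤ δ * (3 * L + 9 + 3 * rad ζ.1 c) := by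
    intro c ξ hξ hξc t t'
    have h1 := norm_loopCurve_sub_le hδ.le hpos hsmall t
    have h2 := norm_loopCurve_sub_le hδ.le hξ hξc t'
    have h3 : ‖(δ : ℂ) * c.pos - δ * ζ.1.pos‖ ≤ δ * (3 * rad ζ.1 c) := by
      rw [← mul_sub, norm_mul, Complex.norm_real, Real.norm_of_nonneg hδ.le, rad_comm]
      exact mul_le_mul_of_nonneg_left (norm_pos_sub_le _ _) hδ.le
    have h4 := norm_sub_le_norm_sub_add_norm_sub (loopCurve δ T ξ t') (δ * c.pos) (δ * ζ.1.pos)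
    have h5 := norm_sub_le_norm_sub_add_norm_sub (loopCurve δ T ξ t') (δ * ζ.1.pos)
      (loopCurve δ S ζ t)
    rw [norm_sub_rev (δ * ζ.1.pos) (loopCurve δ S ζ t)] at h5
    have h6 : (0 : ℝ) ≤ rad ζ.1 c := by exact_mod_cast rad_nonneg _ _
    have h7 : 0 ≤ δ * rad ζ.1 c := by positivity
    have h8 : 0 ≤ δ * L := by positivity
    push_cast at h2
    refine ⟨by linarith, by linarith, by linarith⟩
  -- Far from the origin there is an isolated site close enough in the metric `sphereDist`; near the
  -- origin the fixed isolated site `c₀` will do, as the mesh is small.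
  by_cases hfar : r ≤ rad 0 ζ.1
  · obtain ⟨c, hc, hcη⟩ := hr₀ ζ.1 (by omega)
    obtain ⟨ξ, hξ, hξpos, hξc⟩ := hc.exists_loop
    refine ⟨ξ, hξ, hξpos, curveDist_le fun t t' => ?_⟩
    obtain ⟨h1, h2, h3⟩ := hpair c ξ hξpos hξc t t'
    have hle : δ * (3 * L + 9 + 3 * rad ζ.1 c) ≤ δ * (3 * L + 9 + 3 * (η * rad 0 ζ.1)) := by
      gcongr
    have hρ : (8 * (3 * L + 9) : ℝ) ≤ rad 0 ζ.1 := by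
      have : 8 * (3 * L + 9) ≤ rad 0 ζ.1 := by omega
      exact_mod_cast this
    have hz : δ * ((rad 0 ζ.1 : ℝ) / 2) ≤ ‖(δ : ℂ) * ζ.1.pos‖ := by
      rw [norm_mul, Complex.norm_real, Real.norm_of_nonneg hδ.le]
      have := rad_zero_le_norm ζ.1
      gcongr
      linarith
    refine (sphereDist_le_of_far (z := δ * ζ.1.pos) (ρ := rad 0 ζ.1) (a := 3 * L + 9) (η := η)
      hδ.le (by linarith) (by linarith) hη0.le hz (h1.trans hle) (h2.trans hle) (h3.trans hle)
      (by linarith) (min_le_left _ _)).trans ?_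
    have h4 : η ≤ ε / 12 := min_le_right _ _
    have h5 : δ * (3 * L + 9) ≤ δ * K := by
      gcongr
      linarith
    linarith
  · obtain ⟨ξ, hξ, hξpos, hξc⟩ := hc₀.exists_loop
    refine ⟨ξ, hξ, hξpos, curveDist_le fun t t' => (sphereDist_le_norm _ _).trans ?_⟩
    obtain ⟨-, -, h3⟩ := hpair c₀ ξ hξpos hξc t t'
    rw [norm_sub_rev]
    refine h3.trans ?_
    have h4 : (rad ζ.1 c₀ : ℝ) ≤ r + rad 0 c₀ := by
      have := rad_triangle ζ.1 0 c₀
      rw [rad_comm ζ.1 0] at this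
      have : rad ζ.1 c₀ ≤ r + rad 0 c₀ := by omega
      exact_mod_cast this
    have h5 : δ * (3 * L + 9 + 3 * rad ζ.1 c₀) ≤ δ * K := by
      gcongr
      linarith
    linarith

/-! ### Comparison of the two collections of loops -/

/-- If the large loops of `S` are coupled with loops of `T` within a fixed number of lattice units,
and isolated open sites are densely spread in `T`, then all loops of `S` are close to loops
of `T`. -/
theorem DenselyIsolated.eventually_forall_bLoops {S T : Config} (hT : DenselyIsolated T) {K L : ℤ}
    (hK : 0 ≤ K) (hL : 0 ≤ L)
    (hST : ∀ ζ, Mixed S ζ → 0 < Function.minimalPeriod (nxt S) ζ →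
      ∀ t, L < rad ζ.1 ((nxt S)^[t] ζ).1 → ∃ s, Mixed T s ∧ 0 < Function.minimalPeriod (nxt T) s ∧
        Stair (fun a b => rad ((nxt S)^[a] ζ).1 ((nxt T)^[b] s).1 ≤ K) (0, 0)
          (Function.minimalPeriod (nxt S) ζ, Function.minimalPeriod (nxt T) s))
    {ε : ℝ} (hε : 0 < ε) : ∀ᶠ δ : ℝ in 𝓝[>] 0, ∀ C ∈ bLoops δ S, ∃ C' ∈ bLoops δ T,
      curveDist C C' ≤ ENNReal.ofReal ε := by
  have hK' : (0 : ℝ) ≤ K := by exact_mod_cast hK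
  have hev : ∀ᶠ δ : ℝ in 𝓝[>] 0, δ < ε / (3 * K + 6) :=
    mem_nhdsWithin_of_mem_nhds (Iio_mem_nhds (by positivity))
  filter_upwards [hT.eventually_small hL hε, hev, self_mem_nhdsWithin] with δ hsmall hδK hδ C hC
  have hδ : 0 < δ := hδ
  obtain ⟨ζ, hζ, hpos, hCζ⟩ := exists_of_mem_bLoops hC
  obtain ⟨ξ, hξ, hξpos, hle⟩ : ∃ ξ, Mixed T ξ ∧ 0 < Function.minimalPeriod (nxt T) ξ ∧
      curveDist (loopCurve δ S ζ) (loopCurve δ T ξ) ≤ ENNReal.ofReal ε := by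
    by_cases hfar : ∃ t, L < rad ζ.1 ((nxt S)^[t] ζ).1
    · obtain ⟨t, ht⟩ := hfar
      obtain ⟨s, hs, hspos, hst⟩ := hST ζ hζ hpos t ht
      refine ⟨s, hs, hspos,
        curveDist_polyline_le hpos hspos (Relation.ReflTransGen.mono ?_ _ _ hst)⟩
      have key : ∀ a b, rad ((nxt S)^[a] ζ).1 ((nxt T)^[b] s).1 ≤ K →
          ‖(δ : ℂ) * ((nxt S)^[a] ζ).pos - δ * ((nxt T)^[b] s).pos‖ ≤ ε := by
        intro a b hab
        rw [← mul_sub, norm_mul, Complex.norm_real, Real.norm_of_nonneg hδ.le]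
        have h1 := norm_dualPos_sub_dualPos_le ((nxt S)^[a] ζ) ((nxt T)^[b] s)
        have h2 : (rad ((nxt S)^[a] ζ).1 ((nxt T)^[b] s).1 : ℝ) ≤ K := by exact_mod_cast hab
        rw [lt_div_iff₀ (by positivity)] at hδK
        exact (mul_le_mul_of_nonneg_left (h1.trans (by linarith)) hδ.le).trans hδK.le
      rintro p q ⟨h1, h2, h3⟩
      exact ⟨key _ _ h1, key _ _ h2, h3⟩
    · exact hsmall S ζ hpos fun t => not_lt.1 fun ht => hfar ⟨t, ht⟩
  refine ⟨_, loopCurve_mem_bLoops hξ hξpos, ?_⟩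
  rcases hCζ with rfl | rfl
  · exact hle
  · exact (curveDist_reverse_le _ _).trans hle

/-- Deterministic criterion for the convergence: the loops that are large on the lattice scale are
coupled, and the small ones are close to loops around isolated sites. -/
theorem tendsto_loopDist_of_denselyIsolated (h : Admissible φ R) (hω : DenselyIsolated ω)
    (hE : DenselyIsolated (enhanced φ ω α)) :
    Tendsto (fun δ : ℝ => loopDist (bLoops δ ω) (bLoops δ (enhanced φ ω α))) (𝓝[>] 0) (𝓝 0) := by
  have hR := h.nonneg
  rw [ENNReal.tendsto_nhds_zero]
  intro ε hε
  rcases eq_or_ne ε ⊤ with rfl | hε'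
  · exact Eventually.of_forall fun _ => le_top
  have hε0 : 0 < ε.toReal := ENNReal.toReal_pos hε.ne' hε'
  filter_upwards [hE.eventually_forall_bLoops (S := ω) (K := 16 * R + 26) (L := 20 * R + 30)
    (by omega) (by omega) (fun ζ hζ hpos t ht => h.exists_stair hζ hpos ht) hε0,
    hω.eventually_forall_bLoops (S := enhanced φ ω α) (K := 16 * R + 26) (L := 20 * R + 30)
    (by omega) (by omega) (fun ζ hζ hpos t ht => h.exists_stair_enhanced hζ hpos ht) hε0]
    with δ h1 h2
  rw [ENNReal.ofReal_toReal hε'] at h1 h2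
  refine sInf_le ⟨h1, fun C' hC' => ?_⟩
  obtain ⟨C, hC, hle⟩ := h2 C' hC'
  exact ⟨C, hC, curveDist_comm C C' ▸ hle⟩

end

section

/-! ### Isolated sites survive the enhancement -/

variable {φ : Config → Config} {R : ℤ} {ω α : Config}

/-- The only open site in the box of radius `2 R + 4` around `c` is `c` itself. -/
def Pattern (R : ℤ) (ω : Config) (c : Site) : Prop := ∀ y, rad c y ≤ 2 * R + 4 → (y ∈ ω ↔ y = c)

theorem Pattern.isolated (hR : 0 ≤ R) {c : Site} (h : Pattern R ω c) : Isolated ω c :=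
  fun y hy => h y (by omega)

theorem isInducedPath_horizontal {S : Set Site} (a b : ℤ) (m : ℕ)
    (h : ∀ i : ℕ, i ≤ m → (a + i, b) ∈ S) : IsInducedPath S m fun i => (a + i, b) := by
  refine ⟨h, fun i _ => ?_, fun i j hij _ => ?_, fun i j hij _ => ?_⟩
  · rw [adj_iff]; left; push_cast; exact ⟨by ring, rfl⟩
  · rw [adj_iff]; simp only; omega
  · simp only [ne_eq, Prod.mk.injEq]; omega

theorem isInducedPath_vertical {S : Set Site} (a b : ℤ) (m : ℕ)
    (h : ∀ i : ℕ, i ≤ m → (a, b + i) ∈ S) : IsInducedPath S m fun i => (a, b + i) := by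
  refine ⟨h, fun i _ => ?_, fun i j hij _ => ?_, fun i j hij _ => ?_⟩
  · rw [adj_iff]; right; right; left; push_cast; exact ⟨rfl, by ring⟩
  · rw [adj_iff]; simp only; omega
  · simp only [ne_eq, Prod.mk.injEq]; omega

/-- The straight closed lines near an isolated open site are not touched by the enhancement. -/
theorem Pattern.isolated_enhanced (h : Admissible φ R) {c : Site} (hc : Pattern R ω c) :
    Isolated (enhanced φ ω α) c := by
  have hR := h.nonneg
  intro y hy
  constructor
  · intro hyE
    by_contra hyc
    have hyω : y ∉ ω := fun hyω => hyc ((hc y (by omega)).1 hyω)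
    obtain ⟨x, -, hx⟩ := (mem_enhanced_iff.1 hyE).resolve_left hyω
    have h1 := rad_le_iff.1 (h.rad_le hx)
    have h2 := rad_le_iff.1 hy
    by_cases h3 : y.2 = c.2
    · have h4 : y.1 ≠ c.1 := fun h4 => hyc (Prod.ext h4 h3)
      have hη := isInducedPath_vertical (S := ωᶜ) y.1 (c.2 - (2 * R + 4)) (2 * (2 * R + 4)).toNat
        fun i hi hiω => by
          have he := (hc (y.1, c.2 - (2 * R + 4) + i) (rad_le_iff.2 (by simp only; omega))).1 hiω
          exact h4 (Prod.ext_iff.1 he).1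
      refine h.notMem_enhanceAt hη (x := x) (k := (y.2 - (c.2 - (2 * R + 4))).toNat)
        (lt_rad_iff.2 ?_) (lt_rad_iff.2 ?_) (by omega) ?_
      · simp only; omega
      · simp only; omega
      · have : (y.1, c.2 - (2 * R + 4) + ((y.2 - (c.2 - (2 * R + 4))).toNat : ℤ)) = y := by
          ext
          · rfl
          · simp only; omega
        rwa [this]
    · have hη := isInducedPath_horizontal (S := ωᶜ) (c.1 - (2 * R + 4)) y.2 (2 * (2 * R + 4)).toNat
        fun i hi hiω => by
          have he := (hc (c.1 - (2 * R + 4) + i, y.2) (rad_le_iff.2 (by simp only; omega))).1 hiω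
          exact h3 (Prod.ext_iff.1 he).2
      refine h.notMem_enhanceAt hη (x := x) (k := (y.1 - (c.1 - (2 * R + 4))).toNat)
        (lt_rad_iff.2 ?_) (lt_rad_iff.2 ?_) (by omega) ?_
      · simp only; omega
      · simp only; omega
      · have : (c.1 - (2 * R + 4) + ((y.1 - (c.1 - (2 * R + 4))).toNat : ℤ), y.2) = y := by
          ext
          · simp only; omega
          · rfl
        rwa [this]
  · rintro rfl
    exact subset_enhanced ((hc y (by omega)).2 rfl)

end

/-! ### Almost surely, isolated sites are densely spread -/

/-- The event `E` is determined by the states of the sites in `S`. -/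
def DependsOnSites (E : Set Config) (S : Finset Site) : Prop :=
  ∀ ω ω' : Config, (∀ x ∈ S, x ∈ ω ↔ x ∈ ω') → ω ∈ E → ω' ∈ E

/-- Events determined by disjoint finite sets of sites are independent. -/
theorem siteMeasure_inter {p : unitInterval} {E E' : Set Config} {S T : Finset Site}
    (hE : DependsOnSites E S) (hE' : DependsOnSites E' T) (hST : Disjoint S T) :
    siteMeasure p (E ∩ E') = siteMeasure p E * siteMeasure p E' := by
  have hind := (iIndepFun_infinitePi (P := fun i : Site =>
    unitInterval.toNNReal p • Measure.dirac (i ∈ (Set.univ : Set Site)) +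
      unitInterval.toNNReal (unitInterval.symm p) • Measure.dirac False)
    (X := fun _ t => t) fun _ => measurable_id).indepFun_finset S T hST
      fun i => measurable_pi_apply i
  have key : ∀ (E : Set Config) (S : Finset Site), DependsOnSites E S →
      ((fun t : Site → Prop => {i | t i}) ⁻¹' E) =
        (fun (t : Site → Prop) (i : S) => t i) ⁻¹'
          {u | ∃ ω ∈ E, ∀ i : S, u i ↔ (i : Site) ∈ ω} := by
    intro E S hE
    ext t
    constructor
    · intro ht
      exact ⟨_, ht, fun i => Iff.rfl⟩
    · rintro ⟨ω, hω, h⟩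
      exact hE ω _ (fun x hx => (h ⟨x, hx⟩).symm) hω
  rw [setBernoulli_apply', setBernoulli_apply', setBernoulli_apply', Set.preimage_inter,
    key E S hE, key E' T hE']
  exact hind.measure_inter_preimage_eq_mul _ _ (Set.toFinite _).measurableSet
    (Set.toFinite _).measurableSet

/-- The box of radius `n` around `c`. -/
def box (c : Site) (n : ℤ) : Finset Site :=
  (Finset.Icc ((-n, -n) : Site) (n, n)).map (addLeftEmbedding c)

theorem mem_box {c y : Site} {n : ℤ} : y ∈ box c n ↔ rad c y ≤ n := by
  simp only [box, Finset.mem_map, Finset.mem_Icc, addLeftEmbedding_apply, rad_le_iff]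
  constructor
  · rintro ⟨z, ⟨⟨h1, h2⟩, h3, h4⟩, rfl⟩
    simp only [Prod.fst_add, Prod.snd_add] at *
    omega
  · rintro ⟨h1, h2, h3, h4⟩
    refine ⟨y - c, ⟨⟨?_, ?_⟩, ?_, ?_⟩, by abel⟩ <;> simp only [Prod.fst_sub, Prod.snd_sub] <;> omega

/-- A pattern prescribes the states of a fixed number of sites. -/
theorem le_siteMeasure_pattern {p : unitInterval} (R : ℤ) (c : Site) :
    (min (unitInterval.toNNReal p : ℝ≥0∞) (unitInterval.toNNReal (unitInterval.symm p))) ^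
      (Finset.Icc ((-(2 * R + 4), -(2 * R + 4)) : Site) (2 * R + 4, 2 * R + 4)).card ≤
      siteMeasure p {ω | Pattern R ω c} := by
  classical
  have e : ((fun t : Site → Prop => {i | t i}) ⁻¹' {ω | Pattern R ω c}) =
      Set.pi (box c (2 * R + 4)) fun y => {q : Prop | q ↔ y = c} := by
    ext t
    simp only [Set.mem_preimage, Set.mem_ofPred_eq, Pattern, Set.mem_pi, Finset.mem_coe, mem_box]
  rw [setBernoulli_apply', e, Measure.infinitePi_pi _ fun _ _ => (Set.toFinite _).measurableSet,
    ← Finset.card_map (addLeftEmbedding c)]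
  refine Finset.pow_card_le_prod _ _ _ fun y _ => ?_
  by_cases hy : y = c
  · refine (min_le_left _ _).trans ?_
    simp [hy]
  · refine (min_le_right _ _).trans ?_
    simp [hy]

theorem measurableSet_pattern (R : ℤ) (c : Site) : MeasurableSet {ω | Pattern R ω c} := by
  simp only [Pattern, measurableSet_setOfPred]
  exact Measurable.forall fun y =>
    measurable_const.imp ((measurable_set_mem y).iff measurable_const)

/-- A bound, uniform in the position, for the probability of the absence of a pattern. -/
theorem exists_siteMeasure_not_pattern_le {p : unitInterval} (hp0 : p ≠ 0) (hp1 : p ≠ 1) (R : ℤ) :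
    ∃ θ : ℝ, 0 < θ ∧ θ < 1 ∧ ∀ c, siteMeasure p {ω | ¬ Pattern R ω c} ≤ ENNReal.ofReal θ := by
  set b : ℝ≥0∞ := min (unitInterval.toNNReal p : ℝ≥0∞) (unitInterval.toNNReal (unitInterval.symm p))
    with hb
  set n := (Finset.Icc ((-(2 * R + 4), -(2 * R + 4)) : Site) (2 * R + 4, 2 * R + 4)).card with hn
  have hb0 : b ≠ 0 := by
    have h1 : unitInterval.toNNReal p ≠ 0 := fun h => hp0 (by
      ext; exact congrArg NNReal.toReal h)
    have h2 : unitInterval.toNNReal (unitInterval.symm p) ≠ 0 := fun h => hp1 (by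
      have h3 : 1 - (p : ℝ) = 0 := congrArg NNReal.toReal h
      ext
      exact (sub_eq_zero.1 h3).symm)
    rw [hb]
    exact (lt_min (by simpa [pos_iff_ne_zero] using h1) (by simpa [pos_iff_ne_zero] using h2)).ne'
  have hlt : (1 : ℝ≥0∞) - b ^ n < 1 :=
    ENNReal.sub_lt_self ENNReal.one_ne_top one_ne_zero (pow_ne_zero _ hb0)
  refine ⟨max (1 / 2) (1 - b ^ n).toReal, by positivity, max_lt (by norm_num) ?_, fun c => ?_⟩
  · have := (ENNReal.toReal_lt_toReal hlt.ne_top ENNReal.one_ne_top).2 hlt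
    simpa using this
  · have h1 : {ω | ¬ Pattern R ω c} = {ω | Pattern R ω c}ᶜ := rfl
    rw [h1, prob_compl_eq_one_sub (measurableSet_pattern R c)]
    refine (tsub_le_tsub_left (le_siteMeasure_pattern R c) 1).trans ?_
    refine (ENNReal.ofReal_toReal hlt.ne_top).ge.trans ?_
    exact ENNReal.ofReal_le_ofReal (le_max_right _ _)

theorem dependsOnSites_not_pattern (R : ℤ) (c : Site) :
    DependsOnSites {ω | ¬ Pattern R ω c} (box c (2 * R + 4)) :=
  fun _ _ h hω hω' => hω fun y hy => (h y (mem_box.2 hy)).trans (hω' y hy)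

/-- Patterns at positions at distance `4 R + 9` of each other are independent. -/
theorem siteMeasure_forall_not_pattern_le {p : unitInterval} {R : ℤ} (hR : 0 ≤ R) {θ : ℝ}
    (hθ : 0 ≤ θ) (h : ∀ c, siteMeasure p {ω | ¬ Pattern R ω c} ≤ ENNReal.ofReal θ) (x : Site)
    (m : ℕ) : siteMeasure p {ω | ∀ j < m, ¬ Pattern R ω (x.1 + (4 * R + 9) * j, x.2)} ≤
      ENNReal.ofReal (θ ^ m) := by
  classical
  induction m with
  | zero => simp
  | succ m ih =>
    have e : {ω | ∀ j < m + 1, ¬ Pattern R ω (x.1 + (4 * R + 9) * j, x.2)} =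
        {ω | ∀ j < m, ¬ Pattern R ω (x.1 + (4 * R + 9) * j, x.2)} ∩
          {ω | ¬ Pattern R ω (x.1 + (4 * R + 9) * m, x.2)} := by
      ext ω
      exact Nat.forall_lt_succ_right
    rw [e, siteMeasure_inter (S := (Finset.range m).biUnion fun j : ℕ =>
      box (x.1 + (4 * R + 9) * j, x.2) (2 * R + 4)) _ (dependsOnSites_not_pattern _ _) _, pow_succ,
      ENNReal.ofReal_mul (by positivity)]
    · exact mul_le_mul' ih (h _)
    · intro ω ω' hωω' hω j hj
      exact dependsOnSites_not_pattern R _ ω ω' (fun y hy => hωω' y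
        (Finset.mem_biUnion.2 ⟨j, Finset.mem_range.2 hj, hy⟩)) (hω j hj)
    · rw [Finset.disjoint_biUnion_left]
      intro j hj
      rw [Finset.disjoint_left]
      intro y hy hy'
      have h1 := rad_le_iff.1 (mem_box.1 hy)
      have h2 := rad_le_iff.1 (mem_box.1 hy')
      simp only [Finset.mem_range] at hj h1 h2
      have h3 : (4 * R + 9) * ((j : ℤ) + 1) ≤ (4 * R + 9) * m :=
        mul_le_mul_of_nonneg_left (by omega) (by omega)
      rw [mul_add] at h3
      omega

theorem summable_pow_div {θ : ℝ} (h0 : 0 < θ) (h1 : θ < 1) {D : ℕ} (hD : 0 < D) :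
    Summable fun x : Site => θ ^ ((rad 0 x).toNat / D) := by
  obtain ⟨κ, hκ0, hκ1, hκ⟩ : ∃ κ : ℝ, 0 < κ ∧ κ < 1 ∧ κ ^ (2 * D) = θ := by
    refine ⟨θ ^ ((2 * D : ℕ) : ℝ)⁻¹, by positivity, Real.rpow_lt_one h0.le h1 (by positivity),
      Real.rpow_inv_natCast_pow h0.le (by omega)⟩
  have hs : Summable fun a : ℤ => κ ^ a.natAbs := by
    have := summable_geometric_of_lt_one hκ0.le hκ1
    exact Summable.of_nat_of_neg (by simpa using this) (by simpa using this)
  have hs2 := (hs.mul_of_nonneg hs (fun _ => by positivity) (fun _ => by positivity)).mul_left θ⁻¹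
  refine hs2.of_nonneg_of_le (fun x => by positivity) fun x => ?_
  set n := (rad 0 x).toNat with hn
  have h2 := rad_le_iff.1 (le_refl (rad 0 x))
  simp only [Prod.fst_zero, Prod.snd_zero] at h2
  have h3 : x.1.natAbs + x.2.natAbs ≤ 2 * n := by omega
  -- `θ * θ ^ (n / D) ≤ κ ^ (2 n)`, since the integer division loses less than one
  have h4 : 2 * n ≤ 2 * D + 2 * D * (n / D) := by
    have := Nat.lt_div_mul_add (a := n) hD
    nlinarith [Nat.div_add_mod n D, Nat.mod_lt n hD]
  rw [← div_eq_inv_mul, le_div_iff₀ h0, mul_comm, ← pow_add]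
  calc θ * θ ^ (n / D) = κ ^ (2 * D + 2 * D * (n / D)) := by rw [pow_add, pow_mul _ (2 * D), hκ]
    _ ≤ κ ^ (x.1.natAbs + x.2.natAbs) :=
      pow_le_pow_of_le_one hκ0.le hκ1.le (h3.trans h4)

/-- Patterns occur near every site, at a distance which is negligible with respect to the distance
to the origin. -/
theorem ae_denselyIsolated {p : unitInterval} (hp0 : p ≠ 0) (hp1 : p ≠ 1) {R : ℤ} (hR : 0 ≤ R) :
    ∀ᵐ ω ∂siteMeasure p, ∀ η : ℝ, 0 < η → ∃ r : ℤ, ∀ x, r ≤ rad 0 x →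
      ∃ c, Pattern R ω c ∧ (rad x c : ℝ) ≤ η * rad 0 x := by
  obtain ⟨θ, hθ0, hθ1, hθ⟩ := exists_siteMeasure_not_pattern_le hp0 hp1 R
  -- By the Borel–Cantelli lemma, for almost all sites `x` there is a pattern on the horizontal line
  -- through `x` at distance at most `|x| / (k + 1)`.
  have key : ∀ k : ℕ, ∀ᵐ ω ∂siteMeasure p, {x : Site | ω ∈ {ω : Config | ∀ j : ℕ,
      j < (rad 0 x).toNat / ((4 * R + 9).toNat * (k + 1)) →
        ¬ Pattern R ω (x.1 + (4 * R + 9) * j, x.2)}}.Finite := by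
    intro k
    refine ae_finite_setOfPred_mem (ne_top_of_le_ne_top (summable_pow_div hθ0 hθ1
      (D := (4 * R + 9).toNat * (k + 1)) ?_).tsum_ofReal_ne_top (ENNReal.tsum_le_tsum fun x =>
        siteMeasure_forall_not_pattern_le hR hθ0.le hθ x _))
    have : 0 < (4 * R + 9).toNat := by omega
    positivity
  filter_upwards [ae_all_iff.2 key] with ω hω η hη
  obtain ⟨k, hk⟩ := exists_nat_one_div_lt hη
  obtain ⟨r, hr⟩ := ((hω k).image (rad 0)).bddAbove
  refine ⟨r + 1, fun x hx => ?_⟩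
  have h1 : x ∉ {x : Site | ω ∈ {ω : Config | ∀ j : ℕ,
      j < (rad 0 x).toNat / ((4 * R + 9).toNat * (k + 1)) →
        ¬ Pattern R ω (x.1 + (4 * R + 9) * j, x.2)}} := fun hx' => by
    have := hr (Set.mem_image_of_mem _ hx')
    omega
  simp only [Set.mem_ofPred_eq, not_forall, not_not] at h1
  obtain ⟨j, hj, hc⟩ := h1
  refine ⟨_, hc, ?_⟩
  have h0 : 0 ≤ rad 0 x := rad_nonneg _ _
  have h2 : rad x (x.1 + (4 * R + 9) * j, x.2) ≤ (4 * R + 9) * j := by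
    have : 0 ≤ (4 * R + 9) * (j : ℤ) := by positivity
    rw [rad_le_iff]
    simp only
    omega
  have h3 : j * ((4 * R + 9).toNat * (k + 1)) ≤ (rad 0 x).toNat :=
    (Nat.mul_le_mul_right _ hj.le).trans (Nat.div_mul_le_self _ _)
  zify at h3
  rw [Int.toNat_of_nonneg h0, Int.toNat_of_nonneg (by omega)] at h3
  have h4 : (rad x (x.1 + (4 * R + 9) * j, x.2) : ℝ) * (k + 1) ≤ rad 0 x := by
    have : rad x (x.1 + (4 * R + 9) * j, x.2) * ((k : ℤ) + 1) ≤ rad 0 x :=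
      (mul_le_mul_of_nonneg_right h2 (by positivity)).trans (by linarith)
    exact_mod_cast this
  calc (rad x (x.1 + (4 * R + 9) * j, x.2) : ℝ) ≤ 1 / (k + 1) * rad 0 x := by
        rw [one_div, ← div_eq_inv_mul, le_div_iff₀ (by positivity)]
        exact h4
    _ ≤ η * rad 0 x := mul_le_mul_of_nonneg_right hk.le (by exact_mod_cast h0)

section

/-! ### The almost sure statement -/

variable {φ : Config → Config} {R : ℤ}

/-- With admissible enhancements nothing opens out of the empty configuration. -/
theorem Admissible.enhanced_empty (h : Admissible φ R) (α : Config) : enhanced φ ∅ α = ∅ := by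
  have hR := h.nonneg
  rw [Set.eq_empty_iff_forall_notMem]
  intro y hy
  obtain ⟨x, -, hx⟩ := (mem_enhanced_iff.1 hy).resolve_left (Set.notMem_empty y)
  have h1 := rad_le_iff.1 (h.rad_le hx)
  have hη := isInducedPath_horizontal (S := (∅ : Config)ᶜ) (x.1 - (R + 2)) y.2 (2 * (R + 2)).toNat
    fun i _ => Set.notMem_empty _
  refine h.notMem_enhanceAt hη (x := x) (k := (y.1 - (x.1 - (R + 2))).toNat)
    (lt_rad_iff.2 ?_) (lt_rad_iff.2 ?_) (by omega) ?_
  · simp only; omega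
  · simp only; omega
  · have : (x.1 - (R + 2) + ((y.1 - (x.1 - (R + 2))).toNat : ℤ), y.2) = y := by
      ext
      · simp only; omega
      · rfl
    rwa [this]

theorem bLoops_eq_empty {ω : Config} (h : ω = ∅ ∨ ω = Set.univ) (δ : ℝ) : bLoops δ ω = ∅ := by
  rw [Set.eq_empty_iff_forall_notMem]
  rintro C ⟨ξ, w, hw, -⟩
  have h3 := hw.three_le_length
  obtain ⟨-, x, y, hx, hy, -⟩ := w.adj_getVert_succ (i := 0) (by omega)
  rcases h with rfl | rfl
  · exact hx
  · exact hy (Set.mem_univ y)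

theorem loopDist_empty : loopDist ∅ ∅ = 0 :=
  le_antisymm (sInf_le ⟨fun _ h => h.elim, fun _ h => h.elim⟩) bot_le

/-- The convergence of the distances between the loop collections holds at every density `p`. -/
theorem ae_tendsto_loopDist (h : Admissible φ R) (p s : unitInterval) :
    ∀ᵐ x : Config × Config ∂((siteMeasure p).prod (siteMeasure s)),
      Tendsto (fun δ : ℝ => loopDist (bLoops δ x.1) (bLoops δ (enhanced φ x.1 x.2)))
        (𝓝[>] 0) (𝓝 0) := by
  refine (Measure.quasiMeasurePreserving_fst.ae (p := fun ω => ∀ α, Tendsto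
    (fun δ : ℝ => loopDist (bLoops δ ω) (bLoops δ (enhanced φ ω α))) (𝓝[>] 0) (𝓝 0)) ?_).mono
      fun x hx => hx x.2
  have htriv : ∀ ω, ω = ∅ ∨ ω = Set.univ → ∀ α, Tendsto
      (fun δ : ℝ => loopDist (bLoops δ ω) (bLoops δ (enhanced φ ω α))) (𝓝[>] 0) (𝓝 0) := by
    intro ω hω α
    have hE : enhanced φ ω α = ω := by
      rcases hω with rfl | rfl
      · exact h.enhanced_empty α
      · exact Set.univ_subset_iff.1 subset_enhanced
    simp only [hE, bLoops_eq_empty hω, loopDist_empty]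
    exact tendsto_const_nhds
  by_cases hp0 : p = 0
  · rw [hp0, siteMeasure, setBernoulli_zero, ae_dirac_eq]
    exact htriv _ (Or.inl rfl)
  by_cases hp1 : p = 1
  · rw [hp1, siteMeasure, setBernoulli_one, ae_dirac_eq]
    exact htriv _ (Or.inr rfl)
  filter_upwards [ae_denselyIsolated hp0 hp1 h.nonneg] with ω hω α
  refine tendsto_loopDist_of_denselyIsolated h (fun η hη => ?_) fun η hη => ?_
  · obtain ⟨r, hr⟩ := hω η hη
    exact ⟨r, fun x hx => (hr x hx).imp fun c hc => ⟨hc.1.isolated h.nonneg, hc.2⟩⟩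
  · obtain ⟨r, hr⟩ := hω η hη
    exact ⟨r, fun x hx => (hr x hx).imp fun c hc => ⟨hc.1.isolated_enhanced h, hc.2⟩⟩

end

end EnhPerc

end

theorem mainTheorem10 (φ : EnhPerc.Config → EnhPerc.Config) (R₀ : ℝ)
    (hφ : EnhPerc.IsEnhancementFunction φ R₀) (hmono : Monotone φ)
    (hness : ¬ EnhPerc.IsEssential φ) (s : unitInterval) :
    ∀ᵐ x : EnhPerc.Config × EnhPerc.Config
        ∂((EnhPerc.siteMeasure EnhPerc.criticalProb).prod (EnhPerc.siteMeasure s)),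
      Tendsto
        (fun δ : ℝ => EnhPerc.loopDist (EnhPerc.bLoops δ x.1)
          (EnhPerc.bLoops δ (EnhPerc.enhanced φ x.1 x.2)))
        (𝓝[>] 0) (𝓝 0) := by
  obtain ⟨R, hR⟩ := EnhPerc.exists_admissible hφ hmono hness
  exact EnhPerc.ae_tendsto_loopDist hR EnhPerc.criticalProb s
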